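/- Let $N\ge n\ge 2$, $1<p<N$, $p^*=\frac{Np}{N-p}$, and let $\Omega\subseteq\mathbb R^N$ be open. For $\xi\in\mathbb R^{n\times N}$ with rows $\xi^1,\dots,\xi^n$ let $(\mathrm{adj}_{n-1}\xi)^\alpha$ be the vector of all $(n-1)\times(n-1)$ minors of $\xi$ that do not involve the row $\alpha$. Consider $$J(u,\Omega)=\int_\Omega \sum_{\alpha=1}^n f_\alpha(x,u^\alpha,\nabla u^\alpha)+G(x,u,\nabla u)\,dx,\qquad G(x,u,\xi)=\sum_{\alpha=1}^n G_\alpha\bigl(x,u,(\mathrm{adj}_{n-1}\xi)^\alpha\bigr),$$ and let $0<\epsilon<\frac pN$. Assume: (H.1.1) each $f_\alpha:\Omega\times\mathbb R\times\mathbb R^N\to\mathbb R$ is a Carathéodory function and, for a.e. $x\in\Omega$, all $s\in\mathbb R$ and all $\zeta\in\mathbb R^N$, $$|\zeta|^p-b_\alpha(x)|s|^{\gamma_\alpha}-a_\alpha(x)\le f_\alpha(x,s,\zeta)\le L_\alpha\bigl(|\zeta|^p+b_\alpha(x)|s|^{\gamma_\alpha}+a_\alpha(x)\bigr),$$ where $L_\alpha>1$,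 $p\le\gamma_\alpha<p^*$, $\gamma_\alpha+\epsilon p^*<p^*$, $a_\alpha,b_\alpha\ge0$, $b_\alpha\in L^{\sigma_\alpha}_{loc}(\Omega)$ with $\sigma_\alpha=\frac{p^*}{p^*-\gamma_\alpha-\epsilon p^*}$, and $a_\alpha\in L^{\kappa}_{loc}(\Omega)$ with $\kappa=\frac{N}{p-\epsilon N}$; (H.1.2) $G$ is a Carathéodory function and $|G(x,u,\xi)|\le C\left(|\xi|^q+|u|^q+a(x)\right)$ for a.e. $x\in\Omega$ and all $u\in\mathbb R^n$, $\xi\in\mathbb R^{n\times N}$, where $C>1$, $1\le q<\frac{p^2}{N}$, $a\ge0$ and $a\in L^\kappa_{loc}(\Omega)$; (H.2.3) each $G_\alpha$ is a Carathéodory function, convex in its last argument, and $0\le G_\alpha(x,0,(\mathrm{adj}_{n-1}\xi)^\alpha)\le k_4|(\mathrm{adj}_{n-1}\xi)^\alpha|^r+a'(x)$ for a.e. $x\in\Omega$ and all $\xi$, where $k_4>0$, $1\le r<\frac p{n-1}$, $a'\ge0$ and $a'\in L^{\tau}_{loc}(\Omega)$ for some $\tau\in[1,\infty]$; (H.2.4)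 for every $\alpha$, a.e. $x\in\Omega$ and all $u,v\in\mathbb R^n$, $\xi\in\mathbb R^{n\times N}$, $$|G_\alpha(x,u,(\mathrm{adj}_{n-1}\xi)^\alpha)-G_\alpha(x,v,(\mathrm{adj}_{n-1}\xi)^\alpha)|\le c(x)\,|(\mathrm{adj}_{n-1}\xi)^\alpha|^\delta|u-v|^\beta,$$ where $0<\delta<\frac r{n-1}$, $0<\beta<\min\left\{\frac{p^*(r-(n-1)\delta)}r,1\right\}$, $c\ge0$, $c\in L^\sigma_{loc}(\Omega)$ with $\sigma>\frac{p^*r}{p^*(r-(n-1)\delta)-\beta r}$, and $\frac{(n-1)\delta}p+\frac\beta{p^*}+\frac1\sigma<\frac pN$; or (H.2.4 bis) the same with $c\in L^\infty_{loc}(\Omega)$ and $\frac{(n-1)\delta}p+\frac\beta{p^*}<\frac pN$ in place of the conditions involving $\sigma$. Let $u\in W^{1,p}_{loc}(\Omega,\mathbb R^n)$ be a local minimizer of $J$, i.e. its energy density is integrable on compact subsets of $\Omega$ and $J(u,S)\le J(u+\varphi,S)$ for every compact $S\subset\Omega$ and every $\varphi\in W^{1,p}$ with support in $S$ for which the energy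 of $u+\varphi$ on $S$ is finite. Put $\epsilon'=\min\left\{\epsilon,\frac pN-\frac qp\right\}>0$. Then for every compact $K\subset\Omega$ there are constants $C_{C,1},C_{C,2}>0$ and a radius $R_0>0$ such that for every $x_0\in K$ one has $\overline{B_{R_0}(x_0)}\subset\Omega$ and, for every $\alpha=1,\dots,n$, all $0<\varrho<R<R_0$ and every $k\in\mathbb R$, $$\int_{A^\alpha_{k,\varrho}}|\nabla u^\alpha|^p\,dx\le\frac{C_{C,1}}{(R-\varrho)^p}\int_{A^\alpha_{k,R}}(u^\alpha-k)^p\,dx+C_{C,2}\bigl(1+|k|^pR^{-\epsilon' N}\bigr)|A^\alpha_{k,R}|^{1-\frac pN+\epsilon'}$$ and $$\int_{B^\alpha_{k,\varrho}}|\nabla u^\alpha|^p\,dx\le\frac{C_{C,1}}{(R-\varrho)^p}\int_{B^\alpha_{k,R}}(k-u^\alpha)^p\,dx+C_{C,2}\bigl(1+|k|^pR^{-\epsilon' N}\bigr)|B^\alpha_{k,R}|^{1-\frac pN+\epsilon'},$$ where $A^\alpha_{k,s}=\{u^\alpha>k\}\cap B_s(x_0)$ and $B^\alpha_{k,s}=\{u^\alpha<k\}\cap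 B_s(x_0)$. -/

import Mathlib

open MeasureTheory Set
open scoped ENNReal ContDiff

noncomputable section

/-- The space of `n × N` real matrices (row `α` is the gradient of the `α`-th component),
with the Euclidean (Frobenius) norm. -/
abbrev GradMat (n N : ℕ) : Type :=
  PiLp 2 (fun _ : Fin n => EuclideanSpace ℝ (Fin N))

/-- The Sobolev conjugate exponent `p* = N p / (N - p)`. -/
def sobolevConj (N : ℕ) (p : ℝ) : ℝ := N * p / (N - p)

/-- `v ∈ L^s_loc(Ω)`: `v` is in `L^s` on every compact subset of `Ω`. -/
def MemLpLoc {N : ℕ} {Y : Type*} [NormedAddCommGroup Y] (Ω : Set (EuclideanSpace ℝ (Fin N)))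
    (s : ℝ≥0∞) (v : EuclideanSpace ℝ (Fin N) → Y) : Prop :=
  ∀ K : Set (EuclideanSpace ℝ (Fin N)), IsCompact K → K ⊆ Ω →
    MemLp v s (volume.restrict K)

/-- `g` is the weak gradient on `Ω` of the scalar function `v`:
`∫_Ω v ∂ᵢψ = - ∫_Ω gᵢ ψ` for every `ψ ∈ C_c^∞(Ω)` and every `i`. -/
def HasWeakGradient {N : ℕ} (Ω : Set (EuclideanSpace ℝ (Fin N)))
    (v : EuclideanSpace ℝ (Fin N) → ℝ)
    (g : EuclideanSpace ℝ (Fin N) → EuclideanSpace ℝ (Fin N)) : Prop :=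
  ∀ ψ : EuclideanSpace ℝ (Fin N) → ℝ, ContDiff ℝ ∞ ψ → HasCompactSupport ψ →
    tsupport ψ ⊆ Ω → ∀ i : Fin N,
      ∫ x in Ω, v x * fderiv ℝ ψ x (EuclideanSpace.single i 1) = - ∫ x in Ω, g x i * ψ x

/-- `u ∈ W^{1,p}_loc(Ω, ℝⁿ)` with weak gradient (a representative of it) `Du`. -/
structure IsW1pLoc {n N : ℕ} (Ω : Set (EuclideanSpace ℝ (Fin N))) (p : ℝ)
    (u : EuclideanSpace ℝ (Fin N) → EuclideanSpace ℝ (Fin n))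
    (Du : EuclideanSpace ℝ (Fin N) → GradMat n N) : Prop where
  memLp : MemLpLoc Ω (ENNReal.ofReal p) u
  memLp_grad : MemLpLoc Ω (ENNReal.ofReal p) Du
  weakGradient : ∀ α : Fin n, HasWeakGradient Ω (fun x => u x α) (fun x => Du x α)

/-- Carathéodory functions: (Lebesgue) measurable in `x ∈ Ω`, continuous in `y` for a.e. `x`. -/
structure IsCaratheodory {N : ℕ} {Y : Type*} [TopologicalSpace Y]
    (Ω : Set (EuclideanSpace ℝ (Fin N)))
    (F : EuclideanSpace ℝ (Fin N) → Y → ℝ) : Prop where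
  measurable : ∀ y, AEMeasurable (fun x => F x y) (volume.restrict Ω)
  continuous : ∀ᵐ x ∂(volume.restrict Ω), Continuous (F x)

/-- The rows of an `n`-row matrix other than row `α`, in increasing order. -/
def otherRows {n : ℕ} (α : Fin n) : Fin (n - 1) ↪o Fin n :=
  (Finset.univ.erase α).orderEmbOfFin (by simp)

/-- The sets of `n - 1` columns out of `N`. -/
abbrev ColSel (n N : ℕ) : Type := {s : Finset (Fin N) // s.card = n - 1}

/-- `(adj_{n-1} ξ)^α`: the vector of all minors of order `n - 1` of the matrix `ξ` which
do not involve the row `α`. -/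
def adjRow {n N : ℕ} (ξ : GradMat n N) (α : Fin n) : EuclideanSpace ℝ (ColSel n N) :=
  WithLp.toLp 2 fun s =>
    Matrix.det (Matrix.of fun i j : Fin (n - 1) =>
      ξ (otherRows α i) (s.1.orderEmbOfFin s.2 j))

/-- `G(x, u, ξ) = ∑_α G_α(x, u, (adj_{n-1} ξ)^α)`. -/
def polyDensity {n N : ℕ}
    (Gα : Fin n → EuclideanSpace ℝ (Fin N) → EuclideanSpace ℝ (Fin n) →
      EuclideanSpace ℝ (ColSel n N) → ℝ)
    (x : EuclideanSpace ℝ (Fin N)) (s : EuclideanSpace ℝ (Fin n)) (ξ : GradMat n N) : ℝ :=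
  ∑ α, Gα α x s (adjRow ξ α)

/-- The hypotheses on the functions `f_α`. -/
structure HypF {n N : ℕ} (Ω : Set (EuclideanSpace ℝ (Fin N))) (p ε : ℝ)
    (γ L : Fin n → ℝ) (a b : Fin n → EuclideanSpace ℝ (Fin N) → ℝ)
    (f : Fin n → EuclideanSpace ℝ (Fin N) → ℝ → EuclideanSpace ℝ (Fin N) → ℝ) : Prop where
  ε_pos : 0 < ε
  ε_lt : ε < p / N
  one_lt_L : ∀ α, 1 < L α
  p_le_γ : ∀ α, p ≤ γ α
  γ_lt : ∀ α, γ α < sobolevConj N p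
  /-- the exponent `σ_α = p* / (p* - γ_α - ε p*)` of `b_α` makes sense -/
  exponent_pos : ∀ α, 0 < sobolevConj N p - γ α - ε * sobolevConj N p
  a_nonneg : ∀ α, ∀ᵐ x ∂(volume.restrict Ω), 0 ≤ a α x
  b_nonneg : ∀ α, ∀ᵐ x ∂(volume.restrict Ω), 0 ≤ b α x
  b_memLp : ∀ α, MemLpLoc Ω (ENNReal.ofReal
    (sobolevConj N p / (sobolevConj N p - γ α - ε * sobolevConj N p))) (b α)
  a_memLp : ∀ α, MemLpLoc Ω (ENNReal.ofReal (N / (p - ε * N))) (a α)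
  caratheodory : ∀ α, IsCaratheodory Ω
    (fun x (y : ℝ × EuclideanSpace ℝ (Fin N)) => f α x y.1 y.2)
  growth : ∀ α, ∀ᵐ x ∂(volume.restrict Ω), ∀ (s : ℝ) (ξ : EuclideanSpace ℝ (Fin N)),
    ‖ξ‖ ^ p - b α x * |s| ^ γ α - a α x ≤ f α x s ξ ∧
      f α x s ξ ≤ L α * (‖ξ‖ ^ p + b α x * |s| ^ γ α + a α x)

/-- The growth hypotheses on the function `G`. -/
structure HypG {n N : ℕ} (Ω : Set (EuclideanSpace ℝ (Fin N))) (p ε q C : ℝ)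
    (a : EuclideanSpace ℝ (Fin N) → ℝ)
    (G : EuclideanSpace ℝ (Fin N) → EuclideanSpace ℝ (Fin n) → GradMat n N → ℝ) : Prop where
  ε_pos : 0 < ε
  ε_lt : ε < p / N
  one_lt_C : 1 < C
  one_le_q : 1 ≤ q
  q_lt : q < p ^ 2 / N
  a_nonneg : ∀ᵐ x ∂(volume.restrict Ω), 0 ≤ a x
  a_memLp : MemLpLoc Ω (ENNReal.ofReal (N / (p - ε * N))) a
  caratheodory : IsCaratheodory Ω
    (fun x (y : EuclideanSpace ℝ (Fin n) × GradMat n N) => G x y.1 y.2)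
  growth : ∀ᵐ x ∂(volume.restrict Ω), ∀ (s : EuclideanSpace ℝ (Fin n)) (ξ : GradMat n N),
    |G x s ξ| ≤ C * (‖ξ‖ ^ q + ‖s‖ ^ q + a x)

/-- The polyconvex structure hypotheses: convexity and growth of the functions `G_α`. -/
structure HypPoly {n N : ℕ} (Ω : Set (EuclideanSpace ℝ (Fin N))) (p r k₄ : ℝ) (τ : ℝ≥0∞)
    (a : EuclideanSpace ℝ (Fin N) → ℝ)
    (Gα : Fin n → EuclideanSpace ℝ (Fin N) → EuclideanSpace ℝ (Fin n) →
      EuclideanSpace ℝ (ColSel n N) → ℝ) : Prop where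
  two_le_n : 2 ≤ n
  n_le_N : n ≤ N
  k₄_pos : 0 < k₄
  one_le_r : 1 ≤ r
  r_lt : r < p / (n - 1)
  one_le_τ : 1 ≤ τ
  a_nonneg : ∀ᵐ x ∂(volume.restrict Ω), 0 ≤ a x
  a_memLp : MemLpLoc Ω τ a
  caratheodory : ∀ α, IsCaratheodory Ω
    (fun x (y : EuclideanSpace ℝ (Fin n) × EuclideanSpace ℝ (ColSel n N)) => Gα α x y.1 y.2)
  convex : ∀ α, ∀ᵐ x ∂(volume.restrict Ω), ∀ s : EuclideanSpace ℝ (Fin n),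
    ConvexOn ℝ univ (Gα α x s)
  growth : ∀ α, ∀ᵐ x ∂(volume.restrict Ω), ∀ ξ : GradMat n N,
    0 ≤ Gα α x 0 (adjRow ξ α) ∧
      Gα α x 0 (adjRow ξ α) ≤ k₄ * ‖adjRow ξ α‖ ^ r + a x

/-- The part common to both versions of the Hölder hypothesis on `u ↦ G_α(x, u, ·)`. -/
structure HypHolderBase {n N : ℕ} (Ω : Set (EuclideanSpace ℝ (Fin N))) (p r δ β : ℝ)
    (c : EuclideanSpace ℝ (Fin N) → ℝ)
    (Gα : Fin n → EuclideanSpace ℝ (Fin N) → EuclideanSpace ℝ (Fin n) →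
      EuclideanSpace ℝ (ColSel n N) → ℝ) : Prop where
  δ_pos : 0 < δ
  δ_lt : δ < r / (n - 1)
  β_pos : 0 < β
  β_lt : β < min (sobolevConj N p * (r - (n - 1) * δ) / r) 1
  c_nonneg : ∀ᵐ x ∂(volume.restrict Ω), 0 ≤ c x
  holder : ∀ α, ∀ᵐ x ∂(volume.restrict Ω),
    ∀ (s t : EuclideanSpace ℝ (Fin n)) (ξ : GradMat n N),
      |Gα α x s (adjRow ξ α) - Gα α x t (adjRow ξ α)| ≤
        c x * ‖adjRow ξ α‖ ^ δ * ‖s - t‖ ^ β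

/-- The Hölder hypothesis with `c ∈ L^σ_loc`. -/
structure HypHolder {n N : ℕ} (Ω : Set (EuclideanSpace ℝ (Fin N))) (p r δ β σ : ℝ)
    (c : EuclideanSpace ℝ (Fin N) → ℝ)
    (Gα : Fin n → EuclideanSpace ℝ (Fin N) → EuclideanSpace ℝ (Fin n) →
      EuclideanSpace ℝ (ColSel n N) → ℝ) : Prop
    extends HypHolderBase Ω p r δ β c Gα where
  σ_gt : sobolevConj N p * r / (sobolevConj N p * (r - (n - 1) * δ) - β * r) < σ
  c_memLp : MemLpLoc Ω (ENNReal.ofReal σ) c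
  exponents : (n - 1) * δ / p + β / sobolevConj N p + 1 / σ < p / N

/-- The "bis" version of the Hölder hypothesis, with `c ∈ L^∞_loc`. -/
structure HypHolderBis {n N : ℕ} (Ω : Set (EuclideanSpace ℝ (Fin N))) (p r δ β : ℝ)
    (c : EuclideanSpace ℝ (Fin N) → ℝ)
    (Gα : Fin n → EuclideanSpace ℝ (Fin N) → EuclideanSpace ℝ (Fin n) →
      EuclideanSpace ℝ (ColSel n N) → ℝ) : Prop
    extends HypHolderBase Ω p r δ β c Gα where
  c_memLp : MemLpLoc Ω ∞ c
  exponents : (n - 1) * δ / p + β / sobolevConj N p < p / N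

/-- The integrand `∑_α f_α(x, u^α, ∇u^α) + G(x, u, ∇u)` of the functional. -/
def energyDensity {n N : ℕ}
    (f : Fin n → EuclideanSpace ℝ (Fin N) → ℝ → EuclideanSpace ℝ (Fin N) → ℝ)
    (G : EuclideanSpace ℝ (Fin N) → EuclideanSpace ℝ (Fin n) → GradMat n N → ℝ)
    (u : EuclideanSpace ℝ (Fin N) → EuclideanSpace ℝ (Fin n))
    (Du : EuclideanSpace ℝ (Fin N) → GradMat n N) (x : EuclideanSpace ℝ (Fin N)) : ℝ :=
  (∑ α, f α x (u x α) (Du x α)) + G x (u x) (Du x)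

/-- `u ∈ W^{1,p}_loc(Ω, ℝⁿ)`, with weak gradient `Du`, is a local minimizer of
`J(u, Ω) = ∫_Ω ∑_α f_α(x, u^α, ∇u^α) + G(x, u, ∇u) dx`: its energy on compact subsets of `Ω`
is finite, and `J(u, S) ≤ J(u + φ, S)` for every `φ ∈ W^{1,p}` supported in a compact
set `S ⊆ Ω` such that the energy of `u + φ` on `S` is finite. -/
structure IsLocalMinimizer {n N : ℕ} (Ω : Set (EuclideanSpace ℝ (Fin N))) (p : ℝ)
    (f : Fin n → EuclideanSpace ℝ (Fin N) → ℝ → EuclideanSpace ℝ (Fin N) → ℝ)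
    (G : EuclideanSpace ℝ (Fin N) → EuclideanSpace ℝ (Fin n) → GradMat n N → ℝ)
    (u : EuclideanSpace ℝ (Fin N) → EuclideanSpace ℝ (Fin n))
    (Du : EuclideanSpace ℝ (Fin N) → GradMat n N) : Prop where
  isW1pLoc : IsW1pLoc Ω p u Du
  finite_energy : ∀ S : Set (EuclideanSpace ℝ (Fin N)), IsCompact S → S ⊆ Ω →
    IntegrableOn (energyDensity f G u Du) S
  le : ∀ (S : Set (EuclideanSpace ℝ (Fin N)))
    (φ : EuclideanSpace ℝ (Fin N) → EuclideanSpace ℝ (Fin n))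
    (Dφ : EuclideanSpace ℝ (Fin N) → GradMat n N),
    IsCompact S → S ⊆ Ω → IsW1pLoc Ω p φ Dφ → tsupport φ ⊆ S →
    IntegrableOn (energyDensity f G (u + φ) (Du + Dφ)) S →
    ∫ x in S, energyDensity f G u Du x ≤ ∫ x in S, energyDensity f G (u + φ) (Du + Dφ) x

/-- `A_{k,R} = {v > k} ∩ B_R(x₀)`. -/
def superBall {N : ℕ} (v : EuclideanSpace ℝ (Fin N) → ℝ) (x₀ : EuclideanSpace ℝ (Fin N))
    (k R : ℝ) : Set (EuclideanSpace ℝ (Fin N)) :=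
  {x | k < v x} ∩ Metric.ball x₀ R

/-- `B_{k,R} = {v < k} ∩ B_R(x₀)`. -/
def subBall {N : ℕ} (v : EuclideanSpace ℝ (Fin N) → ℝ) (x₀ : EuclideanSpace ℝ (Fin N))
    (k R : ℝ) : Set (EuclideanSpace ℝ (Fin N)) :=
  {x | v x < k} ∩ Metric.ball x₀ R

end

open Filter Topology
open scoped Convolution

/-! The components are tested one at a time. With a cutoff η between concentric balls, the
competitor replaces u^α by u^α − η (u^α − k)₊ and leaves the other components alone, so among the
f's only f_α changes. On the superlevel set A, coercivity of f_α yields the energy of ∇u^α on the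
inner ball, and its growth bound yields a multiple of the same energy on the annulus. G is a
perturbation of growth q < p²/N. It brings in the full gradient, but only through ∫_A |Du|^q ≤
‖Du‖_p^q |A|^{1 − q/p}, and 1 − q/p ≥ 1 − p/N + ε', so the coupling of the components costs no more
than the final measure term. This is `IsLocalMinimizer.exists_energy_inequality`, resting on the
pointwise `energyDensity_competitor_sub_le`.

Three difficulties remain. The annulus energy is removed by hole filling: moving Λ times the inner
energy to the left gives Φ(s) ≤ θ Φ(t) + … with θ < 1, which `exists_iteration_bound` iterates away.

The term ∫ b (u^α − k)^γ may have γ > p. Hölder's inequality with 1/σ + γ/p* + ε = 1 and the Sobolev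
inequality bound it by |A|^ε times a gradient energy (`exists_integral_mul_rpow_superBall_le`),
which is absorbed once the radius is small.

The constants must not depend on k, although |k|^γ occurs where |k|^p is wanted. If |k|^p |A|^{1 −
p/N} stays below a fixed B, the excess power is harmless (`exists_lower_order_le`). If it does not,
`le_integral_superBall_of_lt` shows that ∫_A (u^α − k)^p is at least a multiple of R^p; the
inequality then holds trivially, with the total energy on a compact neighbourhood built into the
constant.

Sublevel sets follow by reflecting u. The Sobolev tools, namely truncation and the inequality for
compactly supported functions, come from mollification. -/

/-! ### Mollification of Sobolev functions. -/

/-- Young's inequality for the convolution with a kernel of mass one. -/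
theorem lintegral_enorm_convolution_rpow_le {N : ℕ} {Y : Type*} [NormedAddCommGroup Y]
    [NormedSpace ℝ Y] {ρ : EuclideanSpace ℝ (Fin N) → ℝ} {h : EuclideanSpace ℝ (Fin N) → Y}
    (hρ : Continuous ρ) (hρ1 : ∫⁻ t, ‖ρ t‖ₑ = 1) (hh : AEStronglyMeasurable h volume)
    {p : ℝ} (hp : 1 ≤ p) :
    ∫⁻ x, ‖(ρ ⋆[ContinuousLinearMap.lsmul ℝ ℝ] h) x‖ₑ ^ p ≤ ∫⁻ x, ‖h x‖ₑ ^ p := by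
  have hp0 : 0 < p := by linarith
  have hprod : AEMeasurable
      (fun z : EuclideanSpace ℝ (Fin N) × EuclideanSpace ℝ (Fin N) => ‖h (z.1 - z.2)‖ₑ)
      (volume.prod volume) :=
    (hh.comp_quasiMeasurePreserving
      (quasiMeasurePreserving_sub_of_right_invariant volume volume)).enorm
  have hsec : ∀ x, AEMeasurable (fun t => ‖h (x - t)‖ₑ) volume := fun x =>
    (hh.comp_quasiMeasurePreserving (quasiMeasurePreserving_sub_left volume x)).enorm
  have hρm : Measurable fun t => ‖ρ t‖ₑ := hρ.measurable.enorm
  have key : ∀ x, ‖(ρ ⋆[ContinuousLinearMap.lsmul ℝ ℝ] h) x‖ₑ ^ p ≤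
      ∫⁻ t, ‖ρ t‖ₑ * ‖h (x - t)‖ₑ ^ p := by
    intro x
    have h1 : ‖(ρ ⋆[ContinuousLinearMap.lsmul ℝ ℝ] h) x‖ₑ ≤ ∫⁻ t, ‖ρ t‖ₑ * ‖h (x - t)‖ₑ := by
      rw [convolution_def]
      refine (enorm_integral_le_lintegral_enorm _).trans (le_of_eq ?_)
      refine lintegral_congr fun t => ?_
      simp [enorm_smul]
    -- Hölder for |ρ||h| = (|ρ||h|^p)^{1/p} · |ρ|^{1 − 1/p}: the second factor integrates to one.
    -- The weight 1 − 1/p may be zero, so p = 1 is included.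
    have h2 : ∫⁻ t, ‖ρ t‖ₑ * ‖h (x - t)‖ₑ ≤ (∫⁻ t, ‖ρ t‖ₑ * ‖h (x - t)‖ₑ ^ p) ^ (1 / p) := by
      have := ENNReal.lintegral_mul_norm_pow_le (μ := volume)
        (f := fun t => ‖ρ t‖ₑ * ‖h (x - t)‖ₑ ^ p) (g := fun t => ‖ρ t‖ₑ)
        (hρm.aemeasurable.mul ((hsec x).pow_const p)) hρm.aemeasurable
        (p := 1 / p) (q := 1 - 1 / p) (by positivity)
        (by rw [sub_nonneg, div_le_one hp0]; exact hp) (by ring)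
      rw [hρ1, ENNReal.one_rpow, mul_one] at this
      refine le_trans (le_of_eq (lintegral_congr fun t => ?_)) this
      rw [ENNReal.mul_rpow_of_nonneg _ _ (by positivity), ← ENNReal.rpow_mul,
        mul_one_div_cancel hp0.ne', ENNReal.rpow_one, mul_right_comm,
        ← ENNReal.rpow_add_of_nonneg _ _ (by positivity)
          (by rw [sub_nonneg, div_le_one hp0]; exact hp)]
      simp
    calc _ ≤ ((∫⁻ t, ‖ρ t‖ₑ * ‖h (x - t)‖ₑ ^ p) ^ (1 / p)) ^ p := by
          gcongr
          exact h1.trans h2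
      _ = _ := by rw [← ENNReal.rpow_mul, one_div_mul_cancel hp0.ne', ENNReal.rpow_one]
  calc _ ≤ ∫⁻ x, ∫⁻ t, ‖ρ t‖ₑ * ‖h (x - t)‖ₑ ^ p := lintegral_mono key
    _ = ∫⁻ t, ∫⁻ x, ‖ρ t‖ₑ * ‖h (x - t)‖ₑ ^ p := by
        rw [lintegral_lintegral_swap]
        exact (hρm.comp measurable_snd).aemeasurable.mul (hprod.pow_const p)
    _ = ∫⁻ t, ‖ρ t‖ₑ * ∫⁻ x, ‖h x‖ₑ ^ p := by
        refine lintegral_congr fun t => ?_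
        rw [lintegral_const_mul'' , lintegral_sub_right_eq_self (fun x => ‖h x‖ₑ ^ p)]
        exact ((hh.comp_quasiMeasurePreserving
          (measurePreserving_sub_right volume t).quasiMeasurePreserving).enorm).pow_const p
    _ = _ := by rw [lintegral_mul_const _ hρm, hρ1, one_mul]

/-- A sequence of integrable functions converging almost everywhere, with norms bounded by the norm
of the limit, converges in `L¹`. -/
theorem tendsto_lintegral_enorm_sub_of_ae_of_le {X Y : Type*} [MeasurableSpace X]
    [NormedAddCommGroup Y] {μ : Measure X} {g : ℕ → X → Y} {h : X → Y}
    (hg : ∀ j, AEStronglyMeasurable (g j) μ) (hh : Integrable h μ)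
    (hlim : ∀ᵐ x ∂μ, Tendsto (fun j => g j x) atTop (𝓝 (h x)))
    (hle : ∀ j, ∫⁻ x, ‖g j x‖ₑ ∂μ ≤ ∫⁻ x, ‖h x‖ₑ ∂μ) :
    Tendsto (fun j => ∫⁻ x, ‖g j x - h x‖ₑ ∂μ) atTop (𝓝 0) := by
  have hhfin : ∫⁻ x, ‖h x‖ₑ ∂μ ≠ ⊤ := hh.2.ne
  have hgi : ∀ j, Integrable (g j) μ := fun j => ⟨hg j, lt_of_le_of_lt (hle j) hh.2⟩
  set a : ℝ := ∫ x, ‖h x‖ ∂μ with ha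
  have hle' : ∀ j, ∫ x, ‖g j x‖ ∂μ ≤ a := fun j => by
    rw [ha, integral_norm_eq_lintegral_enorm (hg j), integral_norm_eq_lintegral_enorm hh.1]
    exact ENNReal.toReal_mono hhfin (hle j)
  -- ‖g_j‖ + ‖h‖ − ‖g_j − h‖ is nonnegative and tends to 2‖h‖. Capping it at 2‖h‖ supplies the
  -- dominating function that the g_j themselves lack, and the cap can only weaken the bound `hup`
  -- in the permitted direction.
  have hmin : Tendsto (fun j => ∫ x, (‖g j x‖ + ‖h x‖ - ‖g j x - h x‖) ⊓ (2 * ‖h x‖) ∂μ) atTop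
      (𝓝 (∫ x, 2 * ‖h x‖ ∂μ)) := by
    refine tendsto_integral_of_dominated_convergence (fun x => 2 * ‖h x‖) ?_
      (hh.norm.const_mul 2) ?_ ?_
    · intro j
      exact (((hg j).norm.add hh.1.norm).sub ((hg j).sub hh.1).norm).inf
        (hh.1.norm.const_mul 2)
    · intro j
      refine ae_of_all _ fun x => ?_
      have h1 : ‖g j x - h x‖ ≤ ‖g j x‖ + ‖h x‖ := norm_sub_le _ _
      rw [Real.norm_of_nonneg (le_inf (by linarith) (by positivity))]
      exact inf_le_right
    · filter_upwards [hlim] with x hx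
      have h1 : Tendsto (fun j => (‖g j x‖ + ‖h x‖ - ‖g j x - h x‖) ⊓ (2 * ‖h x‖)) atTop
          (𝓝 ((‖h x‖ + ‖h x‖ - ‖h x - h x‖) ⊓ (2 * ‖h x‖))) :=
        ((hx.norm.add_const _).sub (hx.sub_const _).norm).inf_nhds tendsto_const_nhds
      simpa [← two_mul] using h1
  have hup : ∀ j, ∫ x, ‖g j x - h x‖ ∂μ ≤
      2 * a - ∫ x, (‖g j x‖ + ‖h x‖ - ‖g j x - h x‖) ⊓ (2 * ‖h x‖) ∂μ := by
    intro j
    have i1 : Integrable (fun x => ‖g j x‖ + ‖h x‖ - ‖g j x - h x‖) μ :=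
      ((hgi j).norm.add hh.norm).sub ((hgi j).sub hh).norm
    have i2 : ∫ x, (‖g j x‖ + ‖h x‖ - ‖g j x - h x‖) ⊓ (2 * ‖h x‖) ∂μ ≤
        ∫ x, (‖g j x‖ + ‖h x‖ - ‖g j x - h x‖) ∂μ :=
      integral_mono (i1.inf (hh.norm.const_mul 2)) i1 fun x => inf_le_left
    have i3 : ∫ x, (‖g j x‖ + ‖h x‖ - ‖g j x - h x‖) ∂μ =
        ∫ x, ‖g j x‖ ∂μ + a - ∫ x, ‖g j x - h x‖ ∂μ := by
      have e1 := integral_sub ((hgi j).norm.add hh.norm) ((hgi j).sub hh).norm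
      have e2 := integral_add (hgi j).norm hh.norm
      simp only [Pi.add_apply, Pi.sub_apply] at e1 e2
      rw [e1, e2]
    linarith [hle' j]
  have hreal : Tendsto (fun j => ∫ x, ‖g j x - h x‖ ∂μ) atTop (𝓝 0) := by
    refine squeeze_zero (fun j => integral_nonneg fun x => norm_nonneg _) hup ?_
    have := hmin.const_sub (2 * a)
    rwa [integral_const_mul, ← ha, sub_self] at this
  have := (ENNReal.tendsto_ofReal hreal)
  rw [ENNReal.ofReal_zero] at this
  refine this.congr fun j => ?_
  have e1 := integral_norm_eq_lintegral_enorm ((hg j).sub hh.1)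
  have e2 := ((hgi j).sub hh).2.ne
  simp only [Pi.sub_apply] at e1 e2
  rw [e1, ENNReal.ofReal_toReal e2]

/-- The derivative of the mollification is the mollification of the weak gradient. -/
theorem HasWeakGradient.fderiv_convolution {N : ℕ} {V : EuclideanSpace ℝ (Fin N) → ℝ}
    {h : EuclideanSpace ℝ (Fin N) → EuclideanSpace ℝ (Fin N)}
    (hw : HasWeakGradient univ V h) (hV : LocallyIntegrable V volume)
    (hh : LocallyIntegrable h volume) {ρ : EuclideanSpace ℝ (Fin N) → ℝ}
    (hρ : ContDiff ℝ ∞ ρ) (hρc : HasCompactSupport ρ) (x : EuclideanSpace ℝ (Fin N)) (i : Fin N) :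
    fderiv ℝ (ρ ⋆[ContinuousLinearMap.lsmul ℝ ℝ] V) x (EuclideanSpace.single i 1) =
      (ρ ⋆[ContinuousLinearMap.lsmul ℝ ℝ] h) x i := by
  have hρcont := hρ.continuous
  have hd : Continuous (fderiv ℝ ρ) := hρ.continuous_fderiv (by simp)
  have hdc : HasCompactSupport (fderiv ℝ ρ) := hρc.fderiv ℝ
  have h1 := hρc.hasFDerivAt_convolution_right (ContinuousLinearMap.lsmul ℝ ℝ).flip hV
    (hρ.of_le (by simp)) x
  rw [convolution_flip] at h1
  have hint2 : Integrable (fun t => ContinuousLinearMap.lsmul ℝ ℝ (ρ t) (h (x - t))) :=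
    hρc.convolutionExists_left (μ := volume) (ContinuousLinearMap.lsmul ℝ ℝ) hρcont hh x
  -- The weak gradient is tested against the reflected kernel; the minus sign from differentiating
  -- ρ(x − y) in y cancels the one in the definition.
  have hψ : ContDiff ℝ ∞ fun y => ρ (x - y) := hρ.comp (contDiff_const.sub contDiff_id)
  have hψc : HasCompactSupport fun y => ρ (x - y) :=
    hρc.comp_homeomorph (Homeomorph.subLeft x)
  have hψd : ∀ y, fderiv ℝ (fun y => ρ (x - y)) y (EuclideanSpace.single i 1) =
      - fderiv ℝ ρ (x - y) (EuclideanSpace.single i 1) := fun y => by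
    have := ((hρ.differentiable (by simp) (x - y)).hasFDerivAt.comp y
      ((hasFDerivAt_id y).const_sub x)).fderiv
    simp only [Function.comp_def] at this
    rw [this]
    simp
  have hwi := hw _ hψ hψc (subset_univ _) i
  simp only [hψd, mul_neg, integral_neg, neg_inj, Measure.restrict_univ] at hwi
  have e2 : ((ρ ⋆[ContinuousLinearMap.lsmul ℝ ℝ] h) x) i = ∫ y, h y i * ρ (x - y) := by
    have := ((EuclideanSpace.proj i : EuclideanSpace ℝ (Fin N) →L[ℝ] ℝ).integral_comp_comm hint2)
    rw [convolution_def]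
    refine Eq.trans this.symm ?_
    rw [← integral_sub_left_eq_self _ _ x]
    refine integral_congr_ae (ae_of_all _ fun y => ?_)
    simp [mul_comm]
  rw [h1.fderiv, convolution_precompR_apply _ hV hdc hd, e2, ← hwi, convolution_def]
  refine integral_congr_ae (ae_of_all _ fun y => ?_)
  simp [mul_comm]

/-- By linearity T is the inner product with g, and Cauchy–Schwarz applies. It links the operator
norm of the derivative in the classical Sobolev inequality to the Euclidean norm of the mollified
gradient. -/
theorem norm_le_of_apply_single_eq {N : ℕ} {T : EuclideanSpace ℝ (Fin N) →L[ℝ] ℝ}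
    {g : EuclideanSpace ℝ (Fin N)} (hT : ∀ i, T (EuclideanSpace.single i 1) = g i) :
    ‖T‖ ≤ ‖g‖ := by
  refine T.opNorm_le_bound (norm_nonneg _) fun v => ?_
  have h1 : T v = inner ℝ g v := by
    conv_lhs => rw [← (EuclideanSpace.basisFun (Fin N) ℝ).sum_repr v]
    simp only [map_sum, map_smul, EuclideanSpace.basisFun_apply, hT, PiLp.inner_apply]
    exact Finset.sum_congr rfl fun i _ => by simp [mul_comm]
  rw [h1]
  exact norm_inner_le_norm g v

/-- Approximation of a Sobolev function on the whole space by smooth functions. -/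
theorem HasWeakGradient.exists_approx {N : ℕ} {V : EuclideanSpace ℝ (Fin N) → ℝ}
    {h : EuclideanSpace ℝ (Fin N) → EuclideanSpace ℝ (Fin N)}
    (hw : HasWeakGradient univ V h) (hV : Integrable V volume) (hh : Integrable h volume) :
    ∃ (W : ℕ → EuclideanSpace ℝ (Fin N) → ℝ)
      (D : ℕ → EuclideanSpace ℝ (Fin N) → EuclideanSpace ℝ (Fin N)),
      (∀ j, ContDiff ℝ ∞ (W j)) ∧ (∀ j, Continuous (D j)) ∧
      (∀ j x i, fderiv ℝ (W j) x (EuclideanSpace.single i 1) = D j x i) ∧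
      (HasCompactSupport V → ∀ j, HasCompactSupport (W j)) ∧
      (∀ᵐ x, Tendsto (fun j => W j x) atTop (𝓝 (V x))) ∧
      (∀ᵐ x, Tendsto (fun j => D j x) atTop (𝓝 (h x))) ∧
      Tendsto (fun j => ∫⁻ x, ‖W j x - V x‖ₑ) atTop (𝓝 0) ∧
      Tendsto (fun j => ∫⁻ x, ‖D j x - h x‖ₑ) atTop (𝓝 0) ∧
      ∀ p : ℝ, 1 ≤ p → ∀ j, ∫⁻ x, ‖D j x‖ₑ ^ p ≤ ∫⁻ x, ‖h x‖ₑ ^ p := by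
  -- The ratio of outer to inner radius is kept fixed, as a.e. convergence of the convolutions
  -- requires.
  let φ : ℕ → ContDiffBump (0 : EuclideanSpace ℝ (Fin N)) := fun j =>
    ⟨1 / ((j : ℝ) + 1), 2 * (1 / ((j : ℝ) + 1)), by positivity, by
      have : 0 < 1 / ((j : ℝ) + 1) := by positivity
      linarith⟩
  have hφ : Tendsto (fun j => (φ j).rOut) atTop (𝓝 0) := by
    have := (tendsto_one_div_add_atTop_nhds_zero_nat (𝕜 := ℝ)).const_mul 2
    rwa [mul_zero] at this
  have hφ' : ∀ᶠ j in atTop, (φ j).rOut ≤ 2 * (φ j).rIn := Eventually.of_forall fun j => le_rfl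
  have hs : ∀ j, ContDiff ℝ ∞ ((φ j).normed volume) := fun j => (φ j).contDiff_normed
  have hc : ∀ j, HasCompactSupport ((φ j).normed volume) := fun j => (φ j).hasCompactSupport_normed
  have h1 : ∀ j, ∫⁻ t, ‖(φ j).normed volume t‖ₑ = 1 := fun j => by
    have := (φ j).integral_normed (μ := (volume : Measure (EuclideanSpace ℝ (Fin N))))
    rw [integral_eq_lintegral_of_nonneg_ae (ae_of_all _ (φ j).nonneg_normed)
      (φ j).continuous_normed.aestronglyMeasurable] at this
    have h2 : ∀ t, ‖(φ j).normed volume t‖ₑ = ENNReal.ofReal ((φ j).normed volume t) := fun t =>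
      Real.enorm_of_nonneg ((φ j).nonneg_normed t)
    simp only [h2]
    exact (ENNReal.toReal_eq_one_iff _).1 this
  let W := fun j => (φ j).normed volume ⋆[ContinuousLinearMap.lsmul ℝ ℝ] V
  let D := fun j => (φ j).normed volume ⋆[ContinuousLinearMap.lsmul ℝ ℝ] h
  have hWs : ∀ j, ContDiff ℝ ∞ (W j) := fun j =>
    (hc j).contDiff_convolution_left _ (hs j) hV.locallyIntegrable
  have hDs : ∀ j, ContDiff ℝ ∞ (D j) := fun j =>
    (hc j).contDiff_convolution_left _ (hs j) hh.locallyIntegrable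
  have hWl := ContDiffBump.ae_convolution_tendsto_right_of_locallyIntegrable hφ hφ'
    hV.locallyIntegrable
  have hDl := ContDiffBump.ae_convolution_tendsto_right_of_locallyIntegrable hφ hφ'
    hh.locallyIntegrable
  have hWp := fun (p : ℝ) (hp : 1 ≤ p) j => lintegral_enorm_convolution_rpow_le
    (hs j).continuous (h1 j) hV.1 hp
  have hDp := fun (p : ℝ) (hp : 1 ≤ p) j => lintegral_enorm_convolution_rpow_le
    (hs j).continuous (h1 j) hh.1 hp
  refine ⟨W, D, hWs, fun j => (hDs j).continuous, fun j x i => hw.fderiv_convolution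
    hV.locallyIntegrable hh.locallyIntegrable (hs j) (hc j) x i, fun hVc j =>
    HasCompactSupport.convolution _ (hc j) hVc, hWl, hDl, ?_, ?_, hDp⟩
  -- Young's inequality with exponent 1 gives the bound on the norms that upgrades a.e. convergence
  -- to L¹ convergence.
  · exact tendsto_lintegral_enorm_sub_of_ae_of_le
      (fun j => (hWs j).continuous.aestronglyMeasurable) hV hWl
      (fun j => by simpa using hWp 1 le_rfl j)
  · exact tendsto_lintegral_enorm_sub_of_ae_of_le
      (fun j => (hDs j).continuous.aestronglyMeasurable) hh hDl
      (fun j => by simpa using hDp 1 le_rfl j)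

/-! ### Smooth cutoffs and the product rule. -/

/-- The classical gradient of a scalar function, as a vector. -/
noncomputable def vecGrad {N : ℕ} (η : EuclideanSpace ℝ (Fin N) → ℝ) (x : EuclideanSpace ℝ (Fin N)) :
    EuclideanSpace ℝ (Fin N) :=
  WithLp.toLp 2 fun i => fderiv ℝ η x (EuclideanSpace.single i 1)

@[simp] theorem vecGrad_apply {N : ℕ} (η : EuclideanSpace ℝ (Fin N) → ℝ)
    (x : EuclideanSpace ℝ (Fin N)) (i : Fin N) :
    vecGrad η x i = fderiv ℝ η x (EuclideanSpace.single i 1) := rfl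

theorem continuous_vecGrad {N : ℕ} {η : EuclideanSpace ℝ (Fin N) → ℝ} (hη : ContDiff ℝ ∞ η) :
    Continuous (vecGrad η) := by
  refine (PiLp.continuous_toLp 2 _).comp (continuous_pi fun i => ?_)
  exact (hη.continuous_fderiv (by simp)).clm_apply continuous_const

theorem vecGrad_eq_zero_of_notMem_tsupport {N : ℕ} {η : EuclideanSpace ℝ (Fin N) → ℝ}
    {x : EuclideanSpace ℝ (Fin N)} (hx : x ∉ tsupport η) : vecGrad η x = 0 := by
  ext i
  simp [fderiv_of_notMem_tsupport ℝ hx]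

/-- A compact set inside an open set has a smooth cutoff function. -/
theorem exists_smooth_cutoff {N : ℕ} {Ω K : Set (EuclideanSpace ℝ (Fin N))} (hΩ : IsOpen Ω)
    (hK : IsCompact K) (hKΩ : K ⊆ Ω) :
    ∃ χ : EuclideanSpace ℝ (Fin N) → ℝ, ContDiff ℝ ∞ χ ∧ HasCompactSupport χ ∧ tsupport χ ⊆ Ω ∧
      (∀ᶠ x in 𝓝ˢ K, χ x = 1) := by
  obtain ⟨T, hT, hKT, hTΩ⟩ := exists_compact_between hK hΩ hKΩ
  obtain ⟨χ, h1, h0, -⟩ := exists_contMDiffMap_one_nhds_of_subset_interior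
    (n := ⊤) (modelWithCornersSelf ℝ (EuclideanSpace ℝ (Fin N))) hK.isClosed hKT
  have hsub : tsupport χ ⊆ T :=
    closure_minimal (fun x hx => by by_contra hxT; exact hx (h0 x hxT)) hT.isClosed
  exact ⟨χ, χ.contMDiff.contDiff, hT.of_isClosed_subset (isClosed_tsupport _) hsub,
    hsub.trans hTΩ, h1⟩

theorem integrable_mul_of_tsupport_subset {N : ℕ} {Ω : Set (EuclideanSpace ℝ (Fin N))}
    {v ζ : EuclideanSpace ℝ (Fin N) → ℝ} (hv : MemLpLoc Ω 1 v) (hζ : Continuous ζ)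
    (hζc : HasCompactSupport ζ) (hζΩ : tsupport ζ ⊆ Ω) :
    Integrable (fun x => v x * ζ x) volume := by
  have h1 : IntegrableOn v (tsupport ζ) := memLp_one_iff_integrable.1 (hv _ hζc hζΩ)
  have h2 := h1.mul_continuousOn hζ.continuousOn hζc
  refine (integrableOn_iff_integrable_of_support_subset ?_).1 h2
  intro x hx
  exact subset_tsupport _ fun h => hx (by simp [h])

theorem MemLpLoc.mono_exponent {N : ℕ} {Y : Type*} [NormedAddCommGroup Y]
    {Ω : Set (EuclideanSpace ℝ (Fin N))} {s t : ℝ≥0∞} {v : EuclideanSpace ℝ (Fin N) → Y}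
    (hv : MemLpLoc Ω t v) (hst : s ≤ t) : MemLpLoc Ω s v := fun K hK hKΩ => by
  have : IsFiniteMeasure (volume.restrict K) := ⟨by simpa using hK.measure_lt_top⟩
  exact (hv K hK hKΩ).mono_exponent hst

theorem MemLpLoc.apply {n N : ℕ} {Ω : Set (EuclideanSpace ℝ (Fin N))} {s : ℝ≥0∞}
    {v : EuclideanSpace ℝ (Fin N) → EuclideanSpace ℝ (Fin n)} (hv : MemLpLoc Ω s v) (i : Fin n) :
    MemLpLoc Ω s (fun x => v x i) := fun K hK hKΩ => by
  refine (hv K hK hKΩ).mono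
    ((EuclideanSpace.proj (𝕜 := ℝ) i).continuous.comp_aestronglyMeasurable (hv K hK hKΩ).1)
    (ae_of_all _ fun x => PiLp.norm_apply_le _ i)

/-- Product rule: multiplying by a smooth cutoff function supported in `Ω`. -/
theorem HasWeakGradient.cutoff_mul {N : ℕ} {Ω : Set (EuclideanSpace ℝ (Fin N))}
    {v : EuclideanSpace ℝ (Fin N) → ℝ} {g : EuclideanSpace ℝ (Fin N) → EuclideanSpace ℝ (Fin N)}
    (hw : HasWeakGradient Ω v g) (hv : MemLpLoc Ω 1 v) (hg : MemLpLoc Ω 1 g)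
    {η : EuclideanSpace ℝ (Fin N) → ℝ} (hη : ContDiff ℝ ∞ η) (hηc : HasCompactSupport η)
    (hηΩ : tsupport η ⊆ Ω) :
    HasWeakGradient univ (fun x => η x * v x) (fun x => η x • g x + v x • vecGrad η x) := by
  intro ψ hψ hψc _ i
  have hsub : tsupport (fun x => η x * ψ x) ⊆ tsupport η := tsupport_mul_subset_left
  have hζc : HasCompactSupport (fun x => η x * ψ x) := hηc.mul_right
  have hd : ∀ x, fderiv ℝ (fun x => η x * ψ x) x (EuclideanSpace.single i 1) =
      η x * fderiv ℝ ψ x (EuclideanSpace.single i 1) +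
      ψ x * fderiv ℝ η x (EuclideanSpace.single i 1) := fun x => by
    rw [fderiv_fun_mul (hη.differentiable (by simp) x) (hψ.differentiable (by simp) x)]
    simp
  -- η ψ is an admissible test function on Ω; the part ψ ∇η of its derivative produces the extra
  -- term v ∇η of the new gradient.
  have h := hw _ (hη.mul hψ) hζc (hsub.trans hηΩ) i
  simp only [hd] at h
  have hηψ' : Continuous fun x => η x * fderiv ℝ ψ x (EuclideanSpace.single i 1) :=
    hη.continuous.mul ((hψ.continuous_fderiv (by simp)).clm_apply continuous_const)
  have hη'ψ : Continuous fun x => ψ x * fderiv ℝ η x (EuclideanSpace.single i 1) :=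
    hψ.continuous.mul ((hη.continuous_fderiv (by simp)).clm_apply continuous_const)
  have hs1 : tsupport (fun x => η x * fderiv ℝ ψ x (EuclideanSpace.single i 1)) ⊆ tsupport η :=
    tsupport_mul_subset_left
  have hs2 : tsupport (fun x => ψ x * fderiv ℝ η x (EuclideanSpace.single i 1)) ⊆ tsupport η :=
    tsupport_mul_subset_right.trans (tsupport_fderiv_apply_subset ℝ _)
  have i1 := integrable_mul_of_tsupport_subset hv hηψ'
    (hηc.of_isClosed_subset (isClosed_tsupport _) hs1) (hs1.trans hηΩ)
  have i2 := integrable_mul_of_tsupport_subset hv hη'ψ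
    (hηc.of_isClosed_subset (isClosed_tsupport _) hs2) (hs2.trans hηΩ)
  have i3 := integrable_mul_of_tsupport_subset (hg.apply i) (hη.mul hψ).continuous hζc
    (hsub.trans hηΩ)
  rw [setIntegral_eq_integral_of_forall_compl_eq_zero, setIntegral_eq_integral_of_forall_compl_eq_zero]
    at h
  rotate_left
  · intro x hx
    simp [image_eq_zero_of_notMem_tsupport fun h => hx (hηΩ h)]
  · intro x hx
    have hx' : x ∉ tsupport η := fun h => hx (hηΩ h)
    simp [image_eq_zero_of_notMem_tsupport hx', fderiv_of_notMem_tsupport ℝ hx']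
  simp only [Measure.restrict_univ]
  have e1 : ∫ x, v x * (η x * fderiv ℝ ψ x (EuclideanSpace.single i 1) +
      ψ x * fderiv ℝ η x (EuclideanSpace.single i 1)) =
      (∫ x, η x * v x * fderiv ℝ ψ x (EuclideanSpace.single i 1)) +
        ∫ x, v x * (ψ x * fderiv ℝ η x (EuclideanSpace.single i 1)) := by
    rw [← integral_add (i1.congr (ae_of_all _ fun x => by simp only; ring)) i2]
    exact integral_congr_ae (ae_of_all _ fun x => by simp only; ring)
  have e2 : ∫ x, (η x • g x + v x • vecGrad η x) i * ψ x =
      (∫ x, g x i * (η x * ψ x)) +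
        ∫ x, v x * (ψ x * fderiv ℝ η x (EuclideanSpace.single i 1)) := by
    rw [← integral_add i3 i2]
    exact integral_congr_ae (ae_of_all _ fun x => by simp; ring)
  rw [e2]
  linarith

/-! ### Chain rule and truncation. -/

theorem abs_sub_le_of_hasDerivAt {F F' : ℝ → ℝ} (hF : ∀ t, HasDerivAt F (F' t) t)
    (hb : ∀ t, |F' t| ≤ 1) (s t : ℝ) : |F s - F t| ≤ |s - t| := by
  have := Convex.norm_image_sub_le_of_norm_hasDerivWithin_le (s := univ) (f := F) (f' := F')
    (C := 1) (x := t) (y := s) (fun x _ => (hF x).hasDerivWithinAt) (fun x _ => hb x) convex_univ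
    trivial trivial
  simpa using this

/-- Chain rule for a `C¹` function with bounded derivative. -/
theorem HasWeakGradient.comp_of_hasDerivAt {N : ℕ} {V : EuclideanSpace ℝ (Fin N) → ℝ}
    {h : EuclideanSpace ℝ (Fin N) → EuclideanSpace ℝ (Fin N)}
    (hw : HasWeakGradient univ V h) (hV : Integrable V volume) (hh : Integrable h volume)
    {F F' : ℝ → ℝ} (hF : ∀ t, HasDerivAt F (F' t) t) (hF' : Continuous F')
    (hb : ∀ t, |F' t| ≤ 1) :
    HasWeakGradient univ (fun x => F (V x)) (fun x => F' (V x) • h x) := by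
  obtain ⟨W, D, hW, hD, hWD, -, hWae, hDae, hW1, hD1, hDp⟩ := hw.exists_approx hV hh
  intro ψ hψ hψc _ i
  have hFc : Continuous F := continuous_iff_continuousAt.2 fun t => (hF t).continuousAt
  have hψ' : Continuous fun x => fderiv ℝ ψ x (EuclideanSpace.single i 1) :=
    (hψ.continuous_fderiv (by simp)).clm_apply continuous_const
  have hψ'c : HasCompactSupport fun x => fderiv ℝ ψ x (EuclideanSpace.single i 1) :=
    hψc.fderiv_apply ℝ _
  obtain ⟨C, hC⟩ := hψ.continuous.bounded_above_of_compact_support hψc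
  obtain ⟨C', hC'⟩ := hψ'.bounded_above_of_compact_support hψ'c
  simp only [Measure.restrict_univ]
  have hhi : Integrable (fun x => h x i) volume :=
    memLp_one_iff_integrable.1 (((memLp_one_iff_integrable.2 hh).mono
    ((EuclideanSpace.proj (𝕜 := ℝ) i).continuous.comp_aestronglyMeasurable hh.1)
    (ae_of_all _ fun x => PiLp.norm_apply_le _ i)))
  have hFV : Integrable (fun x => F (V x) * fderiv ℝ ψ x (EuclideanSpace.single i 1)) volume := by
    have h1 : Integrable (fun x => (|F 0| + |V x|) * fderiv ℝ ψ x (EuclideanSpace.single i 1)) := by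
      simp only [add_mul]
      exact ((hψ'.integrable_of_hasCompactSupport hψ'c).const_mul _).add
        (hV.abs.mul_bdd hψ'.aestronglyMeasurable (ae_of_all _ hC'))
    refine h1.mono ((hFc.comp_aestronglyMeasurable hV.1).mul hψ'.aestronglyMeasurable)
      (ae_of_all _ fun x => ?_)
    rw [norm_mul, norm_mul]
    gcongr
    have := abs_sub_le_of_hasDerivAt hF hb (V x) 0
    rw [Real.norm_eq_abs, Real.norm_eq_abs, abs_of_nonneg (by positivity : 0 ≤ |F 0| + |V x|)]
    rw [sub_zero] at this
    have h3 := abs_add_le (F 0) (F (V x) - F 0)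
    rw [add_sub_cancel] at h3
    linarith
  -- For the smooth approximations this is the classical chain rule and integration by parts.
  have hcl : ∀ j, ∫ x, F (W j x) * fderiv ℝ ψ x (EuclideanSpace.single i 1) =
      - ∫ x, (F' (W j x) * D j x i) * ψ x := by
    intro j
    have hWd : ∀ x, HasFDerivAt (fun x => F (W j x)) (F' (W j x) • fderiv ℝ (W j) x) x := fun x =>
      (hF (W j x)).comp_hasFDerivAt x ((hW j).differentiable (by simp) x).hasFDerivAt
    have hval : ∀ x, fderiv ℝ (fun x => F (W j x)) x (EuclideanSpace.single i 1) =
        F' (W j x) * D j x i := fun x => by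
      rw [(hWd x).fderiv, ← hWD j x i]; rfl
    have hFW : Continuous fun x => F (W j x) := hFc.comp (hW j).continuous
    have hDi : Continuous fun x => D j x i :=
      (EuclideanSpace.proj (𝕜 := ℝ) i).continuous.comp (hD j)
    have hFD : Continuous fun x => F' (W j x) * D j x i :=
      (hF'.comp (hW j).continuous).mul hDi
    rw [integral_mul_fderiv_eq_neg_fderiv_mul_of_integrable]
    · simp only [hval]
    · simp only [hval]
      exact (hFD.mul hψ.continuous).integrable_of_hasCompactSupport hψc.mul_left
    · exact (hFW.mul hψ').integrable_of_hasCompactSupport hψ'c.mul_left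
    · exact (hFW.mul hψ.continuous).integrable_of_hasCompactSupport hψc.mul_left
    · exact fun x _ => (hWd x).differentiableAt
    · exact fun x _ => hψ.differentiable (by simp) x
  have hlim1 : Tendsto (fun j => ∫ x, F (W j x) * fderiv ℝ ψ x (EuclideanSpace.single i 1)) atTop
      (𝓝 (∫ x, F (V x) * fderiv ℝ ψ x (EuclideanSpace.single i 1))) := by
    refine tendsto_integral_of_L1 _ hFV.1 (Eventually.of_forall fun j => ?_) ?_
    · exact ((hFc.comp (hW j).continuous).mul hψ').integrable_of_hasCompactSupport hψ'c.mul_left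
    · have h0 : Tendsto (fun j => ENNReal.ofReal C' * ∫⁻ x, ‖W j x - V x‖ₑ) atTop (𝓝 0) := by
        simpa using ENNReal.Tendsto.const_mul hW1 (Or.inr ENNReal.ofReal_ne_top)
      refine tendsto_of_tendsto_of_tendsto_of_le_of_le tendsto_const_nhds h0
        (fun j => zero_le) fun j => ?_
      simp only
      rw [← lintegral_const_mul' _ _ ENNReal.ofReal_ne_top]
      refine lintegral_mono fun x => ?_
      rw [← sub_mul, enorm_mul, mul_comm]
      gcongr
      · rw [← ofReal_norm]; exact ENNReal.ofReal_le_ofReal (hC' x)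
      · rw [← ofReal_norm, ← ofReal_norm]
        exact ENNReal.ofReal_le_ofReal (abs_sub_le_of_hasDerivAt hF hb _ _)
  have hF'h : ∀ {U : EuclideanSpace ℝ (Fin N) → ℝ}, AEStronglyMeasurable U volume →
      Integrable (fun x => F' (U x) * h x i * ψ x) volume := fun {U} hU =>
    (hhi.bdd_mul (hF'.comp_aestronglyMeasurable hU) (ae_of_all _ fun x => hb _)).mul_bdd
      hψ.continuous.aestronglyMeasurable (ae_of_all _ hC)
  -- The product F'(W_j) D_j is split as F'(W_j) h + F'(W_j)(D_j − h). The first part converges by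
  -- domination, since F' is continuous and W_j → V a.e.; the second vanishes because |F'| ≤ 1 and
  -- D_j → h in L¹.
  have hlim2 : Tendsto (fun j => ∫ x, F' (W j x) * h x i * ψ x) atTop
      (𝓝 (∫ x, F' (V x) * h x i * ψ x)) := by
    refine tendsto_integral_of_dominated_convergence (fun x => ‖h x i‖ * ‖ψ x‖)
      (fun j => (hF'h (hW j).continuous.aestronglyMeasurable).1) ?_ ?_ ?_
    · exact hhi.norm.mul_bdd hψ.continuous.norm.aestronglyMeasurable
        (ae_of_all _ fun x => by simpa using hC x)
    · refine fun j => ae_of_all _ fun x => ?_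
      rw [norm_mul, norm_mul]
      have := hb (W j x)
      rw [← Real.norm_eq_abs] at this
      gcongr
      exact mul_le_of_le_one_left (norm_nonneg _) this
    · filter_upwards [hWae] with x hx
      exact (((hF'.tendsto _).comp hx).mul_const _).mul_const _
  have hlim3 : Tendsto (fun j => ∫ x, F' (W j x) * (D j x - h x) i * ψ x) atTop (𝓝 0) := by
    have h0 : Tendsto (fun j => (ENNReal.ofReal C * ∫⁻ x, ‖D j x - h x‖ₑ).toReal) atTop (𝓝 0) := by
      have : Tendsto (fun j => (ENNReal.ofReal C * ∫⁻ x, ‖D j x - h x‖ₑ)) atTop (𝓝 0) := by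
        simpa using ENNReal.Tendsto.const_mul hD1 (Or.inr ENNReal.ofReal_ne_top)
      exact (ENNReal.tendsto_toReal ENNReal.zero_ne_top).comp this
    refine squeeze_zero_norm' ?_ h0
    have hfin : ∀ᶠ j in atTop, (∫⁻ x, ‖D j x - h x‖ₑ) < ⊤ :=
      hD1.eventually_lt_const (by simp)
    filter_upwards [hfin] with j hj
    rw [← toReal_enorm]
    refine ENNReal.toReal_mono (ENNReal.mul_lt_top ENNReal.ofReal_lt_top hj).ne ?_
    refine (enorm_integral_le_lintegral_enorm _).trans ?_
    rw [← lintegral_const_mul' _ _ ENNReal.ofReal_ne_top]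
    refine lintegral_mono fun x => ?_
    rw [enorm_mul, enorm_mul, mul_comm]
    gcongr
    · rw [← ofReal_norm]; exact ENNReal.ofReal_le_ofReal (hC x)
    · have h1 : ‖F' (W j x)‖ₑ ≤ 1 := by
        rw [← ofReal_norm, ← ENNReal.ofReal_one]
        exact ENNReal.ofReal_le_ofReal (hb _)
      calc _ ≤ 1 * ‖D j x - h x‖ₑ := by
            gcongr
            rw [← ofReal_norm, ← ofReal_norm]
            exact ENNReal.ofReal_le_ofReal (PiLp.norm_apply_le _ i)
        _ = _ := one_mul _
  have hlim4 : Tendsto (fun j => ∫ x, F' (W j x) * D j x i * ψ x) atTop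
      (𝓝 (∫ x, F' (V x) * h x i * ψ x)) := by
    have := hlim3.add hlim2
    rw [zero_add] at this
    refine this.congr fun j => ?_
    rw [← integral_add _ (hF'h (hW j).continuous.aestronglyMeasurable)]
    · refine integral_congr_ae (ae_of_all _ fun x => ?_)
      simp only [PiLp.sub_apply]; ring
    · have h1 : Integrable (fun x => F' (W j x) * D j x i * ψ x) volume :=
        (((hF'.comp (hW j).continuous).mul
          ((EuclideanSpace.proj (𝕜 := ℝ) i).continuous.comp (hD j))).mul
          hψ.continuous).integrable_of_hasCompactSupport hψc.mul_left
      refine (h1.sub (hF'h (hW j).continuous.aestronglyMeasurable)).congr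
        (ae_of_all _ fun x => ?_)
      simp only [PiLp.sub_apply, Pi.sub_apply]; ring
  have := tendsto_nhds_unique (hlim1.congr hcl) hlim4.neg
  rw [this]
  simp

/-- Positive part of an integrable Sobolev function on the whole space. -/
theorem HasWeakGradient.posPart_univ {N : ℕ} {V : EuclideanSpace ℝ (Fin N) → ℝ}
    {h : EuclideanSpace ℝ (Fin N) → EuclideanSpace ℝ (Fin N)}
    (hw : HasWeakGradient univ V h) (hV : Integrable V volume) (hh : Integrable h volume) (k : ℝ) :
    HasWeakGradient univ (fun x => max (V x - k) 0) ({x | k < V x}.indicator h) := by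
  -- The ramps vanish on (−∞, k], k included, so they converge everywhere to the indicator of the
  -- open half-line. The formula with {k < V} results without knowing that the gradient vanishes
  -- a.e. on {V = k}.
  let F' : ℕ → ℝ → ℝ := fun n s => min 1 (max 0 (n * (s - k)))
  have hF'c : ∀ n, Continuous (F' n) := fun n => by fun_prop
  have hF'0 : ∀ n s, 0 ≤ F' n s := fun n s => le_min zero_le_one (le_max_left _ _)
  have hb : ∀ n s, |F' n s| ≤ 1 := fun n s => by
    rw [abs_of_nonneg (hF'0 n s)]; exact min_le_left _ _
  have hF'lim : ∀ s, Tendsto (fun n => F' n s) atTop (𝓝 ((Ioi k).indicator 1 s)) := by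
    intro s
    by_cases hs : k < s
    · rw [indicator_of_mem (mem_Ioi.2 hs)]
      have h1 : Tendsto (fun n : ℕ => (n : ℝ) * (s - k)) atTop atTop :=
        tendsto_natCast_atTop_atTop.atTop_mul_const (sub_pos.2 hs)
      refine tendsto_const_nhds.congr' ?_
      filter_upwards [h1.eventually_ge_atTop 1] with n hn
      simp only [F', Pi.one_apply]
      rw [min_eq_left (le_max_of_le_right hn)]
    · rw [indicator_of_notMem (by simpa using hs)]
      refine tendsto_const_nhds.congr fun n => ?_
      have : (n : ℝ) * (s - k) ≤ 0 :=
        mul_nonpos_of_nonneg_of_nonpos (Nat.cast_nonneg n) (by linarith)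
      simp [F', max_eq_left this]
  let F : ℕ → ℝ → ℝ := fun n t => ∫ s in k..t, F' n s
  have hF : ∀ n t, HasDerivAt (F n) (F' n t) t := fun n t =>
    intervalIntegral.integral_hasDerivAt_right ((hF'c n).intervalIntegrable _ _)
      ((hF'c n).stronglyMeasurableAtFilter _ _) (hF'c n).continuousAt
  have hFlim : ∀ t, Tendsto (fun n => F n t) atTop (𝓝 (max (t - k) 0)) := by
    intro t
    have h1 : Tendsto (fun n => F n t) atTop (𝓝 (∫ s in k..t, (Ioi k).indicator (1 : ℝ → ℝ) s)) := by
      refine intervalIntegral.tendsto_integral_filter_of_dominated_convergence (fun _ => 1)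
        (Eventually.of_forall fun n => (hF'c n).aestronglyMeasurable)
        (Eventually.of_forall fun n => ae_of_all _ fun s _ => hb n s)
        intervalIntegrable_const (ae_of_all _ fun s _ => hF'lim s)
    convert h1 using 2
    rcases le_total k t with hkt | hkt
    · rw [max_eq_left (by linarith), intervalIntegral.integral_of_le hkt,
        setIntegral_congr_fun (g := fun _ => (1 : ℝ)) measurableSet_Ioc]
      · simp [hkt]
      · intro s hs
        simp [hs.1]
    · rw [max_eq_right (by linarith), intervalIntegral.integral_of_ge hkt,
        setIntegral_congr_fun (g := fun _ => (0 : ℝ)) measurableSet_Ioc]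
      · simp
      · intro s hs
        simp [hs.2]
  have hFle : ∀ n t, |F n t| ≤ |t| + |k| := fun n t => by
    have := abs_sub_le_of_hasDerivAt (hF n) (hb n) t k
    have h0 : F n k = 0 := intervalIntegral.integral_same
    rw [h0, sub_zero] at this
    exact this.trans (abs_sub _ _)
  intro ψ hψ hψc hψu i
  have hcl := fun n => hw.comp_of_hasDerivAt hV hh (hF n) (hF'c n) (hb n) ψ hψ hψc hψu i
  simp only [Measure.restrict_univ] at hcl ⊢
  have hFc : ∀ n, Continuous (F n) := fun n =>
    continuous_iff_continuousAt.2 fun t => (hF n t).continuousAt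
  have hψ' : Continuous fun x => fderiv ℝ ψ x (EuclideanSpace.single i 1) :=
    (hψ.continuous_fderiv (by simp)).clm_apply continuous_const
  have hψ'c : HasCompactSupport fun x => fderiv ℝ ψ x (EuclideanSpace.single i 1) :=
    hψc.fderiv_apply ℝ _
  obtain ⟨C, hC⟩ := hψ.continuous.bounded_above_of_compact_support hψc
  obtain ⟨C', hC'⟩ := hψ'.bounded_above_of_compact_support hψ'c
  have hhim : AEStronglyMeasurable (fun x => h x i) volume :=
    (EuclideanSpace.proj (𝕜 := ℝ) i).continuous.comp_aestronglyMeasurable hh.1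
  have hhi : Integrable (fun x => h x i) volume :=
    hh.mono hhim (ae_of_all _ fun x => PiLp.norm_apply_le _ i)
  have hlim1 : Tendsto (fun n => ∫ x, F n (V x) * fderiv ℝ ψ x (EuclideanSpace.single i 1)) atTop
      (𝓝 (∫ x, max (V x - k) 0 * fderiv ℝ ψ x (EuclideanSpace.single i 1))) := by
    refine tendsto_integral_of_dominated_convergence
      (fun x => (|V x| + |k|) * ‖fderiv ℝ ψ x (EuclideanSpace.single i 1)‖)
      (fun n => ((hFc n).comp_aestronglyMeasurable hV.1).mul hψ'.aestronglyMeasurable) ?_ ?_ ?_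
    · simp only [add_mul]
      exact (hV.abs.mul_bdd hψ'.norm.aestronglyMeasurable
          (ae_of_all _ fun x => by rw [norm_norm]; exact hC' x)).add
        ((hψ'.norm.integrable_of_hasCompactSupport hψ'c.norm).const_mul _)
    · intro n
      refine ae_of_all _ fun x => ?_
      rw [norm_mul]
      gcongr
      exact hFle n (V x)
    · exact ae_of_all _ fun x => (hFlim (V x)).mul_const _
  have hlim2 : Tendsto (fun n => ∫ x, (F' n (V x) • h x) i * ψ x) atTop
      (𝓝 (∫ x, {x | k < V x}.indicator h x i * ψ x)) := by
    refine tendsto_integral_of_dominated_convergence (fun x => ‖h x i‖ * ‖ψ x‖) ?_ ?_ ?_ ?_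
    · intro n
      simp only [PiLp.smul_apply, smul_eq_mul]
      exact (((hF'c n).comp_aestronglyMeasurable hV.1).mul hhim).mul
        hψ.continuous.aestronglyMeasurable
    · exact hhi.norm.mul_bdd hψ.continuous.norm.aestronglyMeasurable
        (ae_of_all _ fun x => by simpa using hC x)
    · refine fun n => ae_of_all _ fun x => ?_
      rw [PiLp.smul_apply, smul_eq_mul, norm_mul, norm_mul]
      gcongr
      exact mul_le_of_le_one_left (norm_nonneg _) (hb n (V x))
    · refine ae_of_all _ fun x => ?_
      have h1 := ((hF'lim (V x)).mul_const (h x i)).mul_const (ψ x)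
      have h2 : (Ioi k).indicator (1 : ℝ → ℝ) (V x) * h x i = {x | k < V x}.indicator h x i := by
        by_cases hx : k < V x
        · rw [indicator_of_mem (mem_Ioi.2 hx), indicator_of_mem (show x ∈ {x | k < V x} from hx)]
          simp
        · rw [indicator_of_notMem (by simpa using hx),
            indicator_of_notMem (show x ∉ {x | k < V x} from hx)]
          simp
      rw [h2] at h1
      exact h1
  exact tendsto_nhds_unique (hlim1.congr hcl) hlim2.neg

/-- Positive part of a locally integrable Sobolev function. -/
theorem HasWeakGradient.posPart {N : ℕ} {Ω : Set (EuclideanSpace ℝ (Fin N))} (hΩ : IsOpen Ω)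
    {v : EuclideanSpace ℝ (Fin N) → ℝ} {g : EuclideanSpace ℝ (Fin N) → EuclideanSpace ℝ (Fin N)}
    (hw : HasWeakGradient Ω v g) (hv : MemLpLoc Ω 1 v) (hg : MemLpLoc Ω 1 g) (k : ℝ) :
    HasWeakGradient Ω (fun x => max (v x - k) 0) ({x | k < v x}.indicator g) := by
  intro ψ hψ hψc hψΩ i
  -- χ equals 1 near the support of ψ, so χ v and v are indistinguishable to ψ, while χ v is
  -- integrable on the whole space.
  obtain ⟨χ, hχ, hχc, hχΩ, hχ1⟩ := exists_smooth_cutoff hΩ hψc hψΩ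
  have hχ1' : ∀ x ∈ tsupport ψ, χ x = 1 ∧ vecGrad χ x = 0 := fun x hx => by
    have h1 : χ =ᶠ[𝓝 x] fun _ => 1 := hχ1.filter_mono (nhds_le_nhdsSet hx)
    refine ⟨h1.eq_of_nhds, ?_⟩
    ext j
    simp [h1.fderiv_eq]
  have hV : Integrable (fun x => χ x * v x) volume := by
    simpa only [mul_comm] using integrable_mul_of_tsupport_subset hv hχ.continuous hχc hχΩ
  have hh : Integrable (fun x => χ x • g x + v x • vecGrad χ x) volume := by
    have h1 : IntegrableOn g (tsupport χ) := memLp_one_iff_integrable.1 (hg _ hχc hχΩ)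
    have h2 : IntegrableOn v (tsupport χ) := memLp_one_iff_integrable.1 (hv _ hχc hχΩ)
    refine Integrable.add
      ((integrableOn_iff_integrable_of_support_subset ?_).1
        (h1.continuousOn_smul hχ.continuous.continuousOn hχc))
      ((integrableOn_iff_integrable_of_support_subset ?_).1
        (h2.smul_continuousOn (continuous_vecGrad hχ).continuousOn hχc))
    · intro x hx
      by_contra hx'
      exact hx (by simp [image_eq_zero_of_notMem_tsupport hx'])
    · intro x hx
      by_contra hx'
      exact hx (by simp [vecGrad_eq_zero_of_notMem_tsupport hx'])
  have key := (hw.cutoff_mul hv hg hχ hχc hχΩ).posPart_univ hV hh k ψ hψ hψc (subset_univ _) i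
  simp only [Measure.restrict_univ] at key
  rw [setIntegral_eq_integral_of_forall_compl_eq_zero,
    setIntegral_eq_integral_of_forall_compl_eq_zero]
  rotate_left
  · intro x hx
    simp [image_eq_zero_of_notMem_tsupport fun h => hx (hψΩ h)]
  · intro x hx
    simp [fderiv_of_notMem_tsupport ℝ fun h => hx (hψΩ h)]
  have e1 : ∀ x, max (v x - k) 0 * fderiv ℝ ψ x (EuclideanSpace.single i 1) =
      max (χ x * v x - k) 0 * fderiv ℝ ψ x (EuclideanSpace.single i 1) := fun x => by
    by_cases hx : x ∈ tsupport ψ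
    · rw [(hχ1' x hx).1, one_mul]
    · simp [fderiv_of_notMem_tsupport ℝ hx]
  have e2 : ∀ x, {x | k < v x}.indicator g x i * ψ x = {x | k < χ x * v x}.indicator
      (fun x => χ x • g x + v x • vecGrad χ x) x i * ψ x := fun x => by
    by_cases hx : x ∈ tsupport ψ
    · simp [indicator_apply, (hχ1' x hx).1, (hχ1' x hx).2]
    · simp [image_eq_zero_of_notMem_tsupport hx]
  simp only [e1, e2]
  exact key

/-! ### Sobolev inequality and local embedding. -/

theorem sobolevConj_inv {N : ℕ} {p : ℝ} (hp : 0 < p) (hpN : p < N) :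
    (sobolevConj N p)⁻¹ = p⁻¹ - (N : ℝ)⁻¹ := by
  have hN : (0 : ℝ) < N := hp.trans hpN
  have : (N : ℝ) - p ≠ 0 := by linarith
  unfold sobolevConj
  field_simp

theorem lt_sobolevConj {N : ℕ} {p : ℝ} (hp : 0 < p) (hpN : p < N) : p < sobolevConj N p := by
  have hN : (0 : ℝ) < N := hp.trans hpN
  unfold sobolevConj
  rw [lt_div_iff₀ (by linarith)]
  nlinarith

/-- The Gagliardo–Nirenberg–Sobolev inequality for compactly supported Sobolev functions. -/
theorem exists_eLpNorm_sobolevConj_le {N : ℕ} {p : ℝ} (hp : 1 ≤ p) (hpN : p < N) :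
    ∃ S : NNReal, ∀ (V : EuclideanSpace ℝ (Fin N) → ℝ)
      (h : EuclideanSpace ℝ (Fin N) → EuclideanSpace ℝ (Fin N)),
      HasWeakGradient univ V h → HasCompactSupport V → Integrable V volume →
      Integrable h volume →
      eLpNorm V (ENNReal.ofReal (sobolevConj N p)) volume ≤
        S * eLpNorm h (ENNReal.ofReal p) volume := by
  have hp0 : 0 < p := by linarith
  refine ⟨SNormLESNormFDerivOfEqConst ℝ (volume : Measure (EuclideanSpace ℝ (Fin N))) p.toNNReal,
    fun V h hw hVc hV hh => ?_⟩
  obtain ⟨W, D, hW, hD, hWD, hWc, hWae, hDae, hW1, hD1, hDp⟩ := hw.exists_approx hV hh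
  have hps0 : 0 < sobolevConj N p := hp0.trans (lt_sobolevConj hp0 hpN)
  -- Fatou along the mollifications: the inequality holds for each of them, and mollifying does not
  -- increase the L^p norm of the gradient.
  refine (Lp.eLpNorm_lim_le_liminf_eLpNorm
    (fun j => (hW j).continuous.aestronglyMeasurable) V hWae).trans ?_
  refine (liminf_le_liminf (v := fun _ => _) (Eventually.of_forall fun j => ?_)).trans_eq
    (liminf_const _)
  have hs := eLpNorm_le_eLpNorm_fderiv_of_eq
    (volume : Measure (EuclideanSpace ℝ (Fin N))) (F := ℝ) ((hW j).of_le (by simp)) (hWc hVc j)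
    (p := p.toNNReal) (p' := (sobolevConj N p).toNNReal) (by simpa using hp)
    (by rw [finrank_euclideanSpace_fin]; exact_mod_cast hp0.trans hpN)
    (by rw [finrank_euclideanSpace_fin, Real.coe_toNNReal _ hps0.le, NNReal.coe_inv,
          Real.coe_toNNReal _ hp0.le]
        exact sobolevConj_inv hp0 hpN)
  refine hs.trans ?_
  gcongr
  calc eLpNorm (fderiv ℝ (W j)) (p.toNNReal) volume ≤ eLpNorm (D j) (ENNReal.ofReal p) volume :=
        eLpNorm_mono fun x => norm_le_of_apply_single_eq (hWD j x)
    _ ≤ eLpNorm h (ENNReal.ofReal p) volume := by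
        rw [eLpNorm_eq_lintegral_rpow_enorm_toReal (by simpa using hp0) ENNReal.ofReal_ne_top,
          eLpNorm_eq_lintegral_rpow_enorm_toReal (by simpa using hp0) ENNReal.ofReal_ne_top,
          ENNReal.toReal_ofReal hp0.le]
        exact ENNReal.rpow_le_rpow (hDp p hp j) (by positivity)

theorem memLp_of_restrict_of_support_subset {N : ℕ} {Y : Type*} [NormedAddCommGroup Y]
    {T : Set (EuclideanSpace ℝ (Fin N))} (hT : MeasurableSet T) {s : ℝ≥0∞}
    {v : EuclideanSpace ℝ (Fin N) → Y} (hv : MemLp v s (volume.restrict T))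
    (h0 : ∀ x ∉ T, v x = 0) : MemLp v s volume := by
  rw [← memLp_indicator_iff_restrict hT] at hv
  rwa [indicator_eq_self.2] at hv
  intro x hx
  by_contra hxT
  exact hx (h0 x hxT)

/-- Multiplying a `W^{1,p}_loc` function by a smooth cutoff gives a function and gradient in
`L^p` of the whole space. -/
theorem MemLpLoc.cutoff {N : ℕ} {Ω : Set (EuclideanSpace ℝ (Fin N))} {s : ℝ≥0∞}
    {v : EuclideanSpace ℝ (Fin N) → ℝ} {g : EuclideanSpace ℝ (Fin N) → EuclideanSpace ℝ (Fin N)}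
    (hv : MemLpLoc Ω s v) (hg : MemLpLoc Ω s g)
    {η : EuclideanSpace ℝ (Fin N) → ℝ} (hη : ContDiff ℝ ∞ η) (hηc : HasCompactSupport η)
    (hηΩ : tsupport η ⊆ Ω) :
    MemLp (fun x => η x * v x) s volume ∧
      MemLp (fun x => η x • g x + v x • vecGrad η x) s volume := by
  obtain ⟨C, hC⟩ := hη.continuous.bounded_above_of_compact_support hηc
  obtain ⟨C', hC'⟩ := (continuous_vecGrad hη).bounded_above_of_compact_support
    (hηc.of_isClosed_subset (isClosed_tsupport _) (closure_minimal (fun x hx => by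
      by_contra hx'
      exact hx (vecGrad_eq_zero_of_notMem_tsupport hx')) (isClosed_tsupport _)))
  have hT := (isClosed_tsupport η).measurableSet
  have hv' := hv _ hηc hηΩ
  have hg' := hg _ hηc hηΩ
  constructor
  · refine memLp_of_restrict_of_support_subset hT ?_ fun x hx => by
      simp [image_eq_zero_of_notMem_tsupport hx]
    refine hv'.of_le_mul (c := C) (hη.continuous.aestronglyMeasurable.mul hv'.1)
      (ae_of_all _ fun x => ?_)
    rw [norm_mul]
    gcongr
    exact hC x
  · refine memLp_of_restrict_of_support_subset hT (MemLp.add ?_ ?_) fun x hx => by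
      simp [image_eq_zero_of_notMem_tsupport hx, vecGrad_eq_zero_of_notMem_tsupport hx]
    · refine hg'.of_le_mul (c := C) (hη.continuous.aestronglyMeasurable.smul hg'.1)
        (ae_of_all _ fun x => ?_)
      rw [norm_smul]
      gcongr
      exact hC x
    · refine hv'.of_le_mul (c := C') (hv'.1.smul (continuous_vecGrad hη).aestronglyMeasurable)
        (ae_of_all _ fun x => ?_)
      rw [norm_smul, mul_comm]
      gcongr
      exact hC' x

theorem one_le_ofReal {p : ℝ} (hp : 1 ≤ p) : (1 : ℝ≥0∞) ≤ ENNReal.ofReal p := by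
  rw [← ENNReal.ofReal_one]; exact ENNReal.ofReal_le_ofReal hp

theorem integrable_of_memLp_of_support_subset {N : ℕ} {Y : Type*} [NormedAddCommGroup Y]
    {T : Set (EuclideanSpace ℝ (Fin N))} (hT : IsCompact T) {s : ℝ≥0∞} (hs : 1 ≤ s)
    {v : EuclideanSpace ℝ (Fin N) → Y} (hv : MemLp v s volume)
    (h0 : ∀ x ∉ T, v x = 0) : Integrable v volume := by
  have : IsFiniteMeasure (volume.restrict T) := ⟨by simpa using hT.measure_lt_top⟩
  exact memLp_one_iff_integrable.1 (memLp_of_restrict_of_support_subset hT.measurableSet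
    ((hv.restrict T).mono_exponent hs) h0)

/-- Sobolev inequality for a cutoff of a `W^{1,p}_loc` function. -/
theorem exists_eLpNorm_cutoff_le {N : ℕ} {p : ℝ} (hp : 1 ≤ p) (hpN : p < N) :
    ∃ S : NNReal, ∀ (Ω : Set (EuclideanSpace ℝ (Fin N))) (v : EuclideanSpace ℝ (Fin N) → ℝ)
      (g : EuclideanSpace ℝ (Fin N) → EuclideanSpace ℝ (Fin N)),
      HasWeakGradient Ω v g → MemLpLoc Ω (ENNReal.ofReal p) v → MemLpLoc Ω (ENNReal.ofReal p) g →
      ∀ η : EuclideanSpace ℝ (Fin N) → ℝ, ContDiff ℝ ∞ η → HasCompactSupport η → tsupport η ⊆ Ω →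
      eLpNorm (fun x => η x * v x) (ENNReal.ofReal (sobolevConj N p)) volume ≤
        S * eLpNorm (fun x => η x • g x + v x • vecGrad η x) (ENNReal.ofReal p) volume := by
  obtain ⟨S, hS⟩ := exists_eLpNorm_sobolevConj_le hp hpN
  refine ⟨S, fun Ω v g hw hv hg η hη hηc hηΩ => ?_⟩
  obtain ⟨h1, h2⟩ := hv.cutoff hg hη hηc hηΩ
  have h1p := one_le_ofReal hp
  refine hS _ _ (hw.cutoff_mul (hv.mono_exponent h1p) (hg.mono_exponent h1p) hη hηc hηΩ)
    hηc.mul_right ?_ ?_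
  · exact integrable_of_memLp_of_support_subset hηc h1p h1 fun x hx => by
      simp [image_eq_zero_of_notMem_tsupport hx]
  · exact integrable_of_memLp_of_support_subset hηc h1p h2 fun x hx => by
      simp [image_eq_zero_of_notMem_tsupport hx, vecGrad_eq_zero_of_notMem_tsupport hx]

/-- Sobolev embedding `W^{1,p}_loc ⊆ L^{p*}_loc`. -/
theorem HasWeakGradient.memLpLoc_sobolevConj {N : ℕ} {Ω : Set (EuclideanSpace ℝ (Fin N))}
    (hΩ : IsOpen Ω) {p : ℝ} (hp : 1 ≤ p) (hpN : p < N)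
    {v : EuclideanSpace ℝ (Fin N) → ℝ} {g : EuclideanSpace ℝ (Fin N) → EuclideanSpace ℝ (Fin N)}
    (hw : HasWeakGradient Ω v g) (hv : MemLpLoc Ω (ENNReal.ofReal p) v)
    (hg : MemLpLoc Ω (ENNReal.ofReal p) g) :
    MemLpLoc Ω (ENNReal.ofReal (sobolevConj N p)) v := by
  intro K hK hKΩ
  obtain ⟨S, hS⟩ := exists_eLpNorm_cutoff_le hp hpN
  obtain ⟨χ, hχ, hχc, hχΩ, hχ1⟩ := exists_smooth_cutoff hΩ hK hKΩ
  obtain ⟨h1, h2⟩ := hv.cutoff hg hχ hχc hχΩ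
  have h3 : MemLp (fun x => χ x * v x) (ENNReal.ofReal (sobolevConj N p)) volume :=
    ⟨h1.1, (hS Ω v g hw hv hg χ hχ hχc hχΩ).trans_lt
      (ENNReal.mul_lt_top ENNReal.coe_lt_top h2.2)⟩
  refine (memLp_congr_ae ?_).1 (h3.restrict K)
  filter_upwards [ae_restrict_mem hK.measurableSet] with x hx
  rw [hχ1.self_of_nhdsSet x hx, one_mul]

/-! ### Radial cutoffs and the hole-filling iteration. -/

theorem exists_abs_deriv_smoothTransition_le :
    ∃ M : ℝ, 0 < M ∧ ∀ x, |deriv Real.smoothTransition x| ≤ M := by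
  have hc : Continuous (deriv Real.smoothTransition) :=
    (Real.smoothTransition.contDiff (n := 1)).continuous_deriv (by simp)
  obtain ⟨M, hM⟩ := (isCompact_Icc (a := (0 : ℝ)) (b := 1)).exists_bound_of_continuousOn
    hc.continuousOn
  refine ⟨max M 1, by positivity, fun x => ?_⟩
  by_cases hx : x ∈ Icc (0 : ℝ) 1
  · exact (hM x hx).trans (le_max_left _ _)
  · have h0 : deriv Real.smoothTransition x = 0 := by
      rw [mem_Icc, not_and_or, not_le, not_le] at hx
      rcases hx with hx | hx
      · have : Real.smoothTransition =ᶠ[𝓝 x] fun _ => 0 := by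
          filter_upwards [Iio_mem_nhds hx] with y hy
          exact Real.smoothTransition.zero_of_nonpos hy.le
        rw [this.deriv_eq]; simp
      · have : Real.smoothTransition =ᶠ[𝓝 x] fun _ => 1 := by
          filter_upwards [Ioi_mem_nhds hx] with y hy
          exact Real.smoothTransition.one_of_one_le hy.le
        rw [this.deriv_eq]; simp
    rw [h0, abs_zero]; positivity

/-- Smooth cutoff functions between concentric balls, with a gradient bound. -/
theorem exists_cutoff_ball : ∃ c : ℝ, 0 < c ∧ ∀ {N : ℕ} (x₀ : EuclideanSpace ℝ (Fin N)) (s t : ℝ),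
    0 < s → s < t → ∃ η : EuclideanSpace ℝ (Fin N) → ℝ, ContDiff ℝ ∞ η ∧
      tsupport η ⊆ Metric.closedBall x₀ t ∧ (∀ x, 0 ≤ η x) ∧ (∀ x, η x ≤ 1) ∧
      (∀ x ∈ Metric.ball x₀ s, η x = 1) ∧ (∀ x ∉ Metric.ball x₀ t, η x = 0 ∧ vecGrad η x = 0) ∧
      ∀ x, ‖vecGrad η x‖ ≤ c / (t - s) := by
  obtain ⟨M, hM0, hM⟩ := exists_abs_deriv_smoothTransition_le
  refine ⟨2 * M, by positivity, fun {N} x₀ s t hs hst => ?_⟩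
  have hd : 0 < t ^ 2 - s ^ 2 := by nlinarith
  -- The squared distance keeps η smooth at the centre. The gradient is then of size t/(t² − s²),
  -- which is at most 1/(t − s).
  let η : EuclideanSpace ℝ (Fin N) → ℝ := fun x =>
    Real.smoothTransition ((t ^ 2 - ‖x - x₀‖ ^ 2) / (t ^ 2 - s ^ 2))
  have hη : ContDiff ℝ ∞ η := Real.smoothTransition.contDiff.comp
    ((contDiff_const.sub ((contDiff_id.sub contDiff_const).norm_sq ℝ)).div_const _)
  have hzero : ∀ x ∉ Metric.ball x₀ t, η x = 0 := fun x hx => by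
    rw [Metric.mem_ball, dist_eq_norm, not_lt] at hx
    refine Real.smoothTransition.zero_of_nonpos (div_nonpos_of_nonpos_of_nonneg ?_ hd.le)
    nlinarith
  have hsupp : tsupport η ⊆ Metric.closedBall x₀ t := closure_minimal (fun x hx => by
    by_contra hx'
    exact hx (hzero x fun h => hx' (Metric.ball_subset_closedBall h))) Metric.isClosed_closedBall
  have hnn : ∀ x, 0 ≤ η x := fun x => Real.smoothTransition.nonneg _
  have hgrad : ∀ x, vecGrad η x = (-(2 * deriv Real.smoothTransition
      ((t ^ 2 - ‖x - x₀‖ ^ 2) / (t ^ 2 - s ^ 2)) / (t ^ 2 - s ^ 2))) • (x - x₀) := fun x => by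
    ext i
    have h1 := ((((hasFDerivAt_id (𝕜 := ℝ) x).sub_const x₀).norm_sq.const_sub (t ^ 2)).mul_const
      (t ^ 2 - s ^ 2)⁻¹)
    have h2 := ((Real.smoothTransition.contDiff (n := 1)).differentiable (by simp)
      ((t ^ 2 - ‖x - x₀‖ ^ 2) / (t ^ 2 - s ^ 2))).hasDerivAt
    have h3 := h2.comp_hasFDerivAt_of_eq x h1 (by simp [div_eq_mul_inv])
    have h4 : fderiv ℝ η x = _ := (HasFDerivAt.congr_of_eventuallyEq h3
      (Eventually.of_forall fun y => by simp [η, div_eq_mul_inv])).fderiv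
    rw [vecGrad_apply, h4]
    simp [EuclideanSpace.inner_single_right]
    ring
  refine ⟨η, hη, hsupp, hnn, fun x => Real.smoothTransition.le_one _, ?_, ?_, ?_⟩
  · intro x hx
    rw [Metric.mem_ball, dist_eq_norm] at hx
    refine Real.smoothTransition.one_of_one_le ?_
    rw [one_le_div hd]
    have := norm_nonneg (x - x₀)
    nlinarith
  · intro x hx
    refine ⟨hzero x hx, ?_⟩
    -- On the sphere of radius t, which may belong to the closed support, the gradient vanishes
    -- because η attains its minimum there.
    have hmin : IsLocalMin η x := Eventually.of_forall fun y => by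
      rw [hzero x hx]; exact hnn y
    ext i
    simp [hmin.fderiv_eq_zero]
  · intro x
    have hst' : 0 < t - s := by linarith
    by_cases hx : x ∈ Metric.closedBall x₀ t
    · rw [Metric.mem_closedBall, dist_eq_norm] at hx
      rw [hgrad, norm_smul, norm_neg, norm_div, norm_mul, Real.norm_eq_abs, Real.norm_eq_abs,
        Real.norm_eq_abs, abs_two, abs_of_pos hd]
      calc _ ≤ 2 * M / (t ^ 2 - s ^ 2) * t := by
            gcongr
            exact hM _
        _ ≤ 2 * M / (t - s) := by
            rw [div_mul_eq_mul_div, div_le_div_iff₀ hd hst']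
            have : 2 * M * t * (t - s) ≤ 2 * M * (t + s) * (t - s) := by
              gcongr
              linarith
            linarith
    · rw [vecGrad_eq_zero_of_notMem_tsupport fun h => hx (hsupp h), norm_zero]
      positivity

/-- The standard iteration lemma for hole filling. -/
theorem exists_iteration_bound {p θ : ℝ} (hp : 0 < p) (hθ0 : 0 ≤ θ) (hθ1 : θ < 1) :
    ∃ c : ℝ, 0 < c ∧ ∀ (Z : ℝ → ℝ) (ρ R A B M : ℝ), 0 ≤ A → 0 ≤ B → ρ < R →
      (∀ s, ρ ≤ s → s < R → Z s ≤ M) →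
      (∀ s t, ρ ≤ s → s < t → t < R → Z s ≤ θ * Z t + (A / (t - s) ^ p + B)) →
      Z ρ ≤ c * (A / (R - ρ) ^ p + B) := by
  -- Passing to the next radius shrinks R − s by the factor l and enlarges A/(R − s)^p by l^{−p}.
  -- The choice gives θ < l^p < 1, so the factor θ outweighs this growth.
  set l : ℝ := ((1 + θ) / 2) ^ (1 / p) with hl
  have hl0 : 0 < l := Real.rpow_pos_of_pos (by linarith) _
  have hl1 : l < 1 := Real.rpow_lt_one (by linarith) (by linarith) (by positivity)
  have hlp : l ^ p = (1 + θ) / 2 := by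
    rw [hl, ← Real.rpow_mul (by linarith), one_div_mul_cancel hp.ne', Real.rpow_one]
  have hθl : θ / l ^ p < 1 := by rw [hlp, div_lt_one (by linarith)]; linarith
  have hl1p : 0 < (1 - l) ^ p := Real.rpow_pos_of_pos (by linarith) _
  -- c solves the fixed-point equation `hceq`, so the induction step reproduces the same constant.
  set c : ℝ := (1 / (1 - l) ^ p + 1) / (1 - θ / l ^ p) with hc
  have hden : 0 < 1 - θ / l ^ p := by linarith
  have hc0 : 0 < c := by positivity
  have hceq : θ / l ^ p * c + (1 / (1 - l) ^ p + 1) = c := by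
    have : (1 - θ / l ^ p) * c = 1 / (1 - l) ^ p + 1 := by rw [hc, mul_div_cancel₀ _ hden.ne']
    linarith
  have hlp0 : 0 < l ^ p := Real.rpow_pos_of_pos hl0 _
  have hlp1 : l ^ p ≤ 1 := by rw [hlp]; linarith
  have hθle : θ ≤ θ / l ^ p := by
    rw [le_div_iff₀ hlp0]; exact mul_le_of_le_one_right hθ0 hlp1
  refine ⟨c, hc0, fun Z ρ R A B M hA hB hρR hZM hZ => ?_⟩
  -- Each step multiplies the a priori bound M by θ; it disappears as n → ∞. Quantifying over all s
  -- avoids writing down the sequence of radii.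
  have key : ∀ n : ℕ, ∀ s, ρ ≤ s → s < R → Z s ≤ θ ^ n * M + c * (A / (R - s) ^ p + B) := by
    intro n
    induction n with
    | zero =>
      intro s h1 h2
      have h3 := hZM s h1 h2
      have : 0 ≤ (R - s) ^ p := Real.rpow_nonneg (by linarith) _
      have : 0 ≤ c * (A / (R - s) ^ p + B) := by positivity
      rw [pow_zero, one_mul]; linarith
    | succ n ih =>
      intro s h1 h2
      have hRs : 0 < R - s := by linarith
      set t := s + (1 - l) * (R - s) with ht
      have hst : s < t := by nlinarith
      have htR : t < R := by nlinarith
      have e1 : t - s = (1 - l) * (R - s) := by rw [ht]; ring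
      have e2 : R - t = l * (R - s) := by rw [ht]; ring
      have h3 := hZ s t h1 hst htR
      have h4 := ih t (h1.trans hst.le) htR
      rw [e1, Real.mul_rpow (by linarith) hRs.le] at h3
      rw [e2, Real.mul_rpow hl0.le hRs.le] at h4
      set X := A / (R - s) ^ p with hX
      have hRsp : 0 < (R - s) ^ p := Real.rpow_pos_of_pos hRs _
      have hX0 : 0 ≤ X := by positivity
      have e3 : A / ((1 - l) ^ p * (R - s) ^ p) = 1 / (1 - l) ^ p * X := by
        rw [hX]; field_simp
      have e4 : A / (l ^ p * (R - s) ^ p) = X / l ^ p := by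
        rw [hX]; field_simp
      rw [e3] at h3
      rw [e4] at h4
      have h5 : θ * Z t ≤ θ * (θ ^ n * M + c * (X / l ^ p + B)) := by gcongr
      have h6 : θ * (c * (X / l ^ p + B)) ≤ θ / l ^ p * c * (X + B) := by
        have : θ * (c * B) ≤ θ / l ^ p * (c * B) := by gcongr
        calc _ = θ / l ^ p * c * X + θ * (c * B) := by ring
          _ ≤ θ / l ^ p * c * X + θ / l ^ p * (c * B) := by linarith
          _ = _ := by ring
      have h7 : 1 / (1 - l) ^ p * X + B ≤ (1 / (1 - l) ^ p + 1) * (X + B) := by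
        have : 0 ≤ 1 / (1 - l) ^ p * B := by positivity
        nlinarith
      calc Z s ≤ θ ^ (n + 1) * M + (θ / l ^ p * c * (X + B) + (1 / (1 - l) ^ p + 1) * (X + B)) := by
            have : θ * (θ ^ n * M + c * (X / l ^ p + B)) =
              θ ^ (n + 1) * M + θ * (c * (X / l ^ p + B)) := by ring
            linarith
        _ = θ ^ (n + 1) * M + (θ / l ^ p * c + (1 / (1 - l) ^ p + 1)) * (X + B) := by ring
        _ = _ := by rw [hceq]
  have hlim : Tendsto (fun n : ℕ => θ ^ n * M + c * (A / (R - ρ) ^ p + B)) atTop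
      (𝓝 (0 * M + c * (A / (R - ρ) ^ p + B))) :=
    ((tendsto_pow_atTop_nhds_zero_of_lt_one hθ0 hθ1).mul_const _).add_const _
  rw [zero_mul, zero_add] at hlim
  exact ge_of_tendsto' hlim fun n => key n ρ le_rfl hρR

/-! ### Measurability of compositions, Hölder inequalities and elementary bounds. -/

/-- Composition of a Carathéodory function with a measurable function is measurable. -/
theorem IsCaratheodory.aemeasurable_comp {N : ℕ} {Y : Type*} [TopologicalSpace Y]
    [TopologicalSpace.MetrizableSpace Y] [SecondCountableTopology Y] [MeasurableSpace Y]
    [OpensMeasurableSpace Y] [Nonempty Y]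
    {Ω S : Set (EuclideanSpace ℝ (Fin N))} {F : EuclideanSpace ℝ (Fin N) → Y → ℝ}
    (hF : IsCaratheodory Ω F) (hS : S ⊆ Ω) {w : EuclideanSpace ℝ (Fin N) → Y}
    (hw : AEMeasurable w (volume.restrict S)) :
    AEMeasurable (fun x => F x (w x)) (volume.restrict S) := by
  have hm : ∀ y, AEMeasurable (fun x => F x y) (volume.restrict S) := fun y =>
    (hF.measurable y).mono_measure (Measure.restrict_mono hS le_rfl)
  have hc : ∀ᵐ x ∂(volume.restrict S), Continuous (F x) :=
    ae_restrict_of_ae_restrict_of_subset hS hF.continuous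
  let d := TopologicalSpace.denseSeq Y
  -- Off a single null set F x is continuous and agrees, at all points of a countable dense set,
  -- with measurable representatives. After setting F to zero on that null set, measurability for
  -- every y follows by continuity, and then joint measurability.
  have hgood : ∀ᵐ x ∂(volume.restrict S),
      Continuous (F x) ∧ ∀ i, F x (d i) = (hm (d i)).mk _ x :=
    hc.and (ae_all_iff.2 fun i => (hm (d i)).ae_eq_mk)
  obtain ⟨T', hT'sub, hT'm, hT'0⟩ := exists_measurable_superset_of_null (ae_iff.1 hgood)
  have hT : ∀ x ∈ T'ᶜ, Continuous (F x) ∧ ∀ i, F x (d i) = (hm (d i)).mk _ x := fun x hx => by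
    by_contra h
    exact hx (hT'sub h)
  let F' : Y → EuclideanSpace ℝ (Fin N) → ℝ := fun y => (T'ᶜ).indicator fun x => F x y
  have hF'c : ∀ x, Continuous fun y => F' y x := fun x => by
    by_cases hx : x ∈ T'ᶜ
    · simpa [F', indicator_of_mem hx] using (hT x hx).1
    · simpa [F', indicator_of_notMem hx] using continuous_const
  have hF'd : ∀ i, Measurable (F' (d i)) := fun i => by
    have : F' (d i) = (T'ᶜ).indicator ((hm (d i)).mk _) := by
      ext x
      by_cases hx : x ∈ T'ᶜ
      · simp only [F', indicator_of_mem hx]; exact (hT x hx).2 i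
      · simp only [F', indicator_of_notMem hx]
    rw [this]
    exact (hm (d i)).measurable_mk.indicator hT'm.compl
  have hF'm : ∀ y, Measurable (F' y) := fun y => by
    obtain ⟨z, hz, hzy⟩ := mem_closure_iff_seq_limit.1 (TopologicalSpace.denseRange_denseSeq Y y)
    refine measurable_of_tendsto_metrizable (f := fun n => F' (z n)) (fun n => ?_)
      (tendsto_pi_nhds.2 fun x => ((hF'c x).tendsto y).comp hzy)
    obtain ⟨i, hi⟩ := hz n
    rw [← hi]
    exact hF'd i
  have hun := measurable_uncurry_of_continuous_of_measurable hF'c hF'm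
  refine ⟨fun x => Function.uncurry F' (hw.mk _ x, x),
    hun.comp (hw.measurable_mk.prodMk measurable_id), ?_⟩
  have hTae : ∀ᵐ x ∂(volume.restrict S), x ∈ T'ᶜ := compl_mem_ae_iff.2 hT'0
  filter_upwards [hTae, hw.ae_eq_mk] with x hx hwx
  simp only [Function.uncurry, F', indicator_of_mem hx, ← hwx]

theorem integrable_norm_rpow_ofReal {X Y : Type*} [MeasurableSpace X] [NormedAddCommGroup Y]
    {μ : Measure X} {g : X → Y} {s : ℝ} (hs : 0 < s) (hg : MemLp g (ENNReal.ofReal s) μ) :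
    Integrable (fun x => ‖g x‖ ^ s) μ := by
  have := hg.integrable_norm_rpow (by simpa using hs) ENNReal.ofReal_ne_top
  rwa [ENNReal.toReal_ofReal hs.le] at this

theorem lintegral_enorm_rpow_eq {X Y : Type*} [MeasurableSpace X] [NormedAddCommGroup Y]
    {μ : Measure X} {g : X → Y} {s : ℝ} (hs : 0 < s) (hg : MemLp g (ENNReal.ofReal s) μ) :
    ∫⁻ x, ‖g x‖ₑ ^ s ∂μ = ENNReal.ofReal (∫ x, ‖g x‖ ^ s ∂μ) := by
  rw [ofReal_integral_eq_lintegral_ofReal (integrable_norm_rpow_ofReal hs hg)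
    (ae_of_all _ fun x => by positivity)]
  refine lintegral_congr fun x => ?_
  rw [← ENNReal.ofReal_rpow_of_nonneg (norm_nonneg _) hs.le, ofReal_norm]

/-- Hölder's inequality with respect to a finite measure. -/
theorem integral_norm_rpow_le {X Y : Type*} [MeasurableSpace X] [NormedAddCommGroup Y]
    {μ : Measure X} [IsFiniteMeasure μ] {g : X → Y} {s q : ℝ} (hs : 0 < s) (hq : 0 ≤ q)
    (hqs : q ≤ s) (hg : MemLp g (ENNReal.ofReal s) μ) :
    Integrable (fun x => ‖g x‖ ^ q) μ ∧
      ∫ x, ‖g x‖ ^ q ∂μ ≤ (∫ x, ‖g x‖ ^ s ∂μ) ^ (q / s) * μ.real univ ^ (1 - q / s) := by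
  have hqs' : 0 ≤ 1 - q / s := by rw [sub_nonneg, div_le_one hs]; exact hqs
  have hI : 0 ≤ ∫ x, ‖g x‖ ^ s ∂μ := integral_nonneg fun x => by positivity
  have h1 : ∫⁻ x, ENNReal.ofReal (‖g x‖ ^ q) ∂μ ≤
      ENNReal.ofReal ((∫ x, ‖g x‖ ^ s ∂μ) ^ (q / s) * μ.real univ ^ (1 - q / s)) := by
    have h2 := ENNReal.lintegral_mul_norm_pow_le (μ := μ) (f := fun x => ‖g x‖ₑ ^ s)
      (g := fun _ => 1) (hg.1.enorm.pow_const s) aemeasurable_const (p := q / s) (q := 1 - q / s)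
      (by positivity) hqs' (by ring)
    rw [lintegral_enorm_rpow_eq hs hg] at h2
    rw [ENNReal.ofReal_mul (by positivity), ← ENNReal.ofReal_rpow_of_nonneg hI (by positivity),
      ← ENNReal.ofReal_rpow_of_nonneg measureReal_nonneg hqs', ofReal_measureReal]
    refine le_trans (le_of_eq (lintegral_congr fun x => ?_)) (h2.trans_eq (by simp))
    rw [← ENNReal.ofReal_rpow_of_nonneg (norm_nonneg _) hq, ofReal_norm, ← ENNReal.rpow_mul,
      mul_div_cancel₀ _ hs.ne']
    simp
  have hm : AEStronglyMeasurable (fun x => ‖g x‖ ^ q) μ :=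
    (hg.1.norm.aemeasurable.pow_const q).aestronglyMeasurable
  have hnn : 0 ≤ᵐ[μ] fun x => ‖g x‖ ^ q := ae_of_all _ fun x => by positivity
  refine ⟨⟨hm, (hasFiniteIntegral_iff_ofReal hnn).2 (h1.trans_lt ENNReal.ofReal_lt_top)⟩, ?_⟩
  rw [integral_eq_lintegral_of_nonneg_ae hnn hm]
  exact ENNReal.toReal_le_of_le_ofReal (by positivity) h1

/-- Hölder's inequality with three factors, one of them constant. -/
theorem integral_abs_mul_rpow_le {X : Type*} [MeasurableSpace X] {μ : Measure X}
    [IsFiniteMeasure μ] {b φ : X → ℝ} {σ γ s e : ℝ} (hσ : 0 < σ) (hγ : 0 ≤ γ) (hs : 0 < s)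
    (he : 0 ≤ e) (hsum : 1 / σ + γ / s + e = 1) (hb : MemLp b (ENNReal.ofReal σ) μ)
    (hφ : MemLp φ (ENNReal.ofReal s) μ) :
    Integrable (fun x => |b x| * |φ x| ^ γ) μ ∧
      ∫ x, |b x| * |φ x| ^ γ ∂μ ≤
        (∫ x, |b x| ^ σ ∂μ) ^ (1 / σ) * (∫ x, |φ x| ^ s ∂μ) ^ (γ / s) * μ.real univ ^ e := by
  have hI1 : 0 ≤ ∫ x, |b x| ^ σ ∂μ := integral_nonneg fun x => by positivity
  have hI2 : 0 ≤ ∫ x, |φ x| ^ s ∂μ := integral_nonneg fun x => by positivity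
  have h1 : ∫⁻ x, ENNReal.ofReal (|b x| * |φ x| ^ γ) ∂μ ≤ ENNReal.ofReal
      ((∫ x, |b x| ^ σ ∂μ) ^ (1 / σ) * (∫ x, |φ x| ^ s ∂μ) ^ (γ / s) * μ.real univ ^ e) := by
    have h2 := ENNReal.lintegral_prod_norm_pow_le (μ := μ) (Finset.univ : Finset (Fin 3))
      (f := ![fun x => ‖b x‖ₑ ^ σ, fun x => ‖φ x‖ₑ ^ s, fun _ => 1])
      (by
        intro i _
        fin_cases i
        · exact hb.1.enorm.pow_const σ
        · exact hφ.1.enorm.pow_const s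
        · exact aemeasurable_const)
      (p := ![1 / σ, γ / s, e]) (by simpa [Fin.sum_univ_three] using hsum)
      (by
        intro i _
        fin_cases i
        · exact (by positivity : 0 ≤ 1 / σ)
        · exact (by positivity : 0 ≤ γ / s)
        · exact he)
    simp only [Fin.prod_univ_three, Matrix.cons_val_zero, Matrix.cons_val_one, Matrix.cons_val,
      lintegral_enorm_rpow_eq hσ hb, lintegral_enorm_rpow_eq hs hφ, lintegral_const, one_mul,
      ENNReal.one_rpow, mul_one, ← ENNReal.rpow_mul, mul_one_div_cancel hσ.ne',
      mul_div_cancel₀ _ hs.ne', ENNReal.rpow_one, Real.norm_eq_abs] at h2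
    rw [ENNReal.ofReal_mul (by positivity), ENNReal.ofReal_mul (by positivity),
      ← ENNReal.ofReal_rpow_of_nonneg hI1 (by positivity),
      ← ENNReal.ofReal_rpow_of_nonneg hI2 (by positivity),
      ← ENNReal.ofReal_rpow_of_nonneg measureReal_nonneg he, ofReal_measureReal]
    refine le_trans (le_of_eq (lintegral_congr fun x => ?_)) h2
    rw [ENNReal.ofReal_mul (abs_nonneg _), ← ENNReal.ofReal_rpow_of_nonneg (abs_nonneg _) hγ,
      ← Real.norm_eq_abs, ← Real.norm_eq_abs, ofReal_norm, ofReal_norm]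
  have hm : AEStronglyMeasurable (fun x => |b x| * |φ x| ^ γ) μ :=
    hb.1.norm.mul (hφ.1.norm.aemeasurable.pow_const γ).aestronglyMeasurable
  have hnn : 0 ≤ᵐ[μ] fun x => |b x| * |φ x| ^ γ := ae_of_all _ fun x => by positivity
  refine ⟨⟨hm, (hasFiniteIntegral_iff_ofReal hnn).2 (h1.trans_lt ENNReal.ofReal_lt_top)⟩, ?_⟩
  rw [integral_eq_lintegral_of_nonneg_ae hnn hm]
  exact ENNReal.toReal_le_of_le_ofReal (by positivity) h1

/-- Raising the norm inequality to the power p gives the form in which the Sobolev bound is compared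
with energy integrals. -/
theorem integral_rpow_le_of_eLpNorm_le {X Y Z : Type*} [MeasurableSpace X] [NormedAddCommGroup Y]
    [NormedAddCommGroup Z] {μ : Measure X} {V : X → Y} {h : X → Z} {s p : ℝ} (hs : 0 < s)
    (hp : 0 < p) {S : NNReal} (hh : MemLp h (ENNReal.ofReal p) μ) (hV : AEStronglyMeasurable V μ)
    (hle : eLpNorm V (ENNReal.ofReal s) μ ≤ S * eLpNorm h (ENNReal.ofReal p) μ) :
    MemLp V (ENNReal.ofReal s) μ ∧
      (∫ x, ‖V x‖ ^ s ∂μ) ^ (p / s) ≤ (S : ℝ) ^ p * ∫ x, ‖h x‖ ^ p ∂μ := by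
  have hVm : MemLp V (ENNReal.ofReal s) μ :=
    ⟨hV, hle.trans_lt (ENNReal.mul_lt_top ENNReal.coe_lt_top hh.2)⟩
  refine ⟨hVm, ?_⟩
  have hI1 : 0 ≤ ∫ x, ‖V x‖ ^ s ∂μ := integral_nonneg fun x => by positivity
  have hI2 : 0 ≤ ∫ x, ‖h x‖ ^ p ∂μ := integral_nonneg fun x => by positivity
  rw [hVm.eLpNorm_eq_integral_rpow_norm (by simpa using hs) ENNReal.ofReal_ne_top,
    hh.eLpNorm_eq_integral_rpow_norm (by simpa using hp) ENNReal.ofReal_ne_top,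
    ENNReal.toReal_ofReal hs.le, ENNReal.toReal_ofReal hp.le, ← ENNReal.ofReal_coe_nnreal,
    ← ENNReal.ofReal_mul (by positivity), ENNReal.ofReal_le_ofReal_iff (by positivity)] at hle
  calc (∫ x, ‖V x‖ ^ s ∂μ) ^ (p / s) = ((∫ x, ‖V x‖ ^ s ∂μ) ^ s⁻¹) ^ p := by
        rw [← Real.rpow_mul hI1]; congr 1; field_simp
    _ ≤ (S * (∫ x, ‖h x‖ ^ p ∂μ) ^ p⁻¹) ^ p := by gcongr
    _ = _ := by
        rw [Real.mul_rpow (by positivity) (by positivity), ← Real.rpow_mul hI2,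
          inv_mul_cancel₀ hp.ne', Real.rpow_one]

/-- The sum is at most twice its larger term; this crude constant needs no convexity and serves
every exponent s ≥ 0. -/
theorem two_rpow_mul_add {a b s : ℝ} (ha : 0 ≤ a) (hb : 0 ≤ b) (hs : 0 ≤ s) :
    (a + b) ^ s ≤ 2 ^ s * (a ^ s + b ^ s) := by
  wlog hab : b ≤ a generalizing a b
  · rw [add_comm, add_comm (a ^ s)]
    exact this hb ha (le_of_not_ge hab)
  calc (a + b) ^ s ≤ (2 * a) ^ s := by gcongr; linarith
    _ = 2 ^ s * a ^ s := Real.mul_rpow (by norm_num) ha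
    _ ≤ _ := by
        gcongr
        have : 0 ≤ b ^ s := by positivity
        linarith

/-- Comparison of a with 1. It trades the growth exponent q of G for p; after integration the 1
becomes a measure term. -/
theorem rpow_le_one_add_rpow {a q p : ℝ} (ha : 0 ≤ a) (hq : 0 ≤ q) (hqp : q ≤ p) :
    a ^ q ≤ 1 + a ^ p := by
  rcases le_total a 1 with h | h
  · have h1 : a ^ q ≤ 1 := Real.rpow_le_one ha h hq
    have h2 : 0 ≤ a ^ p := by positivity
    linarith
  · have := Real.rpow_le_rpow_of_exponent_le h hqp
    linarith

/-! ### Competitors in W^{1,p}_loc and finiteness of their energy. -/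

theorem HasWeakGradient.of_univ {N : ℕ} {Ω : Set (EuclideanSpace ℝ (Fin N))}
    {v : EuclideanSpace ℝ (Fin N) → ℝ} {g : EuclideanSpace ℝ (Fin N) → EuclideanSpace ℝ (Fin N)}
    (hw : HasWeakGradient univ v g) : HasWeakGradient Ω v g := by
  intro ψ hψ hψc hψΩ i
  have h := hw ψ hψ hψc (subset_univ _) i
  rw [Measure.restrict_univ] at h
  rw [setIntegral_eq_integral_of_forall_compl_eq_zero,
    setIntegral_eq_integral_of_forall_compl_eq_zero, h]
  · intro x hx
    simp [image_eq_zero_of_notMem_tsupport fun h => hx (hψΩ h)]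
  · intro x hx
    simp [fderiv_of_notMem_tsupport ℝ fun h => hx (hψΩ h)]

theorem HasWeakGradient.add {N : ℕ} {Ω : Set (EuclideanSpace ℝ (Fin N))}
    {v₁ v₂ : EuclideanSpace ℝ (Fin N) → ℝ}
    {g₁ g₂ : EuclideanSpace ℝ (Fin N) → EuclideanSpace ℝ (Fin N)}
    (h₁ : HasWeakGradient Ω v₁ g₁) (h₂ : HasWeakGradient Ω v₂ g₂)
    (hv₁ : MemLpLoc Ω 1 v₁) (hv₂ : MemLpLoc Ω 1 v₂) (hg₁ : MemLpLoc Ω 1 g₁)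
    (hg₂ : MemLpLoc Ω 1 g₂) :
    HasWeakGradient Ω (fun x => v₁ x + v₂ x) (fun x => g₁ x + g₂ x) := by
  intro ψ hψ hψc hψΩ i
  have hψ' : Continuous fun x => fderiv ℝ ψ x (EuclideanSpace.single i 1) :=
    (hψ.continuous_fderiv (by simp)).clm_apply continuous_const
  have hs : tsupport (fun x => fderiv ℝ ψ x (EuclideanSpace.single i 1)) ⊆ Ω :=
    (tsupport_fderiv_apply_subset ℝ _).trans hψΩ
  have hψ'c : HasCompactSupport fun x => fderiv ℝ ψ x (EuclideanSpace.single i 1) :=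
    hψc.fderiv_apply ℝ _
  simp only [add_mul, PiLp.add_apply]
  rw [integral_add (integrable_mul_of_tsupport_subset hv₁ hψ' hψ'c hs).integrableOn
    (integrable_mul_of_tsupport_subset hv₂ hψ' hψ'c hs).integrableOn,
    integral_add
    (integrable_mul_of_tsupport_subset (hg₁.apply i) hψ.continuous hψc hψΩ).integrableOn
    (integrable_mul_of_tsupport_subset (hg₂.apply i) hψ.continuous hψc hψΩ).integrableOn,
    h₁ ψ hψ hψc hψΩ i, h₂ ψ hψ hψc hψΩ i]
  ring

theorem HasWeakGradient.neg {N : ℕ} {Ω : Set (EuclideanSpace ℝ (Fin N))}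
    {v : EuclideanSpace ℝ (Fin N) → ℝ} {g : EuclideanSpace ℝ (Fin N) → EuclideanSpace ℝ (Fin N)}
    (h : HasWeakGradient Ω v g) : HasWeakGradient Ω (fun x => - v x) (fun x => - g x) := by
  intro ψ hψ hψc hψΩ i
  have := h ψ hψ hψc hψΩ i
  simp only [neg_mul, PiLp.neg_apply, integral_neg, this]

theorem MemLpLoc.row {n N : ℕ} {Ω : Set (EuclideanSpace ℝ (Fin N))} {s : ℝ≥0∞}
    {D : EuclideanSpace ℝ (Fin N) → GradMat n N} (hD : MemLpLoc Ω s D) (i : Fin n) :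
    MemLpLoc Ω s (fun x => D x i) := fun K hK hKΩ => (hD K hK hKΩ).eval_piLp i

theorem IsW1pLoc.add {n N : ℕ} {Ω : Set (EuclideanSpace ℝ (Fin N))} {p : ℝ} (hp : 1 ≤ p)
    {u₁ u₂ : EuclideanSpace ℝ (Fin N) → EuclideanSpace ℝ (Fin n)}
    {D₁ D₂ : EuclideanSpace ℝ (Fin N) → GradMat n N}
    (h₁ : IsW1pLoc Ω p u₁ D₁) (h₂ : IsW1pLoc Ω p u₂ D₂) :
    IsW1pLoc Ω p (u₁ + u₂) (D₁ + D₂) where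
  memLp := fun K hK hKΩ => (h₁.memLp K hK hKΩ).add (h₂.memLp K hK hKΩ)
  memLp_grad := fun K hK hKΩ => (h₁.memLp_grad K hK hKΩ).add (h₂.memLp_grad K hK hKΩ)
  weakGradient := fun α => by
    have h1 := one_le_ofReal hp
    exact (h₁.weakGradient α).add (h₂.weakGradient α)
      ((h₁.memLp.mono_exponent h1).apply α) ((h₂.memLp.mono_exponent h1).apply α)
      ((h₁.memLp_grad.mono_exponent h1).row α) ((h₂.memLp_grad.mono_exponent h1).row α)

theorem IsW1pLoc.neg {n N : ℕ} {Ω : Set (EuclideanSpace ℝ (Fin N))} {p : ℝ}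
    {u : EuclideanSpace ℝ (Fin N) → EuclideanSpace ℝ (Fin n)}
    {D : EuclideanSpace ℝ (Fin N) → GradMat n N}
    (h : IsW1pLoc Ω p u D) : IsW1pLoc Ω p (-u) (-D) where
  memLp := fun K hK hKΩ => (h.memLp K hK hKΩ).neg
  memLp_grad := fun K hK hKΩ => (h.memLp_grad K hK hKΩ).neg
  weakGradient := fun α => (h.weakGradient α).neg

theorem IsW1pLoc.single {n N : ℕ} {Ω : Set (EuclideanSpace ℝ (Fin N))} {p : ℝ} (α : Fin n)
    {v : EuclideanSpace ℝ (Fin N) → ℝ} {g : EuclideanSpace ℝ (Fin N) → EuclideanSpace ℝ (Fin N)}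
    (hw : HasWeakGradient Ω v g) (hv : MemLpLoc Ω (ENNReal.ofReal p) v)
    (hg : MemLpLoc Ω (ENNReal.ofReal p) g) :
    IsW1pLoc Ω p (fun x => EuclideanSpace.single α (v x)) (fun x => PiLp.single 2 α (g x)) where
  memLp := fun K hK hKΩ => MemLp.of_eval_piLp fun i => by
    by_cases hi : i = α
    · subst hi; simpa using hv K hK hKΩ
    · simp [hi]
  memLp_grad := fun K hK hKΩ => MemLp.of_eval_piLp fun i => by
    by_cases hi : i = α
    · subst hi; simpa using hg K hK hKΩ
    · simp [hi]
  weakGradient := fun i => by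
    by_cases hi : i = α
    · subst hi; simpa using hw
    · intro ψ _ _ _ j
      simp [hi]

/-- The positive part of a `W^{1,p}_loc` function and its gradient are in `L^p_loc`. -/
theorem MemLpLoc.posPart {N : ℕ} {Ω : Set (EuclideanSpace ℝ (Fin N))} {s : ℝ≥0∞}
    {v : EuclideanSpace ℝ (Fin N) → ℝ} {g : EuclideanSpace ℝ (Fin N) → EuclideanSpace ℝ (Fin N)}
    (hv : MemLpLoc Ω s v) (hg : MemLpLoc Ω s g) (k : ℝ) :
    MemLpLoc Ω s (fun x => max (v x - k) 0) ∧ MemLpLoc Ω s ({x | k < v x}.indicator g) := by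
  refine ⟨fun K hK hKΩ => ?_, fun K hK hKΩ => ?_⟩
  · have : IsFiniteMeasure (volume.restrict K) := ⟨by simpa using hK.measure_lt_top⟩
    have h1 := (hv K hK hKΩ).sub (memLp_const (μ := volume.restrict K) (p := s) k)
    refine h1.mono ((continuous_id.max continuous_const).comp_aestronglyMeasurable h1.1)
      (ae_of_all _ fun x => ?_)
    simp only [Pi.sub_apply, Real.norm_eq_abs]
    rw [abs_of_nonneg (le_max_right _ _)]
    exact max_le (le_abs_self _) (abs_nonneg _)
  · refine (hg K hK hKΩ).mono ((hg K hK hKΩ).1.indicator₀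
      (nullMeasurableSet_lt aemeasurable_const (hv K hK hKΩ).1.aemeasurable))
      (ae_of_all _ fun x => norm_indicator_le_norm_self _ _)

/-- The energy density of a `W^{1,p}_loc` function is locally integrable. -/
theorem IsW1pLoc.integrableOn_energyDensity {n N : ℕ} {Ω : Set (EuclideanSpace ℝ (Fin N))}
    (hΩ : IsOpen Ω) {p ε q C : ℝ} (hp1 : 1 < p) (hpN : p < N) {γ L : Fin n → ℝ}
    {aα bα : Fin n → EuclideanSpace ℝ (Fin N) → ℝ} {a : EuclideanSpace ℝ (Fin N) → ℝ}
    {f : Fin n → EuclideanSpace ℝ (Fin N) → ℝ → EuclideanSpace ℝ (Fin N) → ℝ}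
    {G : EuclideanSpace ℝ (Fin N) → EuclideanSpace ℝ (Fin n) → GradMat n N → ℝ}
    (hF : HypF Ω p ε γ L aα bα f) (hG : HypG Ω p ε q C a G)
    {w : EuclideanSpace ℝ (Fin N) → EuclideanSpace ℝ (Fin n)}
    {D : EuclideanSpace ℝ (Fin N) → GradMat n N} (hw : IsW1pLoc Ω p w D)
    {S : Set (EuclideanSpace ℝ (Fin N))} (hS : IsCompact S) (hSΩ : S ⊆ Ω) :
    IntegrableOn (energyDensity f G w D) S := by
  have hp0 : 0 < p := by linarith
  have hN0 : (0 : ℝ) < N := hp0.trans hpN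
  have hps := lt_sobolevConj hp0 hpN
  have : IsFiniteMeasure (volume.restrict S) := ⟨by simpa using hS.measure_lt_top⟩
  have hκ : 1 ≤ N / (p - ε * N) := by
    have h1 := hF.ε_lt
    rw [lt_div_iff₀ hN0] at h1
    rw [one_le_div (by linarith)]
    nlinarith [hF.ε_pos]
  have hκ' := one_le_ofReal hκ
  have hwm := hw.memLp S hS hSΩ
  have hDm := hw.memLp_grad S hS hSΩ
  have hae : ∀ {P : EuclideanSpace ℝ (Fin N) → Prop}, (∀ᵐ x ∂(volume.restrict Ω), P x) →
      ∀ᵐ x ∂(volume.restrict S), P x := fun h => ae_restrict_of_ae_restrict_of_subset hSΩ h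
  have hfi : ∀ β, IntegrableOn (fun x => f β x (w x β) (D x β)) S := fun β => by
    have hm : AEMeasurable (fun x => f β x (w x β) (D x β)) (volume.restrict S) :=
      (hF.caratheodory β).aemeasurable_comp hSΩ (w := fun x => (w x β, D x β))
        ((hwm.eval_piLp β).1.aemeasurable.prodMk (hDm.eval_piLp β).1.aemeasurable)
    -- The Sobolev embedding puts the component in L^{p*}, and the exponent σ of b satisfies 1/σ +
    -- γ/p* + ε = 1, so b |w|^γ is integrable.
    have hwps := (hw.weakGradient β).memLpLoc_sobolevConj hΩ hp1.le hpN (hw.memLp.apply β)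
      (hw.memLp_grad.row β) S hS hSΩ
    have hb := integral_abs_mul_rpow_le (div_pos (hp0.trans hps) (hF.exponent_pos β))
      (hp0.le.trans (hF.p_le_γ β)) (hp0.trans hps) hF.ε_pos.le
      (by
        have := (hp0.trans hps).ne'
        rw [one_div_div]; field_simp; ring) (hF.b_memLp β S hS hSΩ) hwps
    have ha : Integrable (aα β) (volume.restrict S) :=
      memLp_one_iff_integrable.1 ((hF.a_memLp β S hS hSΩ).mono_exponent hκ')
    refine (((integrable_norm_rpow_ofReal hp0 (hDm.eval_piLp β)).add hb.1).add ha).const_mul (L β)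
      |>.mono' hm.aestronglyMeasurable ?_
    filter_upwards [hae (hF.growth β), hae (hF.a_nonneg β), hae (hF.b_nonneg β)] with x h1 h2 h3
    obtain ⟨h4, h5⟩ := h1 (w x β) (D x β)
    have h6 := hF.one_lt_L β
    have h7 : 0 ≤ |w x β| ^ γ β := by positivity
    have h8 : 0 ≤ ‖D x β‖ ^ p := by positivity
    have h9 : 0 ≤ bα β x * |w x β| ^ γ β := by positivity
    simp only [Pi.add_apply, abs_of_nonneg h3]
    rw [Real.norm_eq_abs, abs_le]
    constructor <;> nlinarith
  have hGi : IntegrableOn (fun x => G x (w x) (D x)) S := by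
    have hm : AEMeasurable (fun x => G x (w x) (D x)) (volume.restrict S) :=
      hG.caratheodory.aemeasurable_comp hSΩ (w := fun x => (w x, D x))
        (hwm.1.aemeasurable.prodMk hDm.1.aemeasurable)
    have hqp : q ≤ p := by
      have h1 := hG.q_lt
      rw [lt_div_iff₀ hN0] at h1
      nlinarith
    have hq0 : 0 ≤ q := by linarith [hG.one_le_q]
    have ha : Integrable a (volume.restrict S) :=
      memLp_one_iff_integrable.1 ((hG.a_memLp S hS hSΩ).mono_exponent hκ')
    refine ((((integral_norm_rpow_le hp0 hq0 hqp hDm).1.add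
      (integral_norm_rpow_le hp0 hq0 hqp hwm).1).add ha).const_mul C).mono'
      hm.aestronglyMeasurable ?_
    filter_upwards [hae hG.growth] with x h1
    exact h1 _ _
  exact (integrable_finsetSum _ fun β _ => hfi β).add hGi

/-! ### Energy inequality on superlevel sets. -/

/-- A Sobolev function is only a.e. measurable, so its level sets are only null-measurable; this
suffices for a.e. membership under the restricted measure. -/
theorem nullMeasurableSet_superBall {N : ℕ} {v : EuclideanSpace ℝ (Fin N) → ℝ}
    {x₀ : EuclideanSpace ℝ (Fin N)} {r k : ℝ}
    (hv : AEMeasurable v (volume.restrict (Metric.ball x₀ r))) :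
    NullMeasurableSet (superBall v x₀ k r) volume :=
  (nullMeasurableSet_restrict measurableSet_ball.nullMeasurableSet).1
    (nullMeasurableSet_lt aemeasurable_const hv)

theorem superBall_mono {N : ℕ} (v : EuclideanSpace ℝ (Fin N) → ℝ)
    (x₀ : EuclideanSpace ℝ (Fin N)) (k : ℝ) {r s : ℝ} (hrs : r ≤ s) :
    superBall v x₀ k r ⊆ superBall v x₀ k s :=
  inter_subset_inter_right _ (Metric.ball_subset_ball hrs)

theorem superBall_inter_ball {N : ℕ} (v : EuclideanSpace ℝ (Fin N) → ℝ)
    (x₀ : EuclideanSpace ℝ (Fin N)) (k : ℝ) {r s : ℝ} (hrs : r ≤ s) :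
    superBall v x₀ k s ∩ Metric.ball x₀ r = superBall v x₀ k r := by
  rw [superBall, inter_assoc, inter_eq_right.2 (Metric.ball_subset_ball hrs), superBall]

set_option maxHeartbeats 800000 in
/-- Pointwise comparison of the energy of a map with that of its truncated competitor. -/
theorem energyDensity_competitor_sub_le {n N : ℕ} {p q C Λ b a₁ a₂ γ : ℝ} (hp1 : 1 < p)
    (hq : 1 ≤ q) (hqp : q ≤ p) (hC : 1 < C) (hΛ : 1 < Λ) (hγ : 0 ≤ γ) (hb : 0 ≤ b)
    (ha₁ : 0 ≤ a₁) (ha₂ : 0 ≤ a₂)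
    {f : Fin n → ℝ → EuclideanSpace ℝ (Fin N) → ℝ}
    {G : EuclideanSpace ℝ (Fin n) → GradMat n N → ℝ} (α : Fin n)
    (hf : ∀ (s : ℝ) (ξ : EuclideanSpace ℝ (Fin N)),
      ‖ξ‖ ^ p - b * |s| ^ γ - a₁ ≤ f α s ξ ∧ f α s ξ ≤ Λ * (‖ξ‖ ^ p + b * |s| ^ γ + a₁))
    (hG : ∀ (s : EuclideanSpace ℝ (Fin n)) (ξ : GradMat n N),
      |G s ξ| ≤ C * (‖ξ‖ ^ q + ‖s‖ ^ q + a₂))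
    (s : EuclideanSpace ℝ (Fin n)) (D : GradMat n N) {k h l : ℝ} (y : EuclideanSpace ℝ (Fin N))
    (hk : k ≤ s α) (h0 : 0 ≤ h) (h1 : h ≤ 1) (hy : ‖y‖ ≤ l) :
    ((∑ β, f β ((s + EuclideanSpace.single α (-(h * (s α - k)))) β)
          ((D + PiLp.single 2 α (-(h • D α + (s α - k) • y)) : GradMat n N) β)) +
        G (s + EuclideanSpace.single α (-(h * (s α - k))))
          (D + PiLp.single 2 α (-(h • D α + (s α - k) • y)))) -
      ((∑ β, f β (s β) (D β)) + G s D) ≤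
    Λ * 2 ^ p * ((1 - h) ^ p * ‖D α‖ ^ p) - ‖D α‖ ^ p +
      (Λ * 2 ^ p + (Λ + 1) * 2 ^ γ + (Λ + 1) + C * (2 ^ q * 2 ^ q + 2 * 2 ^ q + 2)) *
        ((l * (s α - k)) ^ p + b * (s α - k) ^ γ + |k| ^ γ * b + (a₁ + a₂) +
          (‖D‖ ^ q + ‖s‖ ^ q) + (1 + |k| ^ p)) := by
  set d := s α - k with hd
  have hd0 : 0 ≤ d := by rw [hd]; linarith
  have hl0 : 0 ≤ l := (norm_nonneg y).trans hy
  set w : EuclideanSpace ℝ (Fin n) := s + EuclideanSpace.single α (-(h * d)) with hw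
  set E : GradMat n N := D + PiLp.single 2 α (-(h • D α + d • y)) with hE
  have hsum : (∑ β, f β (w β) (E β)) - ∑ β, f β (s β) (D β) =
      f α (w α) (E α) - f α (s α) (D α) := by
    rw [← Finset.sum_sub_distrib]
    refine Finset.sum_eq_single α (fun β _ hβ => ?_) (fun h => absurd (Finset.mem_univ α) h)
    have e1 : w β = s β := by simp [hw, hβ]
    have e2 : E β = D β := by simp [hE, hβ]
    rw [e1, e2, sub_self]
  have hwα : w α = k + (1 - h) * d := by simp [hw, hd]; ring
  -- The factor 1 − h will confine the gradient energy of the competitor to the annulus, where the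
  -- cutoff is below 1.
  have hEα : E α = (1 - h) • D α - d • y := by
    simp [hE, sub_smul]; abel
  have hP := hf (s α) (D α)
  have hQ := hf (w α) (E α)
  have hG1 := abs_le.1 (hG s D)
  have hG2 := abs_le.1 (hG w E)
  have hdl : d * ‖y‖ ≤ l * d := by rw [mul_comm l]; gcongr
  -- bounds for the competitor
  have b1 : ‖E α‖ ^ p ≤ 2 ^ p * ((1 - h) ^ p * ‖D α‖ ^ p + (l * d) ^ p) := by
    have : ‖E α‖ ≤ (1 - h) * ‖D α‖ + l * d := by
      rw [hEα]
      refine (norm_sub_le _ _).trans ?_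
      rw [norm_smul, norm_smul, Real.norm_of_nonneg (by linarith), Real.norm_of_nonneg hd0]
      linarith
    calc ‖E α‖ ^ p ≤ ((1 - h) * ‖D α‖ + l * d) ^ p := by gcongr
      _ ≤ 2 ^ p * (((1 - h) * ‖D α‖) ^ p + (l * d) ^ p) :=
          two_rpow_mul_add (mul_nonneg (by linarith) (norm_nonneg _)) (by positivity) (by linarith)
      _ = _ := by rw [Real.mul_rpow (by linarith) (norm_nonneg _)]
  -- Both the old and the new value of the component lie within d + |k| of zero, d being its excess
  -- over k.
  have hgen : ∀ z : ℝ, |z| ≤ d + |k| → b * |z| ^ γ ≤ 2 ^ γ * (b * d ^ γ + |k| ^ γ * b) := by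
    intro z hz
    calc b * |z| ^ γ ≤ b * (2 ^ γ * (d ^ γ + |k| ^ γ)) := by
          gcongr
          exact (Real.rpow_le_rpow (abs_nonneg _) hz hγ).trans
            (two_rpow_mul_add hd0 (abs_nonneg _) hγ)
      _ = _ := by ring
  have b2 : b * |w α| ^ γ ≤ 2 ^ γ * (b * d ^ γ + |k| ^ γ * b) := by
    refine hgen _ ?_
    rw [hwα]
    refine (abs_add_le _ _).trans ?_
    rw [abs_of_nonneg (mul_nonneg (by linarith : 0 ≤ 1 - h) hd0)]
    nlinarith
  have b3 : b * |s α| ^ γ ≤ 2 ^ γ * (b * d ^ γ + |k| ^ γ * b) := by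
    refine hgen _ ?_
    have : s α = k + d := by rw [hd]; ring
    rw [this]
    refine (abs_add_le _ _).trans ?_
    rw [abs_of_nonneg hd0]; linarith
  have hDα : ‖D α‖ ≤ ‖D‖ := PiLp.norm_apply_le D α
  have hsα : |s α| ≤ ‖s‖ := PiLp.norm_apply_le s α
  have hq0 : 0 ≤ q := by linarith
  -- Here ‖D‖^q keeps its exponent, since the full gradient has no term on the left to be compared
  -- with, while (l d)^q is raised to the power p and joins the contribution of f.
  have b4 : ‖E‖ ^ q ≤ 2 ^ q * (2 ^ q * ‖D‖ ^ q + (1 + (l * d) ^ p)) := by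
    have : ‖E‖ ≤ 2 * ‖D‖ + l * d := by
      rw [hE]
      refine (norm_add_le _ _).trans ?_
      rw [PiLp.norm_single, norm_neg]
      have h3 := norm_add_le (h • D α) (d • y)
      rw [norm_smul, norm_smul, Real.norm_of_nonneg h0, Real.norm_of_nonneg hd0] at h3
      have h4 : h * ‖D α‖ ≤ ‖D‖ :=
        (mul_le_of_le_one_left (norm_nonneg _) h1).trans hDα
      linarith
    calc ‖E‖ ^ q ≤ (2 * ‖D‖ + l * d) ^ q := by gcongr
      _ ≤ 2 ^ q * ((2 * ‖D‖) ^ q + (l * d) ^ q) :=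
          two_rpow_mul_add (by positivity) (by positivity) hq0
      _ ≤ _ := by
          rw [Real.mul_rpow (by norm_num) (norm_nonneg _)]
          gcongr
          exact rpow_le_one_add_rpow (by positivity) hq0 hqp
  have b5 : ‖w‖ ^ q ≤ 2 ^ q * (2 ^ q * ‖s‖ ^ q + (1 + |k| ^ p)) := by
    have : ‖w‖ ≤ 2 * ‖s‖ + |k| := by
      rw [hw]
      refine (norm_add_le _ _).trans ?_
      have h3 : ‖EuclideanSpace.single α (-(h * d))‖ = h * d := by
        rw [PiLp.norm_single, norm_neg, Real.norm_of_nonneg (by positivity)]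
      rw [h3]
      have h4 : h * d ≤ d := mul_le_of_le_one_left hd0 h1
      have h5 : d ≤ |s α| + |k| := by
        rw [hd]; have := le_abs_self (s α); have := neg_abs_le k; linarith
      linarith
    calc ‖w‖ ^ q ≤ (2 * ‖s‖ + |k|) ^ q := by gcongr
      _ ≤ 2 ^ q * ((2 * ‖s‖) ^ q + |k| ^ q) :=
          two_rpow_mul_add (by positivity) (by positivity) hq0
      _ ≤ _ := by
          rw [Real.mul_rpow (by norm_num) (norm_nonneg _)]
          gcongr
          exact rpow_le_one_add_rpow (by positivity) hq0 hqp
  have t1 : 0 ≤ (l * d) ^ p := by positivity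
  have t2 : 0 ≤ b * d ^ γ := by positivity
  have t3 : 0 ≤ |k| ^ γ * b := by positivity
  have t4 : 0 ≤ ‖D‖ ^ q := by positivity
  have t5 : 0 ≤ ‖s‖ ^ q := by positivity
  have t6 : 0 ≤ |k| ^ p := by positivity
  have t7 : 0 ≤ (1 - h) ^ p * ‖D α‖ ^ p :=
    mul_nonneg (Real.rpow_nonneg (by linarith) _) (by positivity)
  have p2 : (0 : ℝ) < 2 ^ p := by positivity
  have γ2 : (0 : ℝ) < 2 ^ γ := by positivity
  have q2 : (1 : ℝ) ≤ 2 ^ q := Real.one_le_rpow (by norm_num) hq0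
  set T1 := (l * d) ^ p
  set T2 := b * d ^ γ
  set T3 := |k| ^ γ * b
  set T5 := ‖D‖ ^ q
  set T6 := ‖s‖ ^ q
  set T7 := |k| ^ p
  set P := ‖D α‖ ^ p
  set Q := (1 - h) ^ p * P
  have hΛ0 : 0 < Λ := by linarith
  have hC0 : 0 < C := by linarith
  have f1 : f α (w α) (E α) ≤ Λ * (2 ^ p * (Q + T1) + 2 ^ γ * (T2 + T3) + a₁) :=
    hQ.2.trans (by gcongr)
  have f2 : P - 2 ^ γ * (T2 + T3) - a₁ ≤ f α (s α) (D α) := by linarith [hP.1]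
  have g1 : G w E ≤ C * (2 ^ q * (2 ^ q * T5 + (1 + T1)) + 2 ^ q * (2 ^ q * T6 + (1 + T7)) + a₂) :=
    hG2.2.trans (by gcongr)
  have g2 : -(C * (T5 + T6 + a₂)) ≤ G s D := hG1.1
  have hq22 : 0 ≤ (2 : ℝ) ^ q * 2 ^ q := by positivity
  have r1 : f α (w α) (E α) - f α (s α) (D α) ≤ Λ * 2 ^ p * Q - P +
      (Λ * 2 ^ p + (Λ + 1) * 2 ^ γ + (Λ + 1)) * (T1 + (T2 + T3) + a₁) := by
    have : Λ * (2 ^ p * (Q + T1) + 2 ^ γ * (T2 + T3) + a₁) - (P - 2 ^ γ * (T2 + T3) - a₁) =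
      Λ * 2 ^ p * Q - P + (Λ * 2 ^ p * T1 + (Λ + 1) * 2 ^ γ * (T2 + T3) + (Λ + 1) * a₁) := by ring
    have m1 : 0 ≤ Λ * 2 ^ p := by positivity
    have m2 : 0 ≤ (Λ + 1) * 2 ^ γ := by positivity
    have m3 : 0 ≤ Λ + 1 := by positivity
    have m4 : 0 ≤ T2 + T3 := by positivity
    have n1 := mul_nonneg m1 m4
    have n2 := mul_nonneg m1 ha₁
    have n3 := mul_nonneg m2 t1
    have n4 := mul_nonneg m2 ha₁
    have n5 := mul_nonneg m3 t1
    have n6 := mul_nonneg m3 m4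
    linarith
  have r2 : G w E - G s D ≤ C * (2 ^ q * 2 ^ q + 2 * 2 ^ q + 2) *
      (T1 + a₂ + (T5 + T6) + (1 + T7)) := by
    have e : C * (2 ^ q * (2 ^ q * T5 + (1 + T1)) + 2 ^ q * (2 ^ q * T6 + (1 + T7)) + a₂) +
      C * (T5 + T6 + a₂) = C * (2 ^ q * 2 ^ q * (T5 + T6) + 2 ^ q * (2 + T1 + T7) + 2 * a₂ +
        (T5 + T6)) := by ring
    have m : 2 ^ q * 2 ^ q * (T5 + T6) + 2 ^ q * (2 + T1 + T7) + 2 * a₂ + (T5 + T6) ≤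
        (2 ^ q * 2 ^ q + 2 * 2 ^ q + 2) * (T1 + a₂ + (T5 + T6) + (1 + T7)) := by
      have q0 : (0 : ℝ) ≤ 2 ^ q := by positivity
      have e' : (2 ^ q * 2 ^ q + 2 * 2 ^ q + 2) * (T1 + a₂ + (T5 + T6) + (1 + T7)) =
        2 ^ q * 2 ^ q * (T5 + T6) + 2 ^ q * (2 + T1 + T7) + 2 * a₂ + (T5 + T6) +
          (2 ^ q * 2 ^ q * (T1 + a₂ + (1 + T7)) + 2 ^ q * (T1 + T7 + 2 * a₂ + 2 * (T5 + T6)) +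
            (2 * T1 + (T5 + T6) + 2 * (1 + T7))) := by ring
      rw [e']
      exact le_add_of_nonneg_right (by positivity)
    calc G w E - G s D ≤ C * (2 ^ q * 2 ^ q * (T5 + T6) + 2 ^ q * (2 + T1 + T7) + 2 * a₂ +
        (T5 + T6)) := by linarith
      _ ≤ C * ((2 ^ q * 2 ^ q + 2 * 2 ^ q + 2) * (T1 + a₂ + (T5 + T6) + (1 + T7))) := by gcongr
      _ = _ := by ring
  have k1 : 0 ≤ Λ * 2 ^ p + (Λ + 1) * 2 ^ γ + (Λ + 1) := by positivity
  have k2 : 0 ≤ C * (2 ^ q * 2 ^ q + 2 * 2 ^ q + 2) := by positivity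
  have r3 : (Λ * 2 ^ p + (Λ + 1) * 2 ^ γ + (Λ + 1)) * (T1 + (T2 + T3) + a₁) ≤
      (Λ * 2 ^ p + (Λ + 1) * 2 ^ γ + (Λ + 1)) *
        (T1 + T2 + T3 + (a₁ + a₂) + (T5 + T6) + (1 + T7)) :=
    mul_le_mul_of_nonneg_left (by linarith) (by assumption)
  have r4 : C * (2 ^ q * 2 ^ q + 2 * 2 ^ q + 2) * (T1 + a₂ + (T5 + T6) + (1 + T7)) ≤
      C * (2 ^ q * 2 ^ q + 2 * 2 ^ q + 2) *
        (T1 + T2 + T3 + (a₁ + a₂) + (T5 + T6) + (1 + T7)) :=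
    mul_le_mul_of_nonneg_left (by linarith) (by assumption)
  have r5 : (∑ β, f β (w β) (E β)) + G w E - ((∑ β, f β (s β) (D β)) + G s D) =
      (f α (w α) (E α) - f α (s α) (D α)) + (G w E - G s D) := by linarith
  rw [r5, add_mul]
  linarith

/-- The energy inequality on superlevel sets obtained by testing minimality with a truncation. -/
theorem IsLocalMinimizer.exists_energy_inequality {n N : ℕ} {Ω : Set (EuclideanSpace ℝ (Fin N))}
    (hΩ : IsOpen Ω) {p ε q C : ℝ} (hp1 : 1 < p) (hpN : p < N) {γ L : Fin n → ℝ}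
    {aα bα : Fin n → EuclideanSpace ℝ (Fin N) → ℝ} {a : EuclideanSpace ℝ (Fin N) → ℝ}
    {f : Fin n → EuclideanSpace ℝ (Fin N) → ℝ → EuclideanSpace ℝ (Fin N) → ℝ}
    {G : EuclideanSpace ℝ (Fin N) → EuclideanSpace ℝ (Fin n) → GradMat n N → ℝ}
    (hF : HypF Ω p ε γ L aα bα f) (hG : HypG Ω p ε q C a G)
    {u : EuclideanSpace ℝ (Fin N) → EuclideanSpace ℝ (Fin n)}
    {Du : EuclideanSpace ℝ (Fin N) → GradMat n N} (hu : IsLocalMinimizer Ω p f G u Du)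
    (α : Fin n) :
    ∃ Λ c₁ c₀ : ℝ, 0 < Λ ∧ 0 < c₁ ∧ 0 < c₀ ∧
      ∀ (x₀ : EuclideanSpace ℝ (Fin N)) (k s m : ℝ), 0 < s → s < m →
        Metric.closedBall x₀ m ⊆ Ω →
        (∫ x in superBall (fun y => u y α) x₀ k s, ‖Du x α‖ ^ p) ≤
          Λ * ((∫ x in superBall (fun y => u y α) x₀ k m, ‖Du x α‖ ^ p) -
            ∫ x in superBall (fun y => u y α) x₀ k s, ‖Du x α‖ ^ p) +
          c₁ * ((c₀ / (m - s)) ^ p *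
              (∫ x in superBall (fun y => u y α) x₀ k m, (u x α - k) ^ p) +
            (∫ x in superBall (fun y => u y α) x₀ k m, bα α x * (u x α - k) ^ γ α) +
            |k| ^ γ α * (∫ x in superBall (fun y => u y α) x₀ k m, bα α x) +
            (∫ x in superBall (fun y => u y α) x₀ k m, (aα α x + a x)) +
            (∫ x in superBall (fun y => u y α) x₀ k m, (‖Du x‖ ^ q + ‖u x‖ ^ q)) +
            (1 + |k| ^ p) * volume.real (superBall (fun y => u y α) x₀ k m)) := by
  obtain ⟨c₀, hc₀, hcut⟩ := exists_cutoff_ball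
  have hp0 : 0 < p := by linarith
  have hN0 : (0 : ℝ) < N := hp0.trans hpN
  have hps := lt_sobolevConj hp0 hpN
  have hL := hF.one_lt_L α
  have hC := hG.one_lt_C
  have hq0 : 0 ≤ q := by linarith [hG.one_le_q]
  have hqp : q ≤ p := by
    have h1 := hG.q_lt
    rw [lt_div_iff₀ hN0] at h1
    nlinarith
  have hγ0 : 0 ≤ γ α := hp0.le.trans (hF.p_le_γ α)
  have hL0 : 0 < L α := by linarith
  have hC0 : 0 < C := by linarith
  have hκ : 1 ≤ N / (p - ε * N) := by
    have h1 := hF.ε_lt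
    rw [lt_div_iff₀ hN0] at h1
    rw [one_le_div (by linarith)]
    nlinarith [hF.ε_pos]
  have hκ' := one_le_ofReal hκ
  set c₁ := L α * 2 ^ p + (L α + 1) * 2 ^ γ α + (L α + 1) +
    C * (2 ^ q * 2 ^ q + 2 * 2 ^ q + 2) with hc₁
  have hc₁0 : 0 < c₁ := by positivity
  refine ⟨L α * 2 ^ p, c₁, c₀, by positivity, hc₁0, hc₀, fun x₀ k s m hs hsm hmΩ => ?_⟩
  obtain ⟨η, hη, hηS, hη0, hη1, hηs, hηm, hηg⟩ := hcut x₀ s m hs hsm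
  set S := Metric.closedBall x₀ m with hSdef
  have hS : IsCompact S := isCompact_closedBall x₀ m
  have hηc : HasCompactSupport η := hS.of_isClosed_subset (isClosed_tsupport _) hηS
  set v : EuclideanSpace ℝ (Fin N) → ℝ := fun y => u y α with hv
  set A := superBall v x₀ k m with hA
  have hW := hu.isW1pLoc
  have h1p := one_le_ofReal hp1.le
  have hvL := hW.memLp.apply α
  have hgL := hW.memLp_grad.row α
  obtain ⟨hV, hV'⟩ := hvL.posPart hgL k
  have hwV := (hW.weakGradient α).posPart hΩ (hvL.mono_exponent h1p) (hgL.mono_exponent h1p) k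
  have hwη := (hwV.cutoff_mul (hV.mono_exponent h1p) (hV'.mono_exponent h1p) hη hηc
    (hηS.trans hmΩ)).neg.of_univ (Ω := Ω)
  obtain ⟨hm1, hm2⟩ := hV.cutoff hV' hη hηc (hηS.trans hmΩ)
  have hφ := IsW1pLoc.single (p := p) α hwη (fun K _ _ => hm1.neg.restrict K)
    (fun K _ _ => hm2.neg.restrict K)
  -- u + φ lowers the component α towards k on the superlevel set, completely so where η = 1.
  set φ : EuclideanSpace ℝ (Fin N) → EuclideanSpace ℝ (Fin n) :=
    fun x => EuclideanSpace.single α (-(η x * max (v x - k) 0)) with hφdef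
  set Dφ : EuclideanSpace ℝ (Fin N) → GradMat n N := fun x => PiLp.single 2 α
    (-(η x • {x | k < v x}.indicator (fun x => Du x α) x + max (v x - k) 0 • vecGrad η x)) with hDφ
  have hφS : tsupport φ ⊆ S := closure_minimal (fun x hx => by
    by_contra hxS
    refine hx ?_
    have : η x = 0 := image_eq_zero_of_notMem_tsupport fun h => hxS (hηS h)
    simp [hφdef, this]) Metric.isClosed_closedBall
  have hi1 : IntegrableOn (energyDensity f G u Du) S :=
    hW.integrableOn_energyDensity hΩ hp1 hpN hF hG hS hmΩ
  have hi2 : IntegrableOn (energyDensity f G (u + φ) (Du + Dφ)) S :=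
    (hW.add hp1.le hφ).integrableOn_energyDensity hΩ hp1 hpN hF hG hS hmΩ
  have hmin := hu.le S φ Dφ hS hmΩ hφ hφS hi2
  have hAS : A ⊆ S := inter_subset_right.trans Metric.ball_subset_closedBall
  -- Off A the two maps and their chosen gradients coincide, so minimality on the closed ball
  -- localizes to A.
  have hzero : ∀ x ∈ S \ A, energyDensity f G (u + φ) (Du + Dφ) x - energyDensity f G u Du x = 0 := by
    intro x hx
    have h1 : φ x = 0 ∧ Dφ x = 0 := by
      by_cases hxk : k < v x
      · have hxb : x ∉ Metric.ball x₀ m := fun h => hx.2 ⟨hxk, h⟩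
        obtain ⟨e1, e2⟩ := hηm x hxb
        constructor
        · simp [hφdef, e1]
        · simp [hDφ, e1, e2, PiLp.single_eq_zero_iff]
      · have e1 : max (v x - k) 0 = 0 := max_eq_right (by linarith)
        constructor
        · simp [hφdef, e1]
        · simp [hDφ, e1, indicator_of_notMem (show x ∉ {x | k < v x} from hxk),
            PiLp.single_eq_zero_iff]
    simp [energyDensity, h1.1, h1.2]
  have hA0 : 0 ≤ ∫ x in A, (energyDensity f G (u + φ) (Du + Dφ) x - energyDensity f G u Du x) := by
    rw [← setIntegral_eq_of_subset_of_forall_sdiff_eq_zero hS.measurableSet hAS hzero,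
      integral_sub hi2 hi1]
    linarith
  -- measurability and integrability on `A`
  have hvS := hvL S hS hmΩ
  have hAm : NullMeasurableSet A volume := nullMeasurableSet_superBall
    (hvS.1.aemeasurable.mono_measure (Measure.restrict_mono Metric.ball_subset_closedBall le_rfl))
  have hAvol : volume A < ⊤ := (measure_mono hAS).trans_lt hS.measure_lt_top
  have : IsFiniteMeasure (volume.restrict A) := ⟨by simpa using hAvol⟩
  have hmA : ∀ {Y : Type} [NormedAddCommGroup Y] {s : ℝ≥0∞} {g : EuclideanSpace ℝ (Fin N) → Y},
      MemLp g s (volume.restrict S) → MemLp g s (volume.restrict A) := fun h =>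
    h.mono_measure (Measure.restrict_mono hAS le_rfl)
  have hvps := hmA ((hW.weakGradient α).memLpLoc_sobolevConj hΩ hp1.le hpN hvL hgL S hS hmΩ)
  have hAmem := ae_restrict_mem₀ hAm
  have iP : IntegrableOn (fun x => ‖Du x α‖ ^ p) A := integrable_norm_rpow_ofReal hp0
    (hmA (hgL S hS hmΩ))
  have i1 : IntegrableOn (fun x => (u x α - k) ^ p) A := by
    refine (integrable_norm_rpow_ofReal hp0
      ((hmA hvS).sub (memLp_const (μ := volume.restrict A) k))).congr ?_
    filter_upwards [hAmem] with x hx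
    have : k < u x α := hx.1
    simp only [Pi.sub_apply, Real.norm_eq_abs]
    rw [abs_of_nonneg (by linarith)]
  have haeA : ∀ {P : EuclideanSpace ℝ (Fin N) → Prop}, (∀ᵐ x ∂(volume.restrict Ω), P x) →
      ∀ᵐ x ∂(volume.restrict A), P x := fun h =>
    ae_restrict_of_ae_restrict_of_subset (hAS.trans hmΩ) h
  have i2 : IntegrableOn (fun x => bα α x * (u x α - k) ^ γ α) A := by
    refine (integral_abs_mul_rpow_le (div_pos (hp0.trans hps) (hF.exponent_pos α)) hγ0
      (hp0.trans hps) hF.ε_pos.le (by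
        have := (hp0.trans hps).ne'
        rw [one_div_div]; field_simp; ring) (hmA (hF.b_memLp α S hS hmΩ))
        (hvps.sub (memLp_const k))).1.congr ?_
    filter_upwards [hAmem, haeA (hF.b_nonneg α)] with x hx hbx
    have : k < u x α := hx.1
    simp only [Pi.sub_apply]
    rw [abs_of_nonneg hbx, abs_of_nonneg (by linarith)]
  have hσ : 1 ≤ sobolevConj N p / (sobolevConj N p - γ α - ε * sobolevConj N p) := by
    rw [one_le_div (hF.exponent_pos α)]
    nlinarith [hF.ε_pos]
  have i3 : IntegrableOn (bα α) A := memLp_one_iff_integrable.1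
    ((hmA (hF.b_memLp α S hS hmΩ)).mono_exponent (one_le_ofReal hσ))
  have i4 : IntegrableOn (fun x => aα α x + a x) A :=
    (memLp_one_iff_integrable.1 ((hmA (hF.a_memLp α S hS hmΩ)).mono_exponent hκ')).add
    (memLp_one_iff_integrable.1 ((hmA (hG.a_memLp S hS hmΩ)).mono_exponent hκ'))
  have i5 : IntegrableOn (fun x => ‖Du x‖ ^ q + ‖u x‖ ^ q) A :=
    (integral_norm_rpow_le hp0 hq0 hqp (hmA (hW.memLp_grad S hS hmΩ))).1.add
    (integral_norm_rpow_le hp0 hq0 hqp (hmA (hW.memLp S hS hmΩ))).1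
  have i6 : IntegrableOn (fun _ : EuclideanSpace ℝ (Fin N) => 1 + |k| ^ p) A :=
    integrable_const _
  set l := c₀ / (m - s) with hl
  have hl0 : 0 ≤ l := div_nonneg hc₀.le (by linarith)
  have i7 : IntegrableOn ((Metric.ball x₀ s).indicator fun x => ‖Du x α‖ ^ p) A :=
    iP.indicator measurableSet_ball
  have hpt : ∀ᵐ x ∂(volume.restrict A),
      energyDensity f G (u + φ) (Du + Dφ) x - energyDensity f G u Du x ≤
      (L α * 2 ^ p * (‖Du x α‖ ^ p - (Metric.ball x₀ s).indicator (fun x => ‖Du x α‖ ^ p) x) -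
        (Metric.ball x₀ s).indicator (fun x => ‖Du x α‖ ^ p) x) +
      c₁ * (l ^ p * (u x α - k) ^ p + bα α x * (u x α - k) ^ γ α + |k| ^ γ α * bα α x +
        (aα α x + a x) + (‖Du x‖ ^ q + ‖u x‖ ^ q) + (1 + |k| ^ p)) := by
    filter_upwards [hAmem, haeA (hF.b_nonneg α), haeA (hF.a_nonneg α), haeA hG.a_nonneg,
      haeA (hF.growth α), haeA hG.growth] with x hx hbx hax hax' hfx hGx
    have hkx : k < u x α := hx.1
    have key := energyDensity_competitor_sub_le hp1 hG.one_le_q hqp hC hL hγ0 hbx hax hax'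
      (f := fun β => f β x) α hfx hGx (u x) (Du x) (vecGrad η x) hkx.le (hη0 x) (hη1 x)
      (hηg x)
    have e1 : max (v x - k) 0 = u x α - k := max_eq_left (by simp only [hv]; linarith)
    have e2 : {x | k < v x}.indicator (fun x => Du x α) x = Du x α :=
      indicator_of_mem (show x ∈ {x | k < v x} from hkx) _
    rw [Real.mul_rpow hl0 (by linarith)] at key
    refine (le_of_eq ?_).trans (key.trans ?_)
    · simp only [energyDensity, Pi.add_apply, hφdef, hDφ, e1, e2]
    · refine add_le_add_left ?_ _
      have hPnn : 0 ≤ ‖Du x α‖ ^ p := by positivity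
      -- On the inner ball η = 1 and only −|∇u^α|^p survives; on the annulus 1 − η ≤ 1 leaves the
      -- hole-filling term, and the good term is discarded.
      by_cases hxs : x ∈ Metric.ball x₀ s
      · rw [indicator_of_mem hxs, hηs x hxs, sub_self, sub_self, Real.zero_rpow hp0.ne']
        simp
      · rw [indicator_of_notMem hxs, sub_zero, sub_zero]
        have h2 : (1 - η x) ^ p ≤ 1 := Real.rpow_le_one (by linarith [hη1 x])
          (by linarith [hη0 x]) hp0.le
        have h3 : (1 - η x) ^ p * ‖Du x α‖ ^ p ≤ ‖Du x α‖ ^ p :=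
          mul_le_of_le_one_left hPnn h2
        have h4 : L α * 2 ^ p * ((1 - η x) ^ p * ‖Du x α‖ ^ p) ≤ L α * 2 ^ p * ‖Du x α‖ ^ p := by
          gcongr
        linarith
  have j1 := (iP.sub i7).const_mul (L α * 2 ^ p)
  have j2 := j1.sub i7
  have k1 := (i1.const_mul (l ^ p)).add i2
  have k2 := k1.add (i3.const_mul (|k| ^ γ α))
  have k3 := k2.add i4
  have k4 := k3.add i5
  have k5 := k4.add i6
  have hint := integral_mono_ae ((hi2.sub hi1).mono_set hAS) (j2.add (k5.const_mul c₁)) hpt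
  have hsplit : ∫ x in A, ((L α * 2 ^ p * (‖Du x α‖ ^ p -
        (Metric.ball x₀ s).indicator (fun x => ‖Du x α‖ ^ p) x) -
        (Metric.ball x₀ s).indicator (fun x => ‖Du x α‖ ^ p) x) +
      c₁ * (l ^ p * (u x α - k) ^ p + bα α x * (u x α - k) ^ γ α + |k| ^ γ α * bα α x +
        (aα α x + a x) + (‖Du x‖ ^ q + ‖u x‖ ^ q) + (1 + |k| ^ p))) =
      (L α * 2 ^ p * ((∫ x in A, ‖Du x α‖ ^ p) - ∫ x in superBall v x₀ k s, ‖Du x α‖ ^ p) -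
        ∫ x in superBall v x₀ k s, ‖Du x α‖ ^ p) +
      c₁ * (l ^ p * (∫ x in A, (u x α - k) ^ p) + (∫ x in A, bα α x * (u x α - k) ^ γ α) +
        |k| ^ γ α * (∫ x in A, bα α x) + (∫ x in A, (aα α x + a x)) +
        (∫ x in A, (‖Du x‖ ^ q + ‖u x‖ ^ q)) + (1 + |k| ^ p) * volume.real A) := by
    have hAs : ∫ x in A, (Metric.ball x₀ s).indicator (fun x => ‖Du x α‖ ^ p) x =
        ∫ x in superBall v x₀ k s, ‖Du x α‖ ^ p := by
      rw [setIntegral_indicator measurableSet_ball, superBall_inter_ball v x₀ k hsm.le]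
    have s1 := integral_add j2 (k5.const_mul c₁)
    have s2 := integral_sub j1 i7
    have s3 := integral_sub iP i7
    have s4 := integral_add k4 i6
    have s5 := integral_add k3 i5
    have s6 := integral_add k2 i4
    have s7 := integral_add k1 (i3.const_mul (|k| ^ γ α))
    have s8 := integral_add (i1.const_mul (l ^ p)) i2
    simp only [Pi.add_apply, Pi.sub_apply, integral_const_mul] at s1 s2 s3 s4 s5 s6 s7 s8
    rw [s1, s2, s3, s4, s5, s6, s7, s8, hAs]
    simp [mul_comm]
  simp only [Pi.add_apply, Pi.sub_apply] at hint
  rw [hsplit] at hint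
  linarith

/-! ### Levels too large for the size of the superlevel set. -/

theorem div_sobolevConj {N : ℕ} {p : ℝ} (hp : 0 < p) (hpN : p < N) :
    p / sobolevConj N p = 1 - p / N := by
  have hN : (0 : ℝ) < N := hp.trans hpN
  have : (N : ℝ) - p ≠ 0 := by linarith
  unfold sobolevConj
  field_simp

/-- Chebyshev's inequality, with a right-hand side independent of T and k. -/
theorem rpow_mul_measureReal_le_integral {N : ℕ} {s : ℝ} (hs : 0 < s)
    {K T : Set (EuclideanSpace ℝ (Fin N))} (hK : IsCompact K) (hTK : T ⊆ K)
    (hT : NullMeasurableSet T volume) {v : EuclideanSpace ℝ (Fin N) → ℝ}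
    (hv : MemLp v (ENNReal.ofReal s) (volume.restrict K)) {k : ℝ} (hk : ∀ x ∈ T, |k| ≤ |v x|) :
    |k| ^ s * volume.real T ≤ ∫ x in K, |v x| ^ s := by
  have hTv : volume T < ⊤ := (measure_mono hTK).trans_lt hK.measure_lt_top
  have : IsFiniteMeasure (volume.restrict T) := ⟨by simpa using hTv⟩
  have hi : IntegrableOn (fun x => |v x| ^ s) K := integrable_norm_rpow_ofReal hs hv
  calc |k| ^ s * volume.real T = ∫ x in T, |k| ^ s := by simp [mul_comm]
    _ ≤ ∫ x in T, |v x| ^ s := by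
        refine integral_mono_ae (integrable_const _) (hi.mono_set hTK) ?_
        filter_upwards [ae_restrict_mem₀ hT] with x hx
        exact Real.rpow_le_rpow (abs_nonneg _) (hk x hx) hs.le
    _ ≤ _ := setIntegral_mono_set hi (ae_of_all _ fun x => by positivity)
        (LE.le.eventuallyLE hTK)

/-- If the level is very large compared with the size of the superlevel set, then the function
exceeds the level by a definite amount on most of the ball. -/
theorem le_integral_superBall_of_lt {N : ℕ} {p : ℝ} (hp1 : 1 < p) (hpN : p < N)
    {K : Set (EuclideanSpace ℝ (Fin N))} (hK : IsCompact K) {v : EuclideanSpace ℝ (Fin N) → ℝ}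
    (hv : MemLp v (ENNReal.ofReal (sobolevConj N p)) (volume.restrict K))
    {x₀ : EuclideanSpace ℝ (Fin N)} {k R : ℝ} (hR : 0 < R) (hb : Metric.ball x₀ R ⊆ K)
    (hbad : 2 ^ (p + 1) * (∫ x in K, |v x| ^ sobolevConj N p) ^ (p / sobolevConj N p) + 1 <
      |k| ^ p * volume.real (superBall v x₀ k R) ^ (1 - p / N)) :
    (volume.real (Metric.ball (0 : EuclideanSpace ℝ (Fin N)) 1) / 2) ^ (p / N) * R ^ p ≤
      2 ^ (p + 1) * ∫ x in superBall v x₀ k R, (v x - k) ^ p := by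
  have hp0 : 0 < p := by linarith
  have hN0 : (0 : ℝ) < N := hp0.trans hpN
  have hps := lt_sobolevConj hp0 hpN
  have hdiv := div_sobolevConj hp0 hpN
  set s := sobolevConj N p with hs
  have hs0 : 0 < s := hp0.trans hps
  set A := superBall v x₀ k R with hA
  set M := ∫ x in K, |v x| ^ s with hM
  have hM0 : 0 ≤ M := integral_nonneg fun x => by positivity
  have hAB : A ⊆ Metric.ball x₀ R := inter_subset_right
  have hAK : A ⊆ K := hAB.trans hb
  have hAm : NullMeasurableSet A volume := nullMeasurableSet_superBall
    (hv.1.aemeasurable.mono_measure (Measure.restrict_mono hb le_rfl))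
  have hAv : volume A < ⊤ := (measure_mono hAK).trans_lt hK.measure_lt_top
  have hfA : IsFiniteMeasure (volume.restrict A) := ⟨by simpa using hAv⟩
  have hk0 : 0 ≤ |k| := abs_nonneg k
  have hA0 : 0 ≤ volume.real A := measureReal_nonneg
  set X := |k| ^ p * volume.real A ^ (1 - p / N) with hX
  have hMp : 0 ≤ M ^ (p / s) := by positivity
  have h2p : (1 : ℝ) ≤ 2 ^ (p + 1) := Real.one_le_rpow (by norm_num) (by linarith)
  -- Suppose A is less than half of the ball. If k ≥ 0 then |v| ≥ |k| on A; if k < 0 then |v| ≥ |k|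
  -- on the complement of A in the ball, which is larger than A. Either way Chebyshev bounds
  -- |k|^{p*} |A| by M, and the power p/p* = 1 − p/N of this contradicts `hbad`.
  have hhalf : volume.real (Metric.ball x₀ R) / 2 ≤ volume.real A := by
    by_contra hlt
    rw [not_le] at hlt
    have h1 : |k| ^ s * volume.real A ≤ M := by
      rcases le_or_gt 0 k with hk | hk
      · refine rpow_mul_measureReal_le_integral hs0 hK hAK hAm hv fun x hx => ?_
        have : k < v x := hx.1
        rw [abs_of_nonneg hk]
        exact this.le.trans (le_abs_self _)
      · have h2 : |k| ^ s * volume.real (Metric.ball x₀ R \ A) ≤ M := by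
          refine rpow_mul_measureReal_le_integral hs0 hK (sdiff_subset.trans hb)
            (measurableSet_ball.nullMeasurableSet.diff hAm) hv fun x hx => ?_
          have : ¬ k < v x := fun h => hx.2 ⟨h, hx.1⟩
          rw [abs_of_neg hk, abs_of_nonpos (by linarith)]
          linarith
        have h3 : volume.real (Metric.ball x₀ R) ≤
            volume.real A + volume.real (Metric.ball x₀ R \ A) := by
          refine (measureReal_mono (by rw [union_sdiff_self]; exact subset_union_right) ?_).trans
            (measureReal_union_le _ _)
          exact ((measure_union_le _ _).trans_lt (ENNReal.add_lt_top.2 ⟨hAv,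
            (measure_mono sdiff_subset).trans_lt measure_ball_lt_top⟩)).ne
        exact le_trans (mul_le_mul_of_nonneg_left (by linarith) (by positivity)) h2
    have h4 : X ≤ M ^ (p / s) := by
      calc X = (|k| ^ s * volume.real A) ^ (p / s) := by
            rw [Real.mul_rpow (by positivity) hA0, ← Real.rpow_mul hk0, mul_div_cancel₀ _ hs0.ne',
              hX, hdiv]
        _ ≤ _ := by gcongr
    nlinarith
  have hpN0 : 0 ≤ 1 - p / N := by rw [sub_nonneg, div_le_one hN0]; exact hpN.le
  set Y := volume.real A ^ (p / N) with hY
  have hY0 : 0 ≤ Y := by positivity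
  have hXY : |k| ^ p * volume.real A = X * Y := by
    rw [hX, hY, mul_assoc, ← Real.rpow_add_of_nonneg hA0 hpN0 (by positivity)]
    simp
  have hvp : MemLp v (ENNReal.ofReal p) (volume.restrict A) :=
    (hv.mono_measure (Measure.restrict_mono hAK le_rfl)).mono_exponent
      (ENNReal.ofReal_le_ofReal hps.le)
  have hvs : MemLp v (ENNReal.ofReal s) (volume.restrict A) :=
    hv.mono_measure (Measure.restrict_mono hAK le_rfl)
  have i1 : IntegrableOn (fun x => |v x| ^ p) A := integrable_norm_rpow_ofReal hp0 hvp
  have i2 : IntegrableOn (fun x => (v x - k) ^ p) A := by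
    refine (integrable_norm_rpow_ofReal hp0 (hvp.sub (memLp_const k))).congr ?_
    filter_upwards [ae_restrict_mem₀ hAm] with x hx
    have : k < v x := hx.1
    simp only [Pi.sub_apply, Real.norm_eq_abs]
    rw [abs_of_nonneg (by linarith)]
  -- On A one has |k| ≤ (v − k) + |v|. The |v|^p part costs at most M^{p/p*} |A|^{p/N}, which `hbad`
  -- makes less than half of the left side after the factor 2^p, so (v − k)^p carries the rest.
  have h5 : |k| ^ p * volume.real A ≤
      2 ^ p * ((∫ x in A, (v x - k) ^ p) + ∫ x in A, |v x| ^ p) := by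
    rw [← integral_add i2 i1, ← integral_const_mul]
    calc |k| ^ p * volume.real A = ∫ x in A, |k| ^ p := by simp [mul_comm]
      _ ≤ _ := by
        refine integral_mono_ae (integrable_const _) ((i2.add i1).const_mul _) ?_
        filter_upwards [ae_restrict_mem₀ hAm] with x hx
        have hkx : k < v x := hx.1
        have h6 : |k| ≤ (v x - k) + |v x| := by
          rw [abs_le]; have := le_abs_self (v x); have := neg_abs_le (v x)
          constructor <;> linarith
        exact (Real.rpow_le_rpow hk0 h6 hp0.le).trans
          (two_rpow_mul_add (by linarith) (abs_nonneg _) hp0.le)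
  have h7 : ∫ x in A, |v x| ^ p ≤ M ^ (p / s) * Y := by
    have := (integral_norm_rpow_le hs0 hp0.le hps.le hvs).2
    simp only [Real.norm_eq_abs, measureReal_restrict_apply_univ] at this
    refine this.trans ?_
    have e : 1 - p / s = p / N := by rw [hdiv]; ring
    rw [e]
    gcongr
    exact setIntegral_mono_set (integrable_norm_rpow_ofReal hs0 hv)
      (ae_of_all _ fun x => by positivity) (LE.le.eventuallyLE hAK)
  have e2 : (2 : ℝ) ^ (p + 1) = 2 * 2 ^ p := by
    rw [Real.rpow_add (by norm_num), Real.rpow_one]; ring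
  have hball : volume.real (Metric.ball x₀ R) =
      R ^ (N : ℝ) * volume.real (Metric.ball (0 : EuclideanSpace ℝ (Fin N)) 1) := by
    have hNe : Nonempty (Fin N) := ⟨⟨0, by exact_mod_cast hN0⟩⟩
    rw [Measure.real, Measure.addHaar_ball _ _ hR.le, ENNReal.toReal_mul,
      ENNReal.toReal_ofReal (by positivity), finrank_euclideanSpace_fin, Real.rpow_natCast,
      Measure.real]
  set V₁ := volume.real (Metric.ball (0 : EuclideanSpace ℝ (Fin N)) 1) with hV₁
  have hV₁0 : 0 ≤ V₁ := measureReal_nonneg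
  -- A fills at least half of the ball, of volume R^N V₁, so |A|^{p/N} is at least a multiple of
  -- R^p.
  have h8 : (V₁ / 2) ^ (p / N) * R ^ p ≤ Y := by
    calc (V₁ / 2) ^ (p / N) * R ^ p = (R ^ (N : ℝ) * V₁ / 2) ^ (p / N) := by
          rw [mul_div_assoc, Real.mul_rpow (by positivity) (by positivity), ← Real.rpow_mul hR.le,
            mul_div_cancel₀ _ hN0.ne', mul_comm]
      _ ≤ Y := by
          rw [hY]
          refine Real.rpow_le_rpow (by positivity) ?_ (by positivity)
          rw [← hball]; exact hhalf
  refine h8.trans ?_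
  rw [e2] at hbad ⊢
  have h2p0 : (0 : ℝ) < 2 ^ p := by positivity
  have h9 : X * Y ≤ 2 ^ p * (∫ x in A, (v x - k) ^ p) + 2 ^ p * (M ^ (p / s) * Y) := by
    rw [← hXY]
    calc _ ≤ _ := h5
      _ ≤ 2 ^ p * ((∫ x in A, (v x - k) ^ p) + M ^ (p / s) * Y) := by gcongr
      _ = _ := by ring
  have h10 : (2 * 2 ^ p * M ^ (p / s) + 1) * Y ≤ X * Y := by gcongr
  have h11 : 1 * Y ≤ X * Y := by
    refine mul_le_mul_of_nonneg_right ?_ hY0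
    have : 0 ≤ 2 * 2 ^ p * M ^ (p / s) := by positivity
    linarith
  nlinarith

/-! ### Lower-order terms at moderate levels. -/

set_option maxHeartbeats 1000000 in
/-- Estimate of the critical lower order term through the Sobolev inequality. -/
theorem exists_integral_mul_rpow_superBall_le {N : ℕ} {Ω : Set (EuclideanSpace ℝ (Fin N))}
    (hΩ : IsOpen Ω) {p ε γ : ℝ} (hp1 : 1 < p) (hpN : p < N) (hε : 0 < ε) (hpγ : p ≤ γ)
    (hexp : 0 < sobolevConj N p - γ - ε * sobolevConj N p)
    {v : EuclideanSpace ℝ (Fin N) → ℝ} {g : EuclideanSpace ℝ (Fin N) → EuclideanSpace ℝ (Fin N)}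
    (hw : HasWeakGradient Ω v g) (hv : MemLpLoc Ω (ENNReal.ofReal p) v)
    (hg : MemLpLoc Ω (ENNReal.ofReal p) g) {b : EuclideanSpace ℝ (Fin N) → ℝ}
    (hb0 : ∀ᵐ x ∂(volume.restrict Ω), 0 ≤ b x)
    (hb : MemLpLoc Ω (ENNReal.ofReal
      (sobolevConj N p / (sobolevConj N p - γ - ε * sobolevConj N p))) b)
    {K : Set (EuclideanSpace ℝ (Fin N))} (hK : IsCompact K) (hKΩ : K ⊆ Ω) {B : ℝ} (hB : 0 ≤ B) :
    ∃ κ c : ℝ, 0 ≤ κ ∧ 0 < c ∧ ∀ (x₀ : EuclideanSpace ℝ (Fin N)) (k m t : ℝ), 0 < m → m < t →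
      Metric.closedBall x₀ t ⊆ K → |k| ^ p * volume.real (superBall v x₀ k t) ^ (1 - p / N) ≤ B →
      ∫ x in superBall v x₀ k m, b x * (v x - k) ^ γ ≤
        κ * volume.real (superBall v x₀ k t) ^ ε *
          ((∫ x in superBall v x₀ k t, ‖g x‖ ^ p) +
            (c / (t - m)) ^ p * ∫ x in superBall v x₀ k t, (v x - k) ^ p) := by
  obtain ⟨c, hc, hcut⟩ := exists_cutoff_ball
  obtain ⟨S, hS⟩ := exists_eLpNorm_cutoff_le hp1.le hpN
  have hp0 : 0 < p := by linarith
  have hN0 : (0 : ℝ) < N := hp0.trans hpN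
  have hps := lt_sobolevConj hp0 hpN
  have hdiv := div_sobolevConj hp0 hpN
  have hvs := hw.memLpLoc_sobolevConj hΩ hp1.le hpN hv hg
  set s := sobolevConj N p with hs
  have hs0 : 0 < s := hp0.trans hps
  have hγ0 : 0 ≤ γ := hp0.le.trans hpγ
  set σ := s / (s - γ - ε * s) with hσ
  have hσ0 : 0 < σ := div_pos hs0 hexp
  -- The exponent ε left over for |A| is what makes the critical term absorbable on small balls.
  have hsum : 1 / σ + γ / s + ε = 1 := by
    rw [hσ, one_div_div]; field_simp; ring
  set M := ∫ x in K, |v x| ^ s with hM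
  have hM0 : 0 ≤ M := integral_nonneg fun x => by positivity
  set Bσ := (∫ x in K, |b x| ^ σ) ^ (1 / σ) with hBσ
  have hBσ' : 0 ≤ ∫ x in K, |b x| ^ σ := integral_nonneg fun x => by positivity
  have hBσ0 : 0 ≤ Bσ := by positivity
  -- Bound for ∫ φ^{p*} independent of k: M accounts for v, and B^{p*/p} for |k|^{p*} |A|, by the
  -- restriction on the level.
  set Q := 2 ^ s * (M + B ^ (s / p)) with hQ
  have hQ0 : 0 ≤ Q := by positivity
  refine ⟨Bσ * Q ^ ((γ - p) / s) * ((S : ℝ) ^ p * 2 ^ p), c, by positivity, hc,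
    fun x₀ k m t hm hmt htK hgood => ?_⟩
  obtain ⟨η, hη, hηt, hη0, hη1, hηm, hηo, hηg⟩ := hcut x₀ m t hm hmt
  have hηc : HasCompactSupport η :=
    (isCompact_closedBall x₀ t).of_isClosed_subset (isClosed_tsupport _) hηt
  have hηΩ : tsupport η ⊆ Ω := hηt.trans (htK.trans hKΩ)
  set A := superBall v x₀ k t with hA
  have hAK : A ⊆ K := inter_subset_right.trans (Metric.ball_subset_closedBall.trans htK)
  have hAm : NullMeasurableSet A volume := nullMeasurableSet_superBall
    ((hvs K hK hKΩ).1.aemeasurable.mono_measure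
      (Measure.restrict_mono (Metric.ball_subset_closedBall.trans htK) le_rfl))
  have hAv : volume A < ⊤ := (measure_mono hAK).trans_lt hK.measure_lt_top
  have hfA : IsFiniteMeasure (volume.restrict A) := ⟨by simpa using hAv⟩
  have hA0 : 0 ≤ volume.real A := measureReal_nonneg
  have hmA : ∀ {Y : Type} [NormedAddCommGroup Y] {s : ℝ≥0∞} {g : EuclideanSpace ℝ (Fin N) → Y},
      MemLp g s (volume.restrict K) → MemLp g s (volume.restrict A) := fun h =>
    h.mono_measure (Measure.restrict_mono hAK le_rfl)
  have hAmem := ae_restrict_mem₀ hAm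
  have h1p := one_le_ofReal hp1.le
  obtain ⟨hV, hV'⟩ := hv.posPart hg k
  have hwV := hw.posPart hΩ (hv.mono_exponent h1p) (hg.mono_exponent h1p) k
  obtain ⟨hm1, hm2⟩ := hV.cutoff hV' hη hηc hηΩ
  set φ := fun x => η x * max (v x - k) 0 with hφ
  set Dφ := fun x => η x • {x | k < v x}.indicator g x + max (v x - k) 0 • vecGrad η x with hDφ
  obtain ⟨hφs, hsob⟩ := integral_rpow_le_of_eLpNorm_le hs0 hp0 hm2 hm1.1
    (hS Ω _ _ hwV hV hV' η hη hηc hηΩ)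
  have hout : ∀ x ∉ A, φ x = 0 ∧ Dφ x = 0 := fun x hx => by
    by_cases hxk : k < v x
    · have hxb : x ∉ Metric.ball x₀ t := fun h => hx ⟨hxk, h⟩
      obtain ⟨e1, e2⟩ := hηo x hxb
      exact ⟨by simp [hφ, e1], by simp [hDφ, e1, e2]⟩
    · have e1 : max (v x - k) 0 = 0 := max_eq_right (by linarith)
      exact ⟨by simp [hφ, e1],
        by simp [hDφ, e1, indicator_of_notMem (show x ∉ {x | k < v x} from hxk)]⟩
  have hφA : ∫ x in A, |φ x| ^ s = ∫ x, |φ x| ^ s :=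
    setIntegral_eq_integral_of_forall_compl_eq_zero fun x hx => by
      rw [(hout x hx).1, abs_zero, Real.zero_rpow hs0.ne']
  have hDA : ∫ x in A, ‖Dφ x‖ ^ p = ∫ x, ‖Dφ x‖ ^ p :=
    setIntegral_eq_integral_of_forall_compl_eq_zero fun x hx => by
      rw [(hout x hx).2, norm_zero, Real.zero_rpow hp0.ne']
  have hφp : ∀ x ∈ A, 0 ≤ φ x ∧ φ x ≤ v x - k := fun x hx => by
    have : k < v x := hx.1
    have e : max (v x - k) 0 = v x - k := max_eq_left (by linarith)
    simp only [hφ, e]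
    exact ⟨mul_nonneg (hη0 x) (by linarith), mul_le_of_le_one_left (by linarith) (hη1 x)⟩
  -- the gradient of the truncation
  have iP : IntegrableOn (fun x => ‖g x‖ ^ p) A := integrable_norm_rpow_ofReal hp0
    (hmA (hg K hK hKΩ))
  have i1 : IntegrableOn (fun x => (v x - k) ^ p) A := by
    refine (integrable_norm_rpow_ofReal hp0
      ((hmA (hv K hK hKΩ)).sub (memLp_const (μ := volume.restrict A) k))).congr ?_
    filter_upwards [hAmem] with x hx
    have : k < v x := hx.1
    simp only [Pi.sub_apply, Real.norm_eq_abs]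
    rw [abs_of_nonneg (by linarith)]
  have hgrad : ∫ x, ‖Dφ x‖ ^ p ≤ 2 ^ p * ((∫ x in A, ‖g x‖ ^ p) +
      (c / (t - m)) ^ p * ∫ x in A, (v x - k) ^ p) := by
    rw [← hDA, ← integral_const_mul, ← integral_add iP (i1.const_mul _), ← integral_const_mul]
    refine integral_mono_ae (integrable_norm_rpow_ofReal hp0 (hm2.restrict A))
      ((iP.add (i1.const_mul _)).const_mul _) ?_
    filter_upwards [hAmem] with x hx
    have hkx : k < v x := hx.1
    have hl0 : 0 ≤ c / (t - m) := div_nonneg hc.le (by linarith)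
    have h1 : ‖Dφ x‖ ≤ ‖g x‖ + c / (t - m) * (v x - k) := by
      simp only [hDφ]
      refine (norm_add_le _ _).trans ?_
      rw [norm_smul, norm_smul, Real.norm_of_nonneg (hη0 x),
        Real.norm_of_nonneg (le_max_right _ _), max_eq_left (by linarith),
        indicator_of_mem (show x ∈ {x | k < v x} from hkx)]
      refine add_le_add (mul_le_of_le_one_left (norm_nonneg _) (hη1 x)) ?_
      rw [mul_comm]
      exact mul_le_mul_of_nonneg_right (hηg x) (by linarith)
    refine (Real.rpow_le_rpow (norm_nonneg _) h1 hp0.le).trans ?_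
    refine (two_rpow_mul_add (norm_nonneg _) (mul_nonneg hl0 (by linarith)) hp0.le).trans
      (le_of_eq ?_)
    rw [Real.mul_rpow hl0 (by linarith)]
  -- the size of the truncation
  have hφQ : ∫ x, |φ x| ^ s ≤ Q := by
    have i2 : IntegrableOn (fun x => |v x| ^ s) A := integrable_norm_rpow_ofReal hs0
      (hmA (hvs K hK hKΩ))
    have i3 : IntegrableOn (fun _ : EuclideanSpace ℝ (Fin N) => |k| ^ s) A := integrable_const _
    have h1 : ∫ x in A, |φ x| ^ s ≤ 2 ^ s * ((∫ x in A, |v x| ^ s) + |k| ^ s * volume.real A) := by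
      have e : |k| ^ s * volume.real A = ∫ x in A, |k| ^ s := by simp [mul_comm]
      rw [e, ← integral_add i2 i3, ← integral_const_mul]
      refine integral_mono_ae (integrable_norm_rpow_ofReal hs0 (hφs.restrict A))
        ((i2.add i3).const_mul _) ?_
      filter_upwards [hAmem] with x hx
      obtain ⟨h2, h3⟩ := hφp x hx
      have h4 : |φ x| ≤ |v x| + |k| := by
        rw [abs_of_nonneg h2]
        have := le_abs_self (v x); have := neg_abs_le k; linarith
      exact (Real.rpow_le_rpow (abs_nonneg _) h4 hs0.le).trans
        (two_rpow_mul_add (abs_nonneg _) (abs_nonneg _) hs0.le)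
    have h5 : ∫ x in A, |v x| ^ s ≤ M :=
      setIntegral_mono_set (integrable_norm_rpow_ofReal hs0 (hvs K hK hKΩ))
        (ae_of_all _ fun x => by positivity) (LE.le.eventuallyLE hAK)
    have h6 : |k| ^ s * volume.real A ≤ B ^ (s / p) := by
      calc |k| ^ s * volume.real A = (|k| ^ p * volume.real A ^ (1 - p / N)) ^ (s / p) := by
            rw [Real.mul_rpow (by positivity) (by positivity), ← Real.rpow_mul (abs_nonneg _),
              ← Real.rpow_mul hA0, mul_div_cancel₀ _ hp0.ne', ← hdiv, div_mul_div_cancel₀ hs0.ne',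
              div_self hp0.ne', Real.rpow_one]
        _ ≤ _ := by gcongr
    rw [← hφA]
    refine h1.trans ?_
    rw [hQ]
    gcongr
  have hφ0 : 0 ≤ ∫ x, |φ x| ^ s := integral_nonneg fun x => by positivity
  -- Since γ ≥ p, the exponent splits as (γ − p)/p* + p/p*. The first power is bounded by Q; Sobolev
  -- turns the second into the gradient energy, to the first power as absorption demands.
  have hφγ : (∫ x, |φ x| ^ s) ^ (γ / s) ≤
      Q ^ ((γ - p) / s) * ((S : ℝ) ^ p * ∫ x, ‖Dφ x‖ ^ p) := by
    have e : γ / s = (γ - p) / s + p / s := by ring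
    have h0 : 0 ≤ (γ - p) / s := div_nonneg (by linarith) hs0.le
    rw [e, Real.rpow_add_of_nonneg hφ0 h0 (by positivity)]
    gcongr
    exact hsob
  have hbA := hmA (hb K hK hKΩ)
  obtain ⟨hi, hhol⟩ := integral_abs_mul_rpow_le hσ0 hγ0 hs0 hε.le hsum hbA (hφs.restrict A)
  rw [measureReal_restrict_apply_univ, hφA] at hhol
  have hbB : (∫ x in A, |b x| ^ σ) ^ (1 / σ) ≤ Bσ := by
    rw [hBσ]
    refine Real.rpow_le_rpow (integral_nonneg fun x => by positivity) ?_ (by positivity)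
    exact setIntegral_mono_set (integrable_norm_rpow_ofReal hσ0 (hb K hK hKΩ))
      (ae_of_all _ fun x => by positivity) (LE.le.eventuallyLE hAK)
  have hAmA : superBall v x₀ k m ⊆ A := superBall_mono v x₀ k hmt.le
  have hAmm : NullMeasurableSet (superBall v x₀ k m) volume := by
    rw [← superBall_inter_ball v x₀ k hmt.le]
    exact hAm.inter measurableSet_ball.nullMeasurableSet
  have hstart : ∫ x in superBall v x₀ k m, b x * (v x - k) ^ γ ≤ ∫ x in A, |b x| * |φ x| ^ γ := by
    refine le_trans (le_of_eq (integral_congr_ae ?_)) (setIntegral_mono_set hi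
      (ae_of_all _ fun x => by positivity) (LE.le.eventuallyLE hAmA))
    filter_upwards [ae_restrict_mem₀ hAmm,
      ae_restrict_of_ae_restrict_of_subset (hAmA.trans (hAK.trans hKΩ)) hb0] with x hx hbx
    have hkx : k < v x := hx.1
    have e : φ x = v x - k := by
      simp only [hφ]
      rw [hηm x hx.2, one_mul, max_eq_left (by linarith)]
    rw [e, abs_of_nonneg hbx, abs_of_nonneg (by linarith)]
  calc _ ≤ _ := hstart
    _ ≤ _ := hhol
    _ ≤ Bσ * (Q ^ ((γ - p) / s) * ((S : ℝ) ^ p * (2 ^ p * ((∫ x in A, ‖g x‖ ^ p) +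
      (c / (t - m)) ^ p * ∫ x in A, (v x - k) ^ p)))) * volume.real A ^ ε := by
        refine mul_le_mul_of_nonneg_right (mul_le_mul hbB (hφγ.trans ?_) (by positivity) hBσ0)
          (by positivity)
        gcongr
    _ = _ := by ring

/-- Hölder gives the exponent 1 − q/s; because |A| ≤ 1 it can be lowered, which brings all
lower-order terms to one common power of |A|. -/
theorem setIntegral_norm_rpow_le_mul {N : ℕ} {Y : Type*} [NormedAddCommGroup Y] {s q e : ℝ}
    (hs : 0 < s) (hq : 0 ≤ q) (hqs : q ≤ s) (he : 0 ≤ e) (heq : e ≤ 1 - q / s)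
    {K A : Set (EuclideanSpace ℝ (Fin N))} (hK : IsCompact K) (hAK : A ⊆ K)
    (hA1 : volume.real A ≤ 1) {g : EuclideanSpace ℝ (Fin N) → Y}
    (hg : MemLp g (ENNReal.ofReal s) (volume.restrict K)) :
    IntegrableOn (fun x => ‖g x‖ ^ q) A ∧
      ∫ x in A, ‖g x‖ ^ q ≤ (∫ x in K, ‖g x‖ ^ s) ^ (q / s) * volume.real A ^ e := by
  have hAv : volume A < ⊤ := (measure_mono hAK).trans_lt hK.measure_lt_top
  have hfA : IsFiniteMeasure (volume.restrict A) := ⟨by simpa using hAv⟩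
  obtain ⟨h1, h2⟩ := integral_norm_rpow_le hs hq hqs
    (hg.mono_measure (Measure.restrict_mono hAK le_rfl))
  refine ⟨h1, h2.trans ?_⟩
  rw [measureReal_restrict_apply_univ]
  have h3 : volume.real A ^ (1 - q / s) ≤ volume.real A ^ e :=
    Real.rpow_le_rpow_of_exponent_ge' measureReal_nonneg hA1 he heq
  have h4 : 0 ≤ ∫ x in A, ‖g x‖ ^ s := integral_nonneg fun x => by positivity
  have h5 : ∫ x in A, ‖g x‖ ^ s ≤ ∫ x in K, ‖g x‖ ^ s :=
    setIntegral_mono_set (integrable_norm_rpow_ofReal hs hg)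
      (ae_of_all _ fun x => by positivity) (LE.le.eventuallyLE hAK)
  gcongr

/-- Estimate of the subcritical lower order terms. -/
theorem exists_lower_order_le {n N : ℕ} {Ω : Set (EuclideanSpace ℝ (Fin N))}
    {p ε q C : ℝ} (hp1 : 1 < p) (hpN : p < N) {γ L : Fin n → ℝ}
    {aα bα : Fin n → EuclideanSpace ℝ (Fin N) → ℝ} {a : EuclideanSpace ℝ (Fin N) → ℝ}
    {f : Fin n → EuclideanSpace ℝ (Fin N) → ℝ → EuclideanSpace ℝ (Fin N) → ℝ}
    {G : EuclideanSpace ℝ (Fin N) → EuclideanSpace ℝ (Fin n) → GradMat n N → ℝ}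
    (hF : HypF Ω p ε γ L aα bα f) (hG : HypG Ω p ε q C a G)
    {u : EuclideanSpace ℝ (Fin N) → EuclideanSpace ℝ (Fin n)}
    {Du : EuclideanSpace ℝ (Fin N) → GradMat n N} (hu : IsW1pLoc Ω p u Du) (α : Fin n)
    {K : Set (EuclideanSpace ℝ (Fin N))} (hK : IsCompact K) (hKΩ : K ⊆ Ω) {B ε' : ℝ}
    (hε'0 : 0 < ε') (hε' : ε' ≤ ε) (hε'q : ε' ≤ p / N - q / p) :
    ∃ D : ℝ, 0 < D ∧ ∀ (A : Set (EuclideanSpace ℝ (Fin N))) (k : ℝ), A ⊆ K →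
      volume.real A ≤ 1 → |k| ^ p * volume.real A ^ (1 - p / N) ≤ B →
      |k| ^ γ α * (∫ x in A, bα α x) + (∫ x in A, (aα α x + a x)) +
        (∫ x in A, (‖Du x‖ ^ q + ‖u x‖ ^ q)) + (1 + |k| ^ p) * volume.real A ≤
      D * (1 + |k| ^ p) * volume.real A ^ (1 - p / N + ε') := by
  have hp0 : 0 < p := by linarith
  have hN0 : (0 : ℝ) < N := hp0.trans hpN
  have hps := lt_sobolevConj hp0 hpN
  have hdiv := div_sobolevConj hp0 hpN
  have hpγ := hF.p_le_γ α
  have hexp := hF.exponent_pos α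
  have hεlt := hF.ε_lt
  have hbL := hF.b_memLp α K hK hKΩ
  set s := sobolevConj N p with hs
  have hs0 : 0 < s := hp0.trans hps
  have hq0 : 0 ≤ q := by linarith [hG.one_le_q]
  have hqp : q ≤ p := by
    have h1 := hG.q_lt
    rw [lt_div_iff₀ hN0] at h1
    nlinarith
  have hpN' : 0 ≤ 1 - p / N := by rw [sub_nonneg, div_le_one hN0]; exact hpN.le
  set σ := s / (s - γ α - ε * s) with hσ
  have hσ0 : 0 < σ := div_pos hs0 hexp
  have hσ1 : 1 ≤ σ := by
    rw [hσ, one_le_div hexp]; nlinarith [hF.ε_pos]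
  have hσe : 1 - 1 / σ = γ α / s + ε := by rw [hσ, one_div_div]; field_simp; ring
  have hden : 0 < p - ε * N := by
    rw [lt_div_iff₀ hN0] at hεlt; linarith
  have hκ : 1 ≤ N / (p - ε * N) := by
    rw [one_le_div hden]; nlinarith [hF.ε_pos]
  have hκe : 1 - 1 / (N / (p - ε * N)) = 1 - p / N + ε := by
    rw [one_div_div]; field_simp; ring
  set e := 1 - p / N + ε' with he
  have he0 : 0 ≤ e := by positivity
  set κ := N / (p - ε * N) with hκdef
  have hκ0 : 0 < κ := by linarith
  have haL := hF.a_memLp α K hK hKΩ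
  have haL' := hG.a_memLp K hK hKΩ
  -- B carries no sign here, and B₀ is raised to a real power.
  set B₀ := max B 0 with hB₀
  set I₁ := (∫ x in K, ‖bα α x‖ ^ σ) ^ (1 / σ)
  set I₂ := (∫ x in K, ‖aα α x‖ ^ κ) ^ (1 / κ)
  set I₃ := (∫ x in K, ‖a x‖ ^ κ) ^ (1 / κ)
  set I₄ := (∫ x in K, ‖Du x‖ ^ p) ^ (q / p)
  set I₅ := (∫ x in K, ‖u x‖ ^ p) ^ (q / p)
  have hI₁ : 0 ≤ I₁ := Real.rpow_nonneg (integral_nonneg fun x => by positivity) _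
  have hI₂ : 0 ≤ I₂ := Real.rpow_nonneg (integral_nonneg fun x => by positivity) _
  have hI₃ : 0 ≤ I₃ := Real.rpow_nonneg (integral_nonneg fun x => by positivity) _
  have hI₄ : 0 ≤ I₄ := Real.rpow_nonneg (integral_nonneg fun x => by positivity) _
  have hI₅ : 0 ≤ I₅ := Real.rpow_nonneg (integral_nonneg fun x => by positivity) _
  have hBγ : 0 ≤ B₀ ^ ((γ α - p) / p) := Real.rpow_nonneg (le_max_right _ _) _
  refine ⟨I₁ * B₀ ^ ((γ α - p) / p) + (I₂ + I₃) + (I₄ + I₅) + 1, by positivity,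
    fun A k hAK hA1 hgood => ?_⟩
  have hA0 : 0 ≤ volume.real A := measureReal_nonneg
  have hk0 : 0 ≤ |k| := abs_nonneg k
  set E := volume.real A ^ e with hE
  have hE0 : 0 ≤ E := by positivity
  set T := |k| ^ p with hT
  have hT0 : 0 ≤ T := by positivity
  -- the term with `b`
  have hb1 : |k| ^ γ α * (∫ x in A, bα α x) ≤ I₁ * B₀ ^ ((γ α - p) / p) * (T * E) := by
    obtain ⟨j1, j2⟩ := setIntegral_norm_rpow_le_mul hσ0 zero_le_one hσ1
      (by rw [hσe]; exact add_nonneg (div_nonneg (by linarith) hs0.le) hF.ε_pos.le) le_rfl hK hAK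
      hA1 hbL
    simp only [Real.rpow_one, hσe] at j1 j2
    have j3 : ∫ x in A, bα α x ≤ I₁ * volume.real A ^ (γ α / s + ε) :=
      (le_abs_self _).trans ((norm_integral_le_integral_norm (bα α)).trans j2)
    -- The excess |k|^{γ − p} |A|^{(γ − p)/p*} is the power (γ − p)/p of |k|^p |A|^{1 − p/N}, which
    -- is at most B.
    have j4 : |k| ^ γ α * volume.real A ^ (γ α / s + ε) =
        (T * volume.real A ^ (1 - p / N + ε)) *
          (T * volume.real A ^ (1 - p / N)) ^ ((γ α - p) / p) := by
      have h0 : 0 ≤ (γ α - p) / s := div_nonneg (by linarith) hs0.le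
      rw [Real.mul_rpow hT0 (by positivity), ← Real.rpow_mul hA0, hT, ← Real.rpow_mul hk0,
        mul_div_cancel₀ _ hp0.ne', mul_mul_mul_comm, ← Real.rpow_add_of_nonneg hk0 hp0.le
        (by linarith), ← hdiv]
      have e1 : p / s * ((γ α - p) / p) = (γ α - p) / s := by field_simp
      rw [e1, ← Real.rpow_add_of_nonneg hA0 (add_nonneg (by positivity) hF.ε_pos.le) h0]
      congr 2 <;> ring
    have j5 : volume.real A ^ (1 - p / N + ε) ≤ E :=
      Real.rpow_le_rpow_of_exponent_ge' hA0 hA1 he0 (by rw [he]; linarith)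
    have j6 : (T * volume.real A ^ (1 - p / N)) ^ ((γ α - p) / p) ≤ B₀ ^ ((γ α - p) / p) :=
      Real.rpow_le_rpow (by positivity) (hgood.trans (le_max_left _ _))
        (div_nonneg (by linarith) hp0.le)
    calc |k| ^ γ α * (∫ x in A, bα α x) ≤ |k| ^ γ α * (I₁ * volume.real A ^ (γ α / s + ε)) := by
          gcongr
      _ = I₁ * (|k| ^ γ α * volume.real A ^ (γ α / s + ε)) := by ring
      _ ≤ I₁ * ((T * E) * B₀ ^ ((γ α - p) / p)) := by
          rw [j4]
          gcongr
      _ = _ := by ring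
  have hone : 0 ≤ 1 / κ := by positivity
  obtain ⟨j1, j2⟩ := setIntegral_norm_rpow_le_mul hκ0 zero_le_one hκ he0
    (by rw [hκe, he]; linarith) hK hAK hA1 haL
  obtain ⟨j3, j4⟩ := setIntegral_norm_rpow_le_mul hκ0 zero_le_one hκ he0
    (by rw [hκe, he]; linarith) hK hAK hA1 haL'
  simp only [Real.rpow_one] at j1 j2 j3 j4
  have hi1 : IntegrableOn (aα α) A :=
    (integrable_norm_iff (haL.1.mono_measure (Measure.restrict_mono hAK le_rfl))).1 j1
  have hi2 : IntegrableOn a A :=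
    (integrable_norm_iff (haL'.1.mono_measure (Measure.restrict_mono hAK le_rfl))).1 j3
  have ha1 : ∫ x in A, (aα α x + a x) ≤ (I₂ + I₃) * E := by
    rw [integral_add hi1 hi2, add_mul]
    exact add_le_add ((le_abs_self _).trans ((norm_integral_le_integral_norm _).trans j2))
      ((le_abs_self _).trans ((norm_integral_le_integral_norm _).trans j4))
  -- This is the condition ε' ≤ p/N − q/p: it makes the q-growth of G fit the final power of |A|.
  have heq : e ≤ 1 - q / p := by rw [he]; linarith
  obtain ⟨j5, j6⟩ := setIntegral_norm_rpow_le_mul hp0 hq0 hqp he0 heq hK hAK hA1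
    (hu.memLp_grad K hK hKΩ)
  obtain ⟨j7, j8⟩ := setIntegral_norm_rpow_le_mul hp0 hq0 hqp he0 heq hK hAK hA1
    (hu.memLp K hK hKΩ)
  have hd1 : ∫ x in A, (‖Du x‖ ^ q + ‖u x‖ ^ q) ≤ (I₄ + I₅) * E := by
    rw [integral_add j5 j7, add_mul]
    exact add_le_add j6 j8
  have hv1 : volume.real A ≤ E := by
    have := Real.rpow_le_rpow_of_exponent_ge' hA0 hA1 he0
      (show e ≤ 1 by rw [he]; linarith)
    rwa [Real.rpow_one] at this
  have hT1 : 1 ≤ 1 + T := by linarith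
  have m1 : I₁ * B₀ ^ ((γ α - p) / p) * (T * E) ≤
      I₁ * B₀ ^ ((γ α - p) / p) * ((1 + T) * E) := by gcongr; linarith
  have m2 : (I₂ + I₃) * E ≤ (I₂ + I₃) * ((1 + T) * E) := by
    gcongr; exact le_mul_of_one_le_left hE0 hT1
  have m3 : (I₄ + I₅) * E ≤ (I₄ + I₅) * ((1 + T) * E) := by
    gcongr; exact le_mul_of_one_le_left hE0 hT1
  have m4 : (1 + T) * volume.real A ≤ (1 + T) * E := by gcongr
  calc _ ≤ I₁ * B₀ ^ ((γ α - p) / p) * ((1 + T) * E) + (I₂ + I₃) * ((1 + T) * E) +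
        (I₄ + I₅) * ((1 + T) * E) + (1 + T) * E := by linarith
    _ = _ := by ring

/-! ### Caccioppoli inequality on superlevel sets. -/

set_option maxHeartbeats 1000000 in
/-- The Caccioppoli inequality on superlevel sets, for one component. -/
theorem IsLocalMinimizer.exists_caccioppoli_superBall {n N : ℕ}
    {Ω : Set (EuclideanSpace ℝ (Fin N))} (hΩ : IsOpen Ω) {p ε q C : ℝ} (hp1 : 1 < p)
    (hpN : p < N) {γ L : Fin n → ℝ}
    {aα bα : Fin n → EuclideanSpace ℝ (Fin N) → ℝ} {a : EuclideanSpace ℝ (Fin N) → ℝ}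
    {f : Fin n → EuclideanSpace ℝ (Fin N) → ℝ → EuclideanSpace ℝ (Fin N) → ℝ}
    {G : EuclideanSpace ℝ (Fin N) → EuclideanSpace ℝ (Fin n) → GradMat n N → ℝ}
    (hF : HypF Ω p ε γ L aα bα f) (hG : HypG Ω p ε q C a G)
    {u : EuclideanSpace ℝ (Fin N) → EuclideanSpace ℝ (Fin n)}
    {Du : EuclideanSpace ℝ (Fin N) → GradMat n N} (hu : IsLocalMinimizer Ω p f G u Du)
    {ε' : ℝ} (hε'0 : 0 < ε') (hε' : ε' ≤ ε) (hε'q : ε' ≤ p / N - q / p) (α : Fin n)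
    {K : Set (EuclideanSpace ℝ (Fin N))} (hK : IsCompact K) (hKΩ : K ⊆ Ω) :
    ∃ C₁ C₂ R₀ : ℝ, 0 < C₁ ∧ 0 < C₂ ∧ 0 < R₀ ∧ ∀ x₀ ∈ K, Metric.closedBall x₀ R₀ ⊆ Ω ∧
      ∀ ρ R k : ℝ, 0 < ρ → ρ < R → R < R₀ →
        (∫ x in superBall (fun y => u y α) x₀ k ρ, ‖Du x α‖ ^ p) ≤
          C₁ / (R - ρ) ^ p * (∫ x in superBall (fun y => u y α) x₀ k R, (u x α - k) ^ p) +
            C₂ * (1 + |k| ^ p * R ^ (-(ε' * N))) *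
              volume.real (superBall (fun y => u y α) x₀ k R) ^ (1 - p / N + ε') := by
  have hp0 : 0 < p := by linarith
  have hN0 : (0 : ℝ) < N := hp0.trans hpN
  have hW := hu.isW1pLoc
  have hvL := hW.memLp.apply α
  have hgL := hW.memLp_grad.row α
  have hvs := (hW.weakGradient α).memLpLoc_sobolevConj hΩ hp1.le hpN hvL hgL
  set v : EuclideanSpace ℝ (Fin N) → ℝ := fun y => u y α with hv
  set s := sobolevConj N p with hs
  -- All constants are integrals over this compact neighbourhood of K, hence independent of the
  -- centre.
  obtain ⟨K', hK', hKK', hK'Ω⟩ := exists_compact_between hK hΩ hKΩ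
  obtain ⟨r₁, hr₁, hr₁K⟩ := hK.exists_cthickening_subset_open isOpen_interior hKK'
  have hballK : ∀ x₀ ∈ K, Metric.closedBall x₀ r₁ ⊆ K' := fun x₀ hx₀ =>
    ((Metric.closedBall_subset_cthickening hx₀ r₁).trans hr₁K).trans interior_subset
  set M := ∫ x in K', |v x| ^ s with hM
  have hM0 : 0 ≤ M := integral_nonneg fun x => by positivity
  -- The threshold beyond which `le_integral_superBall_of_lt` applies.
  set B := 2 ^ (p + 1) * M ^ (p / s) + 1 with hB
  have hB0 : 0 < B := by positivity
  set E := ∫ x in K', ‖Du x α‖ ^ p with hE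
  have hE0 : 0 ≤ E := integral_nonneg fun x => by positivity
  have hiE : IntegrableOn (fun x => ‖Du x α‖ ^ p) K' :=
    integrable_norm_rpow_ofReal hp0 (hgL K' hK' hK'Ω)
  obtain ⟨Λ, c₁, c₀, hΛ, hc₁, hc₀, hener⟩ := hu.exists_energy_inequality hΩ hp1 hpN hF hG α
  obtain ⟨κ, c₂, hκ, hc₂, hsob⟩ := exists_integral_mul_rpow_superBall_le hΩ hp1 hpN hF.ε_pos
    (hF.p_le_γ α) (hF.exponent_pos α) (hW.weakGradient α) hvL hgL (hF.b_nonneg α)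
    (hF.b_memLp α) hK' hK'Ω hB0.le
  obtain ⟨D, hD, hlow⟩ := exists_lower_order_le hp1 hpN hF hG hW α hK' hK'Ω (B := B)
    hε'0 hε' hε'q
  -- Hole filling contributes Λ to the numerator, and the absorbed critical term the 1/2.
  set θ := (Λ + 1 / 2) / (Λ + 1) with hθ
  have hθ0 : 0 ≤ θ := by positivity
  have hθ1 : θ < 1 := by rw [hθ, div_lt_one (by positivity)]; linarith
  obtain ⟨c₃, hc₃, hiter⟩ := exists_iteration_bound hp0 hθ0 hθ1
  have hNe : Nonempty (Fin N) := ⟨⟨0, by exact_mod_cast hN0⟩⟩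
  set V₁ := volume.real (Metric.ball (0 : EuclideanSpace ℝ (Fin N)) 1) with hV₁
  have hV₁0 : 0 < V₁ := ENNReal.toReal_pos (Metric.measure_ball_pos _ _ one_pos).ne'
    measure_ball_lt_top.ne
  -- |A| ≤ τ forces c₁ κ |A|^ε ≤ 1/2, and |A| ≤ 1 as needed for comparing exponents. The + 1 allows
  -- for κ = 0.
  set τ := min 1 ((1 / (2 * (c₁ * κ) + 1)) ^ (1 / ε)) with hτ
  have hcκ : 0 ≤ c₁ * κ := by positivity
  have hτ0 : 0 < τ := lt_min one_pos (Real.rpow_pos_of_pos (by positivity) _)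
  -- For R ≤ 1 and N ≥ 1 the ball has volume R^N V₁ ≤ R V₁, hence at most τ.
  set R₀ := min (min r₁ 1) (τ / V₁) with hR₀
  have hR₀0 : 0 < R₀ := lt_min (lt_min hr₁ one_pos) (by positivity)
  set A₀ := (c₁ * (2 * c₀) ^ p + 1 / 2 * (2 * c₂) ^ p) / (1 + Λ) with hA₀
  have hA₀0 : 0 < A₀ := by positivity
  set V₂ := (V₁ / 2) ^ (p / N) with hV₂
  have hV₂0 : 0 < V₂ := by positivity
  refine ⟨c₃ * A₀ + E * 2 ^ (p + 1) / V₂, c₃ * (c₁ * D / (1 + Λ)), R₀, by positivity,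
    by positivity, hR₀0, fun x₀ hx₀ => ?_⟩
  have hR₀r : R₀ ≤ r₁ := (min_le_left _ _).trans (min_le_left _ _)
  have hR₀1 : R₀ ≤ 1 := (min_le_left _ _).trans (min_le_right _ _)
  have hballK' : Metric.closedBall x₀ R₀ ⊆ K' :=
    (Metric.closedBall_subset_closedBall hR₀r).trans (hballK x₀ hx₀)
  refine ⟨hballK'.trans hK'Ω, fun ρ R k hρ hρR hRR₀ => ?_⟩
  have hR : 0 < R := hρ.trans hρR
  have hbR : Metric.closedBall x₀ R ⊆ K' :=
    (Metric.closedBall_subset_closedBall hRR₀.le).trans hballK'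
  set A := superBall v x₀ k R with hA
  have hAb : A ⊆ Metric.ball x₀ R := inter_subset_right
  have hAK : A ⊆ K' := hAb.trans (Metric.ball_subset_closedBall.trans hbR)
  have hsubK : ∀ r ≤ R, superBall v x₀ k r ⊆ A := fun r hr => superBall_mono v x₀ k hr
  have hA0 : 0 ≤ volume.real A := measureReal_nonneg
  have hAτ : volume.real A ≤ τ := by
    calc volume.real A ≤ volume.real (Metric.ball x₀ R) :=
          measureReal_mono hAb measure_ball_lt_top.ne
      _ = R ^ N * V₁ := by
          rw [Measure.real, Measure.addHaar_ball _ _ hR.le, ENNReal.toReal_mul,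
            ENNReal.toReal_ofReal (by positivity), finrank_euclideanSpace_fin, hV₁, Measure.real]
      _ ≤ R * V₁ := by
          gcongr
          exact pow_le_of_le_one hR.le (hRR₀.le.trans hR₀1)
            (by have : (N : ℝ) ≠ 0 := hN0.ne'
                exact_mod_cast this)
      _ ≤ (τ / V₁) * V₁ := by
          gcongr
          exact hRR₀.le.trans (min_le_right _ _)
      _ = τ := by field_simp
  have hA1 : volume.real A ≤ 1 := hAτ.trans (min_le_left _ _)
  have hAm : NullMeasurableSet A volume := nullMeasurableSet_superBall
    ((hvs K' hK' hK'Ω).1.aemeasurable.mono_measure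
      (Measure.restrict_mono (Metric.ball_subset_closedBall.trans hbR) le_rfl))
  have hAv : volume A < ⊤ := (measure_mono hAK).trans_lt hK'.measure_lt_top
  have hfA : IsFiniteMeasure (volume.restrict A) := ⟨by simpa using hAv⟩
  have hΨi : IntegrableOn (fun x => (u x α - k) ^ p) A := by
    refine (integrable_norm_rpow_ofReal hp0
      (((hvL K' hK' hK'Ω).mono_measure (Measure.restrict_mono hAK le_rfl)).sub
        (memLp_const (μ := volume.restrict A) k))).congr ?_
    filter_upwards [ae_restrict_mem₀ hAm] with x hx
    have : k < v x := hx.1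
    simp only [Pi.sub_apply, Real.norm_eq_abs]
    rw [abs_of_nonneg (by linarith)]
  have hΨnn : 0 ≤ᵐ[volume.restrict A] fun x => (u x α - k) ^ p := by
    filter_upwards [ae_restrict_mem₀ hAm] with x hx
    have : k < u x α := hx.1
    exact Real.rpow_nonneg (by linarith) _
  set Ψ := ∫ x in A, (u x α - k) ^ p with hΨ
  have hΨ0 : 0 ≤ Ψ := integral_nonneg_of_ae hΨnn
  set Φ : ℝ → ℝ := fun r => ∫ x in superBall v x₀ k r, ‖Du x α‖ ^ p with hΦ
  have hΦE : ∀ r ≤ R, Φ r ≤ E := fun r hr => setIntegral_mono_set hiE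
    (ae_of_all _ fun x => by positivity) (LE.le.eventuallyLE ((hsubK r hr).trans hAK))
  have hΨr : ∀ r ≤ R, ∫ x in superBall v x₀ k r, (u x α - k) ^ p ≤ Ψ := fun r hr =>
    setIntegral_mono_set hΨi hΨnn (LE.le.eventuallyLE (hsubK r hr))
  have hRρ : 0 < R - ρ := by linarith
  have hRρp : 0 < (R - ρ) ^ p := Real.rpow_pos_of_pos hRρ _
  -- As R ≤ 1, the bound with 1 + |k|^p obtained for moderate levels is already stronger than the
  -- required one.
  have hRε : 1 ≤ R ^ (-(ε' * N)) := Real.one_le_rpow_of_pos_of_le_one_of_nonpos hR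
    (hRR₀.le.trans hR₀1) (by have : 0 < ε' * N := by positivity
                             linarith)
  set P := volume.real A ^ (1 - p / N + ε') with hP
  have hP0 : 0 ≤ P := by positivity
  have hT0 : 0 ≤ |k| ^ p := by positivity
  change Φ ρ ≤ _
  -- For an excessive level R^p is bounded by a multiple of Ψ, so even the whole energy E is at most
  -- a multiple of Ψ/(R − ρ)^p. Otherwise the iteration is carried out.
  rcases lt_or_ge B (|k| ^ p * volume.real A ^ (1 - p / N)) with hbad | hgood
  · have h1 : V₂ * R ^ p ≤ 2 ^ (p + 1) * Ψ := le_integral_superBall_of_lt hp1 hpN hK'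
      (hvs K' hK' hK'Ω) hR (Metric.ball_subset_closedBall.trans hbR) hbad
    have h2 : (R - ρ) ^ p ≤ R ^ p := Real.rpow_le_rpow hRρ.le (by linarith) hp0.le
    have h3 : E ≤ E * 2 ^ (p + 1) / V₂ / (R - ρ) ^ p * Ψ := by
      have h4 : V₂ * (R - ρ) ^ p ≤ 2 ^ (p + 1) * Ψ := le_trans (by gcongr) h1
      calc E = E * (V₂ * (R - ρ) ^ p) / (V₂ * (R - ρ) ^ p) := by field_simp
        _ ≤ E * (2 ^ (p + 1) * Ψ) / (V₂ * (R - ρ) ^ p) := by gcongr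
        _ = _ := by field_simp
    have h5 : 0 ≤ c₃ * A₀ / (R - ρ) ^ p * Ψ := by positivity
    have h6 : 0 ≤ c₃ * (c₁ * D / (1 + Λ)) * (1 + |k| ^ p * R ^ (-(ε' * N))) * P := by positivity
    have h7 : (c₃ * A₀ + E * 2 ^ (p + 1) / V₂) / (R - ρ) ^ p * Ψ =
        c₃ * A₀ / (R - ρ) ^ p * Ψ + E * 2 ^ (p + 1) / V₂ / (R - ρ) ^ p * Ψ := by ring
    rw [h7]
    linarith [hΦE ρ hρR.le]
  · have hsmall : c₁ * κ * volume.real A ^ ε ≤ 1 / 2 := by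
      have h1 : volume.real A ^ ε ≤ 1 / (2 * (c₁ * κ) + 1) := by
        calc volume.real A ^ ε ≤ ((1 / (2 * (c₁ * κ) + 1)) ^ (1 / ε)) ^ ε :=
              Real.rpow_le_rpow hA0 (hAτ.trans (min_le_right _ _)) hF.ε_pos.le
          _ = _ := by
              rw [← Real.rpow_mul (by positivity), one_div_mul_cancel hF.ε_pos.ne', Real.rpow_one]
      calc c₁ * κ * volume.real A ^ ε ≤ c₁ * κ * (1 / (2 * (c₁ * κ) + 1)) := by gcongr
        _ ≤ 1 / 2 := by
            rw [mul_one_div, div_le_div_iff₀ (by positivity) (by norm_num)]; linarith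
    have hgoodr : ∀ r ≤ R, |k| ^ p * volume.real (superBall v x₀ k r) ^ (1 - p / N) ≤ B :=
      fun r hr => by
        refine le_trans ?_ hgood
        have hpN' : 0 ≤ 1 - p / N := by rw [sub_nonneg, div_le_one hN0]; exact hpN.le
        have := measureReal_mono (hsubK r hr) hAv.ne
        gcongr
    have hstep : ∀ s t, ρ ≤ s → s < t → t < R → Φ s ≤ θ * Φ t +
        (A₀ * Ψ / (t - s) ^ p + c₁ * D / (1 + Λ) * ((1 + |k| ^ p) * P)) := by
      intro s t hρs hst htR
      have hs0 : 0 < s := hρ.trans_le hρs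
      -- The midpoint leaves room for two cutoffs: the energy inequality between s and m, the
      -- Sobolev estimate between m and t. Halving the gap doubles c₀ and c₂.
      set m := (s + t) / 2 with hm
      have hsm : s < m := by rw [hm]; linarith
      have hmt : m < t := by rw [hm]; linarith
      have hmR : m ≤ R := by linarith
      have e1 : m - s = (t - s) / 2 := by rw [hm]; ring
      have e2 : t - m = (t - s) / 2 := by rw [hm]; ring
      have hts : 0 < t - s := by linarith
      have htsp : 0 < (t - s) ^ p := Real.rpow_pos_of_pos hts _
      have hq1 : ∀ c : ℝ, 0 < c → (c / ((t - s) / 2)) ^ p = (2 * c) ^ p / (t - s) ^ p := by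
        intro c hc
        rw [← Real.div_rpow (by positivity) hts.le]
        congr 1
        field_simp
      have h1 := hener x₀ k s m hs0 hsm
        (((Metric.closedBall_subset_closedBall hmR).trans hbR).trans hK'Ω)
      have h2 := hsob x₀ k m t (hs0.trans hsm) hmt
        ((Metric.closedBall_subset_closedBall htR.le).trans hbR) (hgoodr t htR.le)
      have h3 := hlow (superBall v x₀ k m) k ((hsubK m hmR).trans hAK)
        ((measureReal_mono (hsubK m hmR) hAv.ne).trans hA1) (hgoodr m hmR)
      rw [e1, hq1 c₀ hc₀] at h1
      rw [e2, hq1 c₂ hc₂] at h2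
      change Φ s ≤ Λ * (Φ m - Φ s) + _ at h1
      have hΦmt : Φ m ≤ Φ t := setIntegral_mono_set
        (hiE.mono_set ((hsubK t htR.le).trans hAK)) (ae_of_all _ fun x => by positivity)
        (LE.le.eventuallyLE (superBall_mono v x₀ k hmt.le))
      have hΦt0 : 0 ≤ Φ t := integral_nonneg fun x => by positivity
      have h4 : volume.real (superBall v x₀ k m) ^ (1 - p / N + ε') ≤ P := by
        have hpN' : 0 ≤ 1 - p / N := by rw [sub_nonneg, div_le_one hN0]; exact hpN.le
        exact Real.rpow_le_rpow measureReal_nonneg (measureReal_mono (hsubK m hmR) hAv.ne)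
          (by linarith)
      have h5 : D * (1 + |k| ^ p) * volume.real (superBall v x₀ k m) ^ (1 - p / N + ε') ≤
          D * (1 + |k| ^ p) * P := by gcongr
      have h6 : κ * volume.real (superBall v x₀ k t) ^ ε *
          (Φ t + (2 * c₂) ^ p / (t - s) ^ p * ∫ x in superBall v x₀ k t, (v x - k) ^ p) ≤
          κ * volume.real A ^ ε * (Φ t + (2 * c₂) ^ p / (t - s) ^ p * Ψ) := by
        have a1 : volume.real (superBall v x₀ k t) ^ ε ≤ volume.real A ^ ε :=
          Real.rpow_le_rpow measureReal_nonneg (measureReal_mono (hsubK t htR.le) hAv.ne)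
            hF.ε_pos.le
        have a2 : ∫ x in superBall v x₀ k t, (v x - k) ^ p ≤ Ψ := hΨr t htR.le
        have a3 : 0 ≤ ∫ x in superBall v x₀ k t, (v x - k) ^ p :=
          integral_nonneg_of_ae (ae_mono (Measure.restrict_mono (hsubK t htR.le) le_rfl) hΨnn)
        have a4 : 0 ≤ (2 * c₂) ^ p / (t - s) ^ p := by positivity
        have a5 := mul_nonneg a4 a3
        gcongr
      have h7 : c₁ * (κ * volume.real A ^ ε * (Φ t + (2 * c₂) ^ p / (t - s) ^ p * Ψ)) ≤
          1 / 2 * (Φ t + (2 * c₂) ^ p / (t - s) ^ p * Ψ) := by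
        rw [← mul_assoc, ← mul_assoc]
        gcongr
      have h8 : (2 * c₀) ^ p / (t - s) ^ p * (∫ x in superBall v x₀ k m, (u x α - k) ^ p) ≤
          (2 * c₀) ^ p / (t - s) ^ p * Ψ := by
        gcongr
        exact hΨr m hmR
      have h9 : Λ * (Φ m - Φ s) ≤ Λ * (Φ t - Φ s) := by gcongr
      have h10 : Φ s ≤ Λ * (Φ t - Φ s) + c₁ * ((2 * c₀) ^ p / (t - s) ^ p * Ψ) +
          1 / 2 * (Φ t + (2 * c₂) ^ p / (t - s) ^ p * Ψ) + c₁ * (D * (1 + |k| ^ p) * P) := by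
        have h11 := h2.trans h6
        have h12 := mul_le_mul_of_nonneg_left h11 hc₁.le
        have h13 := mul_le_mul_of_nonneg_left (h3.trans h5) hc₁.le
        have h14 := mul_le_mul_of_nonneg_left h8 hc₁.le
        simp only [mul_add] at h1 h12 h13 h14 h7 ⊢
        linarith
      -- The hole is filled: Λ Φ(s) moves to the left.
      have h15 : (1 + Λ) * Φ s ≤ (Λ + 1 / 2) * Φ t +
          (c₁ * (2 * c₀) ^ p + 1 / 2 * (2 * c₂) ^ p) * Ψ / (t - s) ^ p +
          c₁ * D * ((1 + |k| ^ p) * P) := by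
        have e3 : (c₁ * (2 * c₀) ^ p + 1 / 2 * (2 * c₂) ^ p) * Ψ / (t - s) ^ p =
          c₁ * ((2 * c₀) ^ p / (t - s) ^ p * Ψ) + 1 / 2 * ((2 * c₂) ^ p / (t - s) ^ p * Ψ) := by
          ring
        rw [e3]
        linarith
      have e4 : θ * Φ t + (A₀ * Ψ / (t - s) ^ p + c₁ * D / (1 + Λ) * ((1 + |k| ^ p) * P)) =
        ((Λ + 1 / 2) * Φ t + (c₁ * (2 * c₀) ^ p + 1 / 2 * (2 * c₂) ^ p) * Ψ / (t - s) ^ p +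
          c₁ * D * ((1 + |k| ^ p) * P)) / (1 + Λ) := by
        rw [hθ, hA₀, add_comm Λ 1]; field_simp; ring
      rw [e4, le_div_iff₀ (by positivity)]
      linarith
    have hfin := hiter Φ ρ R (A₀ * Ψ) (c₁ * D / (1 + Λ) * ((1 + |k| ^ p) * P)) E (by positivity)
      (by positivity) hρR (fun r _ hr => hΦE r hr.le) hstep
    refine hfin.trans ?_
    have h1 : (1 + |k| ^ p) ≤ 1 + |k| ^ p * R ^ (-(ε' * N)) := by
      have := le_mul_of_one_le_right hT0 hRε
      linarith
    have h2 : 0 ≤ E * 2 ^ (p + 1) / V₂ / (R - ρ) ^ p * Ψ := by positivity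
    have h3 : c₃ * (c₁ * D / (1 + Λ)) * (1 + |k| ^ p) * P ≤
        c₃ * (c₁ * D / (1 + Λ)) * (1 + |k| ^ p * R ^ (-(ε' * N))) * P := by gcongr
    have h4 : c₃ * (A₀ * Ψ / (R - ρ) ^ p + c₁ * D / (1 + Λ) * ((1 + |k| ^ p) * P)) =
        c₃ * A₀ / (R - ρ) ^ p * Ψ + c₃ * (c₁ * D / (1 + Λ)) * (1 + |k| ^ p) * P := by ring
    have h5 : (c₃ * A₀ + E * 2 ^ (p + 1) / V₂) / (R - ρ) ^ p * Ψ =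
        c₃ * A₀ / (R - ρ) ^ p * Ψ + E * 2 ^ (p + 1) / V₂ / (R - ρ) ^ p * Ψ := by ring
    rw [h4, h5]
    linarith

/-! ### Reflection and sublevel sets. -/

theorem IsCaratheodory.comp_neg {N : ℕ} {Y : Type*} [TopologicalSpace Y] [AddGroup Y]
    [IsTopologicalAddGroup Y] {Ω : Set (EuclideanSpace ℝ (Fin N))}
    {F : EuclideanSpace ℝ (Fin N) → Y → ℝ} (h : IsCaratheodory Ω F) :
    IsCaratheodory Ω fun x y => F x (-y) where
  measurable := fun y => h.measurable (-y)
  continuous := h.continuous.mono fun _ hx => hx.comp continuous_neg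

theorem HypF.comp_neg {n N : ℕ} {Ω : Set (EuclideanSpace ℝ (Fin N))} {p ε : ℝ}
    {γ L : Fin n → ℝ} {a b : Fin n → EuclideanSpace ℝ (Fin N) → ℝ}
    {f : Fin n → EuclideanSpace ℝ (Fin N) → ℝ → EuclideanSpace ℝ (Fin N) → ℝ}
    (h : HypF Ω p ε γ L a b f) :
    HypF Ω p ε γ L a b fun α x s ζ => f α x (-s) (-ζ) :=
  { h with
    caratheodory := fun α => (h.caratheodory α).comp_neg
    growth := fun α => (h.growth α).mono fun x hx s ζ => by
      simpa only [norm_neg, abs_neg] using hx (-s) (-ζ) }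

theorem HypG.comp_neg {n N : ℕ} {Ω : Set (EuclideanSpace ℝ (Fin N))} {p ε q C : ℝ}
    {a : EuclideanSpace ℝ (Fin N) → ℝ}
    {G : EuclideanSpace ℝ (Fin N) → EuclideanSpace ℝ (Fin n) → GradMat n N → ℝ}
    (h : HypG Ω p ε q C a G) : HypG Ω p ε q C a fun x s ξ => G x (-s) (-ξ) :=
  { h with
    caratheodory := h.caratheodory.comp_neg
    growth := h.growth.mono fun x hx s ξ => by
      simpa only [norm_neg] using hx (-s) (-ξ) }

theorem energyDensity_comp_neg {n N : ℕ}
    (f : Fin n → EuclideanSpace ℝ (Fin N) → ℝ → EuclideanSpace ℝ (Fin N) → ℝ)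
    (G : EuclideanSpace ℝ (Fin N) → EuclideanSpace ℝ (Fin n) → GradMat n N → ℝ)
    (u : EuclideanSpace ℝ (Fin N) → EuclideanSpace ℝ (Fin n))
    (Du : EuclideanSpace ℝ (Fin N) → GradMat n N) :
    energyDensity (fun α x s ζ => f α x (-s) (-ζ)) (fun x s ξ => G x (-s) (-ξ)) u Du =
      energyDensity f G (-u) (-Du) :=
  rfl

theorem IsLocalMinimizer.neg {n N : ℕ} {Ω : Set (EuclideanSpace ℝ (Fin N))} {p : ℝ}
    {f : Fin n → EuclideanSpace ℝ (Fin N) → ℝ → EuclideanSpace ℝ (Fin N) → ℝ}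
    {G : EuclideanSpace ℝ (Fin N) → EuclideanSpace ℝ (Fin n) → GradMat n N → ℝ}
    {u : EuclideanSpace ℝ (Fin N) → EuclideanSpace ℝ (Fin n)}
    {Du : EuclideanSpace ℝ (Fin N) → GradMat n N} (h : IsLocalMinimizer Ω p f G u Du) :
    IsLocalMinimizer Ω p (fun α x s ζ => f α x (-s) (-ζ)) (fun x s ξ => G x (-s) (-ξ))
      (-u) (-Du) where
  isW1pLoc := h.isW1pLoc.neg
  finite_energy := fun S hS hSΩ => by
    rw [energyDensity_comp_neg, neg_neg, neg_neg]
    exact h.finite_energy S hS hSΩ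
  le := fun S φ Dφ hS hSΩ hφ hφS hint => by
    have e : energyDensity (fun α x s ζ => f α x (-s) (-ζ)) (fun x s ξ => G x (-s) (-ξ))
        (-u + φ) (-Du + Dφ) = energyDensity f G (u + -φ) (Du + -Dφ) := by
      rw [energyDensity_comp_neg, neg_add, neg_add, neg_neg, neg_neg]
    rw [e] at hint ⊢
    rw [energyDensity_comp_neg, neg_neg, neg_neg]
    exact h.le S (-φ) (-Dφ) hS hSΩ hφ.neg
      ((closure_mono (Function.support_neg φ).subset).trans hφS) hint

theorem superBall_neg {N : ℕ} (v : EuclideanSpace ℝ (Fin N) → ℝ)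
    (x₀ : EuclideanSpace ℝ (Fin N)) (k r : ℝ) :
    superBall (fun x => -v x) x₀ (-k) r = subBall v x₀ k r := by
  simp only [superBall, subBall, neg_lt_neg_iff]

/-- −u minimizes the reflected functional, whose integrands obey the same bounds because these
involve only norms, and sublevels of u^α at k are superlevels of −u^α at −k. The superlevel estimate
is formulated for a general G of growth q so that it covers the reflected integrand directly. -/
theorem IsLocalMinimizer.exists_caccioppoli_subBall {n N : ℕ}
    {Ω : Set (EuclideanSpace ℝ (Fin N))} (hΩ : IsOpen Ω) {p ε q C : ℝ} (hp1 : 1 < p)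
    (hpN : p < N) {γ L : Fin n → ℝ}
    {aα bα : Fin n → EuclideanSpace ℝ (Fin N) → ℝ} {a : EuclideanSpace ℝ (Fin N) → ℝ}
    {f : Fin n → EuclideanSpace ℝ (Fin N) → ℝ → EuclideanSpace ℝ (Fin N) → ℝ}
    {G : EuclideanSpace ℝ (Fin N) → EuclideanSpace ℝ (Fin n) → GradMat n N → ℝ}
    (hF : HypF Ω p ε γ L aα bα f) (hG : HypG Ω p ε q C a G)
    {u : EuclideanSpace ℝ (Fin N) → EuclideanSpace ℝ (Fin n)}
    {Du : EuclideanSpace ℝ (Fin N) → GradMat n N} (hu : IsLocalMinimizer Ω p f G u Du)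
    {ε' : ℝ} (hε'0 : 0 < ε') (hε' : ε' ≤ ε) (hε'q : ε' ≤ p / N - q / p) (α : Fin n)
    {K : Set (EuclideanSpace ℝ (Fin N))} (hK : IsCompact K) (hKΩ : K ⊆ Ω) :
    ∃ C₁ C₂ R₀ : ℝ, 0 < C₁ ∧ 0 < C₂ ∧ 0 < R₀ ∧ ∀ x₀ ∈ K, Metric.closedBall x₀ R₀ ⊆ Ω ∧
      ∀ ρ R k : ℝ, 0 < ρ → ρ < R → R < R₀ →
        (∫ x in subBall (fun y => u y α) x₀ k ρ, ‖Du x α‖ ^ p) ≤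
          C₁ / (R - ρ) ^ p * (∫ x in subBall (fun y => u y α) x₀ k R, (k - u x α) ^ p) +
            C₂ * (1 + |k| ^ p * R ^ (-(ε' * N))) *
              volume.real (subBall (fun y => u y α) x₀ k R) ^ (1 - p / N + ε') := by
  obtain ⟨C₁, C₂, R₀, hC₁, hC₂, hR₀, h⟩ := hu.neg.exists_caccioppoli_superBall hΩ hp1 hpN
    hF.comp_neg hG.comp_neg hε'0 hε' hε'q α hK hKΩ
  refine ⟨C₁, C₂, R₀, hC₁, hC₂, hR₀, fun x₀ hx₀ => ⟨(h x₀ hx₀).1, fun ρ R k hρ hρR hR => ?_⟩⟩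
  have := (h x₀ hx₀).2 ρ R (-k) hρ hρR hR
  simp only [Pi.neg_apply, PiLp.neg_apply, superBall_neg, norm_neg, abs_neg, sub_neg_eq_add,
    neg_add_eq_sub] at this
  exact this

/-! ### Common constants for all components. -/

/-- The base k − v is positive only on the set itself, so the sign rests on a.e. membership, hence
on null-measurability. The sign is needed to enlarge the constant in front of this integral. -/
theorem integral_subBall_nonneg {N : ℕ} {v : EuclideanSpace ℝ (Fin N) → ℝ}
    {x₀ : EuclideanSpace ℝ (Fin N)} {k r p : ℝ}
    (hv : AEMeasurable v (volume.restrict (Metric.ball x₀ r))) :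
    0 ≤ ∫ x in subBall v x₀ k r, (k - v x) ^ p := by
  rw [← superBall_neg]
  refine integral_nonneg_of_ae ?_
  filter_upwards [ae_restrict_mem₀ (nullMeasurableSet_superBall hv.neg)] with x hx
  have : -k < -v x := hx.1
  exact Real.rpow_nonneg (by linarith) _

theorem integral_superBall_nonneg {N : ℕ} {v : EuclideanSpace ℝ (Fin N) → ℝ}
    {x₀ : EuclideanSpace ℝ (Fin N)} {k r p : ℝ}
    (hv : AEMeasurable v (volume.restrict (Metric.ball x₀ r))) :
    0 ≤ ∫ x in superBall v x₀ k r, (v x - k) ^ p := by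
  refine integral_nonneg_of_ae ?_
  filter_upwards [ae_restrict_mem₀ (nullMeasurableSet_superBall hv)] with x hx
  have : k < v x := hx.1
  exact Real.rpow_nonneg (by linarith) _

theorem theorem5 {n N : ℕ} (Ω : Set (EuclideanSpace ℝ (Fin N))) (hΩ : IsOpen Ω)
    (p ε q r δ β σ C k₄ : ℝ) (τ : ℝ≥0∞) (hp1 : 1 < p) (hpN : p < N)
    (γ L : Fin n → ℝ) (aα bα : Fin n → EuclideanSpace ℝ (Fin N) → ℝ)
    (a a' c : EuclideanSpace ℝ (Fin N) → ℝ)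
    (f : Fin n → EuclideanSpace ℝ (Fin N) → ℝ → EuclideanSpace ℝ (Fin N) → ℝ)
    (Gα : Fin n → EuclideanSpace ℝ (Fin N) → EuclideanSpace ℝ (Fin n) →
      EuclideanSpace ℝ (ColSel n N) → ℝ)
    (hF : HypF Ω p ε γ L aα bα f)
    (hG : HypG Ω p ε q C a (polyDensity Gα))
    (hPoly : HypPoly Ω p r k₄ τ a' Gα)
    (hHolder : HypHolder Ω p r δ β σ c Gα ∨ HypHolderBis Ω p r δ β c Gα)
    (u : EuclideanSpace ℝ (Fin N) → EuclideanSpace ℝ (Fin n))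
    (Du : EuclideanSpace ℝ (Fin N) → GradMat n N)
    (hu : IsLocalMinimizer Ω p f (polyDensity Gα) u Du)
    (ε' : ℝ) (hε' : ε' = min ε (p / N - q / p)) :
    ∀ K : Set (EuclideanSpace ℝ (Fin N)), IsCompact K → K ⊆ Ω →
      ∃ C₁ C₂ R₀ : ℝ, 0 < C₁ ∧ 0 < C₂ ∧ 0 < R₀ ∧
        ∀ x₀ ∈ K, Metric.closedBall x₀ R₀ ⊆ Ω ∧
          ∀ (α : Fin n) (ρ R k : ℝ), 0 < ρ → ρ < R → R < R₀ →
            ((∫ x in superBall (fun y => u y α) x₀ k ρ, ‖Du x α‖ ^ p) ≤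
              C₁ / (R - ρ) ^ p * (∫ x in superBall (fun y => u y α) x₀ k R, (u x α - k) ^ p) +
                C₂ * (1 + |k| ^ p * R ^ (-(ε' * N))) *
                  volume.real (superBall (fun y => u y α) x₀ k R) ^ (1 - p / N + ε')) ∧
            ((∫ x in subBall (fun y => u y α) x₀ k ρ, ‖Du x α‖ ^ p) ≤
              C₁ / (R - ρ) ^ p * (∫ x in subBall (fun y => u y α) x₀ k R, (k - u x α) ^ p) +
                C₂ * (1 + |k| ^ p * R ^ (-(ε' * N))) *
                  volume.real (subBall (fun y => u y α) x₀ k R) ^ (1 - p / N + ε')) := by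
  intro K hK hKΩ
  have hp0 : 0 < p := by linarith
  -- q < p²/N is exactly the positivity of p/N − q/p.
  have hε'0 : 0 < ε' := by
    rw [hε', lt_min_iff, sub_pos, div_lt_iff₀ hp0, div_mul_eq_mul_div, ← pow_two]
    exact ⟨hF.ε_pos, hG.q_lt⟩
  have hε'ε : ε' ≤ ε := hε'.trans_le (min_le_left _ _)
  have hε'q : ε' ≤ p / N - q / p := hε'.trans_le (min_le_right _ _)
  choose A₁ A₂ A₀ hA₁ hA₂ hA₀ hA using fun α =>
    hu.exists_caccioppoli_superBall hΩ hp1 hpN hF hG hε'0 hε'ε hε'q α hK hKΩ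
  choose B₁ B₂ B₀ hB₁ hB₂ hB₀ hB using fun α =>
    hu.exists_caccioppoli_subBall hΩ hp1 hpN hF hG hε'0 hε'ε hε'q α hK hKΩ
  have hn : Nonempty (Fin n) := ⟨⟨0, by linarith [hPoly.two_le_n]⟩⟩
  obtain ⟨α₀, -, hα₀⟩ := Finset.univ.exists_min_image (fun α => min (A₀ α) (B₀ α))
    Finset.univ_nonempty
  -- Sums of positive constants serve as upper bounds for all components and both kinds of level
  -- sets; the radius is the smallest of the finitely many.
  refine ⟨∑ α, (A₁ α + B₁ α), ∑ α, (A₂ α + B₂ α), min (A₀ α₀) (B₀ α₀),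
    Finset.sum_pos (fun α _ => add_pos (hA₁ α) (hB₁ α)) Finset.univ_nonempty,
    Finset.sum_pos (fun α _ => add_pos (hA₂ α) (hB₂ α)) Finset.univ_nonempty,
    lt_min (hA₀ α₀) (hB₀ α₀), fun x₀ hx₀ => ?_⟩
  have hball : Metric.closedBall x₀ (min (A₀ α₀) (B₀ α₀)) ⊆ Ω :=
    (Metric.closedBall_subset_closedBall (min_le_left _ _)).trans (hA α₀ x₀ hx₀).1
  refine ⟨hball, fun α ρ R k hρ hρR hR => ?_⟩
  have h1 : A₁ α + B₁ α ≤ ∑ α, (A₁ α + B₁ α) := Finset.single_le_sum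
    (f := fun α => A₁ α + B₁ α) (fun α _ => (add_pos (hA₁ α) (hB₁ α)).le) (Finset.mem_univ α)
  have h2 : A₂ α + B₂ α ≤ ∑ α, (A₂ α + B₂ α) := Finset.single_le_sum
    (f := fun α => A₂ α + B₂ α) (fun α _ => (add_pos (hA₂ α) (hB₂ α)).le) (Finset.mem_univ α)
  have hRA : R < A₀ α := hR.trans_le ((hα₀ α (Finset.mem_univ α)).trans (min_le_left _ _))
  have hRB : R < B₀ α := hR.trans_le ((hα₀ α (Finset.mem_univ α)).trans (min_le_right _ _))
  have hRρ : 0 < (R - ρ) ^ p := Real.rpow_pos_of_pos (by linarith) _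
  have hR0 : 0 < R := hρ.trans hρR
  have hv : AEMeasurable (fun y => u y α) (volume.restrict (Metric.ball x₀ R)) := by
    have h : AEMeasurable u (volume.restrict (Metric.ball x₀ R)) :=
      (hu.isW1pLoc.memLp _ (isCompact_closedBall x₀ R)
        ((Metric.closedBall_subset_closedBall hR.le).trans hball)).1.aemeasurable.mono_measure
          (Measure.restrict_mono Metric.ball_subset_closedBall le_rfl)
    exact (EuclideanSpace.proj (𝕜 := ℝ) α).measurable.comp_aemeasurable h
  constructor
  · refine ((hA α x₀ hx₀).2 ρ R k hρ hρR hRA).trans ?_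
    have := integral_superBall_nonneg (k := k) (p := p) hv
    gcongr
    · linarith [hB₁ α]
    · linarith [hB₂ α]
  · refine ((hB α x₀ hx₀).2 ρ R k hρ hρR hRB).trans ?_
    have := integral_subBall_nonneg (k := k) (p := p) hv
    gcongr
    · linarith [hA₁ α]
    · linarith [hA₂ α]
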